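/- **Conventions.** For $\mathbb K=\mathbb R$ or $\mathbb C$, let $\mathrm H^n_{\mathbb K}$ be the space of negative lines in $\mathbb K^{n+1}$ for the form $\operatorname{diag}(1,\dots,1,-1)$, identified with the open unit ball of $\mathbb K^n$ by $z\mapsto[z:1]$; $\mathrm{O}(n,1)$ (resp. $\mathrm{U}(n,1)$) acts on it by projective transformations. Let $\iota:\mathrm{SO}(n,1)\to\mathrm{SU}(n,1)$ be the inclusion. A hyperbolic structure on a smooth connected $n$-manifold (or $n$-orbifold) is an atlas of smooth charts (local uniformizations) in $\mathrm H^n_{\mathbb R}$ whose changes of charts are locally restrictions of elements of $\mathrm{O}(n,1)$. It has a developing map $\mathrm{dev}$ from the universal (orbifold) covering to $\mathrm H^n_{\mathbb R}$, which in these charts is locally an isometry of $\mathrm H^n_{\mathbb R}$; the structure is complete if $\mathrm{dev}$ is a covering map. A homomorphism $\rho_{\rm hyp}$ from the (orbifold) fundamental group $\Gamma$ to $\mathrm{SO}(n,1)$ is the holonomy representation if $\mathrm{dev}(\gamma\cdot z)=\rho_{\rm hyp}(\gamma)\,\mathrm{dev}(z)$ for all $\gamma\in\Gamma$, where $\Gamma$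 acts on the universal covering by deck transformations. **Theorem.** Let $n\geqslant 2$. 1. Let $M$ be a complete hyperbolic $n$-manifold with holonomy representation $\rho_{\rm hyp}:\Gamma=\pi_1(M)\to\mathrm{SO}(n,1)$. Then $\iota(\rho_{\rm hyp}(\Gamma))$ acts freely and properly discontinuously on $\mathrm H^n_{\mathbb C}$, and the quotient manifold $\mathrm H^n_{\mathbb C}/\iota(\rho_{\rm hyp}(\Gamma))$ is diffeomorphic to the tangent bundle $TM$. 2. Let $Q$ be a complete hyperbolic $n$-orbifold, that is, a Hausdorff smooth orbifold with a complete hyperbolic structure, with universal orbifold covering a simply connected manifold on which the orbifold fundamental group $\Gamma=\pi_1^{\rm orb}(Q)$ acts faithfully and properly discontinuously by diffeomorphisms with quotient orbifold $Q$, and let $\rho_{\rm hyp}:\Gamma\to\mathrm{SO}(n,1)$ be its holonomy representation. Then $\iota(\rho_{\rm hyp}(\Gamma))$ acts properly discontinuously on $\mathrm H^n_{\mathbb C}$, and the quotient orbifold $\mathrm H^n_{\mathbb C}/\iota(\rho_{\rm hyp}(\Gamma))$ is diffeomorphic, as an orbifold, to the tangent orbibundle $TQ$, i.e. the orbifold glued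 from the products $U\times\mathbb R^n$, over the orbifold charts $U\subseteq\mathbb R^n$ of $Q$, by the differentials of the changes of charts. (A diffeomorphism of orbifolds is a homeomorphism of the underlying spaces that lifts locally to diffeomorphisms between charts.) -/

import Mathlib

open scoped Manifold ContDiff Topology Matrix
noncomputable section

/-- The Hermitian (over `ℝ`: symmetric) form `diag(1, …, 1, -1)` of signature `(n,1)`. -/
def lorentzForm (𝕜 : Type*) [RCLike 𝕜] (n : ℕ) : Matrix (Fin n ⊕ Unit) (Fin n ⊕ Unit) 𝕜 :=
  Matrix.fromBlocks 1 0 0 (-1)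

/-- The isometry group of the form of signature `(n,1)`:
`O(n,1)` for `𝕜 = ℝ`, and `U(n,1)` for `𝕜 = ℂ`. -/
def pseudoUnitary (𝕜 : Type*) [RCLike 𝕜] (n : ℕ) : Subgroup (GL (Fin n ⊕ Unit) 𝕜) where
  carrier := {g | g.valᴴ * lorentzForm 𝕜 n * g.val = lorentzForm 𝕜 n}
  one_mem' := by simp
  mul_mem' := by
    intro a b ha hb
    simp only [Set.mem_ofPred_eq] at ha hb ⊢
    rw [Units.val_mul, Matrix.conjTranspose_mul]
    calc _ = b.valᴴ * (a.valᴴ * lorentzForm 𝕜 n * a.val) * b.val := by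
            simp only [Matrix.mul_assoc]
      _ = _ := by rw [ha, hb]
  inv_mem' := by
    intro a ha
    simp only [Set.mem_ofPred_eq] at ha ⊢
    have h1 : a.val * (a⁻¹).val = 1 := a.mul_inv
    have h2 := congrArg Matrix.conjTranspose h1
    rw [Matrix.conjTranspose_mul, Matrix.conjTranspose_one] at h2
    conv_lhs => rw [← ha]
    calc _ = ((a⁻¹).valᴴ * a.valᴴ) * lorentzForm 𝕜 n * (a.val * (a⁻¹).val) := by
            simp only [Matrix.mul_assoc]
      _ = _ := by rw [h1, h2]; simp

/-- The elements of determinant one: `SO(n,1)` for `𝕜 = ℝ`, and `SU(n,1)` for `𝕜 = ℂ`. -/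
def specialPseudoUnitary (𝕜 : Type*) [RCLike 𝕜] (n : ℕ) : Subgroup (pseudoUnitary 𝕜 n) :=
  (Matrix.GeneralLinearGroup.det.comp (pseudoUnitary 𝕜 n).subtype).ker

lemma map_lorentz {n : ℕ} {g : GL (Fin n ⊕ Unit) ℝ} (hg : g ∈ pseudoUnitary ℝ n) :
    Matrix.GeneralLinearGroup.map (algebraMap ℝ ℂ) g ∈ pseudoUnitary ℂ n := by
  have hg' : g.valᴴ * lorentzForm ℝ n * g.val = lorentzForm ℝ n := hg
  have hJ : (lorentzForm ℝ n).map (algebraMap ℝ ℂ) = lorentzForm ℂ n := by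
    ext i j
    rcases i with i | i <;> rcases j with j | j <;>
      simp [lorentzForm, Matrix.one_apply, apply_ite]
  have h := congrArg (fun A => A.map (algebraMap ℝ ℂ)) hg'
  simp only [Matrix.map_mul, hJ] at h
  have hc : (g.valᴴ).map (algebraMap ℝ ℂ) = (g.val.map (algebraMap ℝ ℂ))ᴴ := by
    ext i j
    simp
  rw [hc] at h
  exact h

/-- The inclusion `ι : SO(n,1) → SU(n,1)`: a real matrix is regarded as a complex one. -/
def iotaSO (n : ℕ) : specialPseudoUnitary ℝ n →* specialPseudoUnitary ℂ n :=
  ((((Matrix.GeneralLinearGroup.map (algebraMap ℝ ℂ)).comp (pseudoUnitary ℝ n).subtype).codRestrict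
    (pseudoUnitary ℂ n) (fun g => map_lorentz g.2)).comp
      (specialPseudoUnitary ℝ n).subtype).codRestrict (specialPseudoUnitary ℂ n) (by
    intro g
    have h : Matrix.GeneralLinearGroup.det ((g : pseudoUnitary ℝ n) : GL (Fin n ⊕ Unit) ℝ) = 1 :=
      g.2
    change Matrix.GeneralLinearGroup.det (Matrix.GeneralLinearGroup.map (algebraMap ℝ ℂ)
      ((g : pseudoUnitary ℝ n) : GL (Fin n ⊕ Unit) ℝ)) = 1
    rw [Matrix.GeneralLinearGroup.map_det, h, map_one])

/-- The open unit ball of `𝕜ⁿ`. -/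
def hypBall (𝕜 : Type*) [RCLike 𝕜] (n : ℕ) :
    TopologicalSpace.Opens (EuclideanSpace 𝕜 (Fin n)) :=
  ⟨Metric.ball 0 1, Metric.isOpen_ball⟩

/-- Hyperbolic space `H^n_𝕜`, the space of lines in `𝕜^{n+1}` that are negative for the form of
signature `(n,1)`. A point `z` of the unit ball stands for the line spanned by `(z, 1)`; every
negative line is of this form for exactly one `z`. -/
abbrev HypSpace (𝕜 : Type*) [RCLike 𝕜] (n : ℕ) : Type _ := ↥(hypBall 𝕜 n)

section Action
variable {𝕜 : Type*} [RCLike 𝕜] {n : ℕ}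

/-- The vector `(z, 1)`. -/
def homVec (z : EuclideanSpace 𝕜 (Fin n)) : Fin n ⊕ Unit → 𝕜 := Sum.elim z (fun _ => 1)

/-- The projective transformation of a matrix in the affine chart `z ↦ [z : 1]`. -/
def projMap (g : Matrix (Fin n ⊕ Unit) (Fin n ⊕ Unit) 𝕜) (z : EuclideanSpace 𝕜 (Fin n)) :
    EuclideanSpace 𝕜 (Fin n) :=
  WithLp.toLp 2 fun i => (g *ᵥ homVec z) (Sum.inl i) / (g *ᵥ homVec z) (Sum.inr ())

lemma form_apply (v : Fin n ⊕ Unit → 𝕜) :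
    star v ⬝ᵥ (lorentzForm 𝕜 n *ᵥ v)
      = (((∑ i, ‖v (Sum.inl i)‖ ^ 2) - ‖v (Sum.inr ())‖ ^ 2 : ℝ) : 𝕜) := by
  have h : lorentzForm 𝕜 n *ᵥ v = Sum.elim (fun i => v (Sum.inl i)) (fun i => - v (Sum.inr i)) := by
    rw [lorentzForm, Matrix.fromBlocks_mulVec]
    ext i
    rcases i with i | i <;> simp [Matrix.neg_mulVec]
  rw [h, dotProduct, Fintype.sum_sum_type]
  simp [RCLike.conj_mul, sub_eq_add_neg]

lemma form_preserved {g : GL (Fin n ⊕ Unit) 𝕜} (hg : g ∈ pseudoUnitary 𝕜 n)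
    (v : Fin n ⊕ Unit → 𝕜) :
    (∑ i, ‖(g.val *ᵥ v) (Sum.inl i)‖ ^ 2) - ‖(g.val *ᵥ v) (Sum.inr ())‖ ^ 2
      = (∑ i, ‖v (Sum.inl i)‖ ^ 2) - ‖v (Sum.inr ())‖ ^ 2 := by
  have hg' : g.valᴴ * lorentzForm 𝕜 n * g.val = lorentzForm 𝕜 n := hg
  have h : star (g.val *ᵥ v) ⬝ᵥ (lorentzForm 𝕜 n *ᵥ (g.val *ᵥ v))
      = star v ⬝ᵥ (lorentzForm 𝕜 n *ᵥ v) := by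
    conv_rhs => rw [← hg']
    rw [Matrix.star_mulVec, ← Matrix.dotProduct_mulVec, Matrix.mulVec_mulVec, Matrix.mulVec_mulVec,
      Matrix.mul_assoc]
  rw [form_apply, form_apply] at h
  exact_mod_cast h

lemma form_homVec_neg {z : EuclideanSpace 𝕜 (Fin n)} (hz : z ∈ hypBall 𝕜 n) :
    (∑ i, ‖homVec z (Sum.inl i)‖ ^ 2) - ‖homVec z (Sum.inr ())‖ ^ 2 < 0 := by
  have h1 : ‖z‖ < 1 := by simpa [hypBall] using hz
  have h2 : ‖z‖ ^ 2 < 1 := by nlinarith [norm_nonneg z]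
  rw [EuclideanSpace.norm_sq_eq] at h2
  simpa [homVec] using h2

lemma projMap_denom_ne {g : GL (Fin n ⊕ Unit) 𝕜} (hg : g ∈ pseudoUnitary 𝕜 n)
    {z : EuclideanSpace 𝕜 (Fin n)} (hz : z ∈ hypBall 𝕜 n) :
    (g.val *ᵥ homVec z) (Sum.inr ()) ≠ 0 := by
  intro h
  have h1 := form_homVec_neg hz
  rw [← form_preserved hg, h] at h1
  have : 0 ≤ ∑ i, ‖(g.val *ᵥ homVec z) (Sum.inl i)‖ ^ 2 := by positivity
  simp at h1
  linarith

lemma projMap_mem {g : GL (Fin n ⊕ Unit) 𝕜} (hg : g ∈ pseudoUnitary 𝕜 n)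
    {z : EuclideanSpace 𝕜 (Fin n)} (hz : z ∈ hypBall 𝕜 n) : projMap g.val z ∈ hypBall 𝕜 n := by
  have h0 := projMap_denom_ne hg hz
  have h1 := form_homVec_neg hz
  rw [← form_preserved hg] at h1
  have h2 : ‖projMap g.val z‖ ^ 2 < 1 := by
    rw [EuclideanSpace.norm_sq_eq]
    simp only [projMap, norm_div, div_pow]
    rw [← Finset.sum_div, div_lt_one (by positivity)]
    linarith
  have h3 : ‖projMap g.val z‖ < 1 := by
    by_contra h
    push Not at h
    nlinarith
  simpa [hypBall] using h3

lemma homVec_projMap {g : GL (Fin n ⊕ Unit) 𝕜} (hg : g ∈ pseudoUnitary 𝕜 n)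
    {z : EuclideanSpace 𝕜 (Fin n)} (hz : z ∈ hypBall 𝕜 n) :
    homVec (projMap g.val z)
      = ((g.val *ᵥ homVec z) (Sum.inr ()))⁻¹ • (g.val *ᵥ homVec z) := by
  have h0 := projMap_denom_ne hg hz
  ext i
  rcases i with i | i
  · simp [homVec, projMap, div_eq_inv_mul]
  · simp only [homVec, Sum.elim_inr, Pi.smul_apply, smul_eq_mul]
    exact (inv_mul_cancel₀ h0).symm

/-- The action of `O(n,1)` on `H^n_ℝ`, respectively of `U(n,1)` on `H^n_ℂ`, that is induced by the
linear action on negative lines. -/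
instance : MulAction (pseudoUnitary 𝕜 n) (HypSpace 𝕜 n) where
  smul g z := ⟨projMap g.1.val z.1, projMap_mem g.2 z.2⟩
  one_smul z := by
    apply Subtype.ext
    change projMap (1 : Matrix _ _ 𝕜) z.1 = z.1
    ext i
    simp [projMap, homVec]
  mul_smul g h z := by
    apply Subtype.ext
    change projMap (g.1.val * h.1.val) z.1 = projMap g.1.val (projMap h.1.val z.1)
    have h0 := projMap_denom_ne h.2 z.2
    ext i
    simp only [projMap]
    rw [show (WithLp.toLp 2 fun i => (h.1.val *ᵥ homVec z.1) (Sum.inl i)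
      / (h.1.val *ᵥ homVec z.1) (Sum.inr ())) = projMap h.1.val z.1 from rfl,
      homVec_projMap h.2 z.2, Matrix.mulVec_smul, Matrix.mulVec_mulVec]
    simp only [Pi.smul_apply, smul_eq_mul]
    rw [mul_div_mul_left _ _ (inv_ne_zero h0)]

lemma projMap_contDiffOn {g : GL (Fin n ⊕ Unit) 𝕜} (hg : g ∈ pseudoUnitary 𝕜 n) :
    ContDiffOn ℝ ∞ (projMap g.val) (hypBall 𝕜 n : Set (EuclideanSpace 𝕜 (Fin n))) := by
  have key : ∀ j, ContDiff ℝ ∞ fun z : EuclideanSpace 𝕜 (Fin n) => (g.val *ᵥ homVec z) j := by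
    intro j
    simp only [Matrix.mulVec, dotProduct, Fintype.sum_sum_type, homVec, Sum.elim_inl, Sum.elim_inr]
    refine ContDiff.add (ContDiff.sum fun i _ => contDiff_const.mul ?_) contDiff_const
    exact (EuclideanSpace.proj (𝕜 := 𝕜) i : _ →L[𝕜] 𝕜).restrictScalars ℝ |>.contDiff
  rw [contDiffOn_piLp]
  intro i
  simp only [projMap, div_eq_mul_inv]
  exact (key _).contDiffOn.mul ((key _).contDiffOn.inv fun z hz => projMap_denom_ne hg hz)

instance : ContinuousConstSMul (pseudoUnitary 𝕜 n) (HypSpace 𝕜 n) where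
  continuous_const_smul g :=
    Continuous.subtype_mk (continuousOn_iff_continuous_domRestrict.1
      (projMap_contDiffOn g.2).continuousOn) _

instance : LocallyCompactSpace (HypSpace 𝕜 n) :=
  (hypBall 𝕜 n).isOpen.locallyCompactSpace

end Action

instance subgroupContinuousConstSMul {G X : Type*} [Group G] [TopologicalSpace X] [MulAction G X]
    [ContinuousConstSMul G X] (S : Subgroup G) : ContinuousConstSMul S X :=
  ⟨fun g => continuous_const_smul (g : G)⟩


/-! ### Orbifolds -/

section Orbifold

/-- `h` is a diffeomorphism between open subsets of the manifolds `N₁` and `N₂`, contained in `U₁`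
and `U₂`, that covers the map `f : Q₁ → Q₂` with respect to the maps `p₁ : U₁ → Q₁` and
`p₂ : U₂ → Q₂`. -/
structure IsSmoothLift (E₁ E₂ : Type*) {N₁ N₂ Q₁ Q₂ : Type*}
    [NormedAddCommGroup E₁] [NormedSpace ℝ E₁] [NormedAddCommGroup E₂] [NormedSpace ℝ E₂]
    [TopologicalSpace N₁] [ChartedSpace E₁ N₁] [TopologicalSpace N₂] [ChartedSpace E₂ N₂]
    {U₁ : TopologicalSpace.Opens N₁} {U₂ : TopologicalSpace.Opens N₂} (p₁ : U₁ → Q₁) (p₂ : U₂ → Q₂) (f : Q₁ → Q₂)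
    (h : OpenPartialHomeomorph N₁ N₂) : Prop where
  source_subset : h.source ⊆ (U₁ : Set N₁)
  target_subset : h.target ⊆ (U₂ : Set N₂)
  smooth : ContMDiffOn 𝓘(ℝ, E₁) 𝓘(ℝ, E₂) ∞ h h.source
  smooth_symm : ContMDiffOn 𝓘(ℝ, E₂) 𝓘(ℝ, E₁) ∞ h.symm h.target
  comm : ∀ (x : U₁) (y : U₂), x.1 ∈ h.source → h x.1 = y.1 → p₂ y = f (p₁ x)

/-- `q : U → Q` is an orbifold chart: `U` is an open subset of the vector space `E`, and there is a
finite group of diffeomorphisms of `U` such that `q` induces a homeomorphism from the orbit space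
onto an open subset of `Q`. -/
structure IsOrbifoldChart {E Q : Type*} [NormedAddCommGroup E] [NormedSpace ℝ E]
    [TopologicalSpace Q] (U : TopologicalSpace.Opens E) (q : U → Q) : Prop where
  continuous : Continuous q
  isOpenMap : IsOpenMap q
  exists_group : ∃ G : Subgroup (Equiv.Perm U), Finite G ∧
    (∀ g ∈ G, ∃ f : E → E, ContDiffOn ℝ ∞ f U ∧ ∀ x : U, f x = g x) ∧
    ∀ x y : U, q x = q y ↔ ∃ g ∈ G, g x = y

/-- A smooth orbifold structure on the space `Q`, modelled on the vector space `E`: an atlas of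
orbifold charts such that any two charts are related, near any two points that lie over the same
point of `Q`, by a local diffeomorphism over `Q`. -/
structure Orbifold (E : Type*) [NormedAddCommGroup E] [NormedSpace ℝ E]
    (Q : Type*) [TopologicalSpace Q] where
  ι : Type*
  dom : ι → TopologicalSpace.Opens E
  chart : ∀ i, dom i → Q
  isChart : ∀ i, IsOrbifoldChart (dom i) (chart i)
  cover : ∀ y : Q, ∃ (i : ι) (x : dom i), chart i x = y
  compatible : ∀ (i j : ι) (x : dom i) (y : dom j), chart i x = chart j y →
    ∃ h : OpenPartialHomeomorph E E,
      IsSmoothLift E E (chart i) (chart j) id h ∧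
        x.1 ∈ h.source ∧ h x.1 = y.1

/-- A diffeomorphism of orbifolds: a homeomorphism of the underlying spaces that lifts locally to
diffeomorphisms of the charts. -/
structure OrbifoldDiffeo {E₁ E₂ Q₁ Q₂ : Type*}
    [NormedAddCommGroup E₁] [NormedSpace ℝ E₁] [NormedAddCommGroup E₂] [NormedSpace ℝ E₂]
    [TopologicalSpace Q₁] [TopologicalSpace Q₂] (O₁ : Orbifold E₁ Q₁) (O₂ : Orbifold E₂ Q₂) where
  toHomeomorph : Q₁ ≃ₜ Q₂
  exists_lift : ∀ (i : O₁.ι) (j : O₂.ι) (x : O₁.dom i) (y : O₂.dom j),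
    toHomeomorph (O₁.chart i x) = O₂.chart j y →
    ∃ h : OpenPartialHomeomorph E₁ E₂,
      IsSmoothLift E₁ E₂ (O₁.chart i) (O₂.chart j) toHomeomorph h ∧ x.1 ∈ h.source ∧ h x.1 = y.1

variable {E : Type*} [NormedAddCommGroup E] [NormedSpace ℝ E]

/-! #### The quotient orbifold -/

section Quotient
variable (X : TopologicalSpace.Opens E) (Γ : Type*) [Group Γ] [MulAction Γ X]

/-- An open set `U ⊆ X` is adapted to the action of `Γ` if a finite subgroup of `Γ` preserves `U`
and all other elements of `Γ` move `U` off itself. -/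
def IsAdapted {E : Type*} [NormedAddCommGroup E] (X : TopologicalSpace.Opens E) (Γ : Type*)
    [Group Γ] [MulAction Γ X] (U : TopologicalSpace.Opens E) : Prop :=
  ∃ H : Subgroup Γ, Finite H ∧ (∀ γ ∈ H, ∀ x : X, x.1 ∈ U → (γ • x).1 ∈ U) ∧
    ∀ (γ : Γ) (x : X), x.1 ∈ U → (γ • x).1 ∈ U → γ ∈ H

variable {X Γ}

lemma IsAdapted.isOrbifoldChart [ContinuousConstSMul Γ X]
    (hs : ∀ γ : Γ, ∃ f : E → E, ContDiffOn ℝ ∞ f X ∧ ∀ x : X, f x = (γ • x).1)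
    {U : TopologicalSpace.Opens E} (hU : U ≤ X) (hA : IsAdapted X Γ U) :
    IsOrbifoldChart U
      (fun x : U => (Quotient.mk _ (⟨x.1, hU x.2⟩ : X) : MulAction.orbitRel.Quotient Γ X)) := by
  obtain ⟨H, hfin, hH, hH'⟩ := hA
  have hinc : Continuous fun x : U => (⟨x.1, hU x.2⟩ : X) := by fun_prop
  have hinco : IsOpenMap fun x : U => (⟨x.1, hU x.2⟩ : X) := by
    intro s hs
    have h1 : IsOpen (Subtype.val '' s : Set E) := U.isOpen.isOpenMap_subtype_val s hs
    convert h1.preimage (continuous_subtype_val (p := fun x => x ∈ X)) using 1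
    ext y
    constructor
    · rintro ⟨x, hx, rfl⟩
      exact ⟨x, hx, rfl⟩
    · rintro ⟨x, hx, hxy⟩
      exact ⟨x, hx, Subtype.ext hxy⟩
  refine ⟨continuous_quotient_mk'.comp hinc,
    (isOpenMap_quotient_mk'_mul (Γ := Γ) (T := X)).comp hinco, ?_⟩
  let act : MulAction H U :=
    { smul := fun γ x => ⟨((γ : Γ) • (⟨x.1, hU x.2⟩ : X)).1, hH γ.1 γ.2 _ x.2⟩
      one_smul := fun x => Subtype.ext (by
        change (((1 : H) : Γ) • (⟨x.1, hU x.2⟩ : X)).1 = x.1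
        simp)
      mul_smul := fun γ δ x => Subtype.ext (by
        change (((γ * δ : H) : Γ) • (⟨x.1, hU x.2⟩ : X)).1
          = ((γ : Γ) • ((δ : Γ) • (⟨x.1, hU x.2⟩ : X))).1
        rw [Subgroup.coe_mul, mul_smul]) }
  have hact : ∀ (γ : H) (x : U), (γ • x).1 = ((γ : Γ) • (⟨x.1, hU x.2⟩ : X)).1 :=
    fun _ _ => rfl
  refine ⟨(MulAction.toPermHom H U).range,
    Finite.of_surjective _ (MulAction.toPermHom H U).rangeRestrict_surjective, ?_, ?_⟩
  · rintro _ ⟨γ, rfl⟩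
    obtain ⟨f, hf, hfx⟩ := hs γ
    exact ⟨f, hf.mono hU, fun x => hfx ⟨x.1, hU x.2⟩⟩
  · intro x y
    rw [Quotient.eq, MulAction.orbitRel_apply, MulAction.mem_orbit_iff]
    constructor
    · rintro ⟨γ, hγ⟩
      have h1 : γ⁻¹ • (⟨x.1, hU x.2⟩ : X) = ⟨y.1, hU y.2⟩ := by rw [← hγ, inv_smul_smul]
      have h2 : (γ⁻¹ • (⟨x.1, hU x.2⟩ : X)).1 = y.1 := congrArg Subtype.val h1
      have h3 : γ⁻¹ ∈ H := hH' γ⁻¹ ⟨x.1, hU x.2⟩ x.2 (by rw [h2]; exact y.2)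
      refine ⟨MulAction.toPermHom H U ⟨γ⁻¹, h3⟩, ⟨⟨γ⁻¹, h3⟩, rfl⟩, Subtype.ext h2⟩
    · rintro ⟨_, ⟨γ, rfl⟩, rfl⟩
      refine ⟨(γ : Γ)⁻¹, ?_⟩
      rw [inv_smul_eq_iff]
      rfl

lemma exists_isAdapted {E : Type*} [NormedAddCommGroup E] {X : TopologicalSpace.Opens E}
    {Γ : Type*} [Group Γ] [MulAction Γ X] [T2Space X] [LocallyCompactSpace X] [ContinuousConstSMul Γ X]
    [ProperlyDiscontinuousSMul Γ X] (x : X) :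
    ∃ U : TopologicalSpace.Opens E, U ≤ X ∧ IsAdapted X Γ U ∧ x.1 ∈ U := by
  obtain ⟨V, hV, hVx⟩ := ProperlyDiscontinuousSMul.exists_nhds_image_smul_eq_self Γ x
  obtain ⟨W, hWV, hW, hxW⟩ := mem_nhds_iff.1 hV
  let H := MulAction.stabilizer Γ x
  have hfin : Finite H :=
    (ProperlyDiscontinuousSMul.finite_stabilizer' Γ x : {γ : Γ | γ • x = x}.Finite)
  let A : Set X := ⋂ γ : H, (fun y : X => (γ : Γ) • y) ⁻¹' W
  have hA : IsOpen A := isOpen_iInter_of_finite fun γ => hW.preimage (continuous_const_smul _)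
  have hmem : ∀ y : X, y ∈ A ↔ ∀ γ ∈ H, γ • y ∈ W := by
    intro y
    simp [A]
  refine ⟨⟨Subtype.val '' A, X.isOpen.isOpenMap_subtype_val A hA⟩, ?_, ⟨H, hfin, ?_, ?_⟩, ?_⟩
  · rintro _ ⟨y, _, rfl⟩
    exact y.2
  · rintro γ hγ y ⟨y', hy', hyy'⟩
    obtain rfl : y' = y := Subtype.ext hyy'
    refine ⟨γ • y', (hmem _).2 fun δ hδ => ?_, rfl⟩
    rw [← mul_smul]
    exact (hmem _).1 hy' _ (H.mul_mem hδ hγ)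
  · rintro γ y ⟨y', hy', hyy'⟩ ⟨w, hw, hwy⟩
    obtain rfl : y' = y := Subtype.ext hyy'
    obtain rfl : w = γ • y' := Subtype.ext hwy
    refine hVx γ ⟨γ • y', ⟨y', hWV ?_, rfl⟩, hWV ?_⟩
    · simpa using (hmem _).1 hy' 1 H.one_mem
    · simpa using (hmem _).1 hw 1 H.one_mem
  · refine ⟨x, (hmem _).2 fun γ hγ => ?_, rfl⟩
    rw [show γ • x = x from hγ]
    exact hxW

/-- The orbifold `X / Γ`, for a properly discontinuous action of a group `Γ` by diffeomorphisms on
an open subset `X` of `E`. Its charts are the restrictions of the projection `X → X / Γ` to the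
adapted open sets. -/
def quotientOrbifold [T2Space X] [LocallyCompactSpace X] [ContinuousConstSMul Γ X]
    [ProperlyDiscontinuousSMul Γ X]
    (hs : ∀ γ : Γ, ∃ f : E → E, ContDiffOn ℝ ∞ f X ∧ ∀ x : X, f x = (γ • x).1) :
    Orbifold E (MulAction.orbitRel.Quotient Γ X) where
  ι := {U : TopologicalSpace.Opens E // U ≤ X ∧ IsAdapted X Γ U}
  dom U := U.1
  chart U x := Quotient.mk _ ⟨x.1, U.2.1 x.2⟩
  isChart U := U.2.2.isOrbifoldChart hs U.2.1
  cover y := by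
    induction y using Quotient.inductionOn with | _ x
    obtain ⟨U, hU, hA, hx⟩ := exists_isAdapted (Γ := Γ) x
    exact ⟨⟨U, hU, hA⟩, ⟨x.1, hx⟩, rfl⟩
  compatible := by
    rintro ⟨U, hU, hUA⟩ ⟨V, hV, hVA⟩ x y hxy
    rw [Quotient.eq, MulAction.orbitRel_apply, MulAction.mem_orbit_iff] at hxy
    obtain ⟨γ, hγ⟩ := hxy
    have h1 : γ⁻¹ • (⟨x.1, hU x.2⟩ : X) = ⟨y.1, hV y.2⟩ := by rw [← hγ, inv_smul_smul]
    obtain ⟨f, hf, hfx⟩ := hs γ⁻¹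
    obtain ⟨f', hf', hfx'⟩ := hs γ
    have hff' : ∀ z ∈ X, f' (f z) = z := fun z hz => by
      rw [hfx ⟨z, hz⟩, hfx', smul_inv_smul]
    have hf'f : ∀ z ∈ X, f (f' z) = z := fun z hz => by
      rw [hfx' ⟨z, hz⟩, hfx, inv_smul_smul]
    have hfX : ∀ z ∈ X, f z ∈ X := fun z hz => by
      rw [hfx ⟨z, hz⟩]; exact Subtype.prop _
    have hf'X : ∀ z ∈ X, f' z ∈ X := fun z hz => by
      rw [hfx' ⟨z, hz⟩]; exact Subtype.prop _
    let h : OpenPartialHomeomorph E E :=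
      { toFun := f
        invFun := f'
        source := (X : Set E) ∩ f ⁻¹' V ∩ U
        target := (X : Set E) ∩ f' ⁻¹' U ∩ V
        map_source' := fun z hz =>
          ⟨⟨hfX z hz.1.1, by rw [Set.mem_preimage, hff' z hz.1.1]; exact hz.2⟩, hz.1.2⟩
        map_target' := fun z hz =>
          ⟨⟨hf'X z hz.1.1, by rw [Set.mem_preimage, hf'f z hz.1.1]; exact hz.2⟩, hz.1.2⟩
        left_inv' := fun z hz => hff' z hz.1.1
        right_inv' := fun z hz => hf'f z hz.1.1
        open_source := (hf.continuousOn.isOpen_inter_preimage X.isOpen V.isOpen).inter U.isOpen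
        open_target := (hf'.continuousOn.isOpen_inter_preimage X.isOpen U.isOpen).inter V.isOpen
        continuousOn_toFun := hf.continuousOn.mono fun z hz => hz.1.1
        continuousOn_invFun := hf'.continuousOn.mono fun z hz => hz.1.1 }
    have hfxy : f x.1 = y.1 := (hfx ⟨x.1, hU x.2⟩).trans (congrArg Subtype.val h1)
    refine ⟨h, ⟨fun z hz => hz.2, fun z hz => hz.2, ?_, ?_, ?_⟩, ⟨⟨hU x.2, ?_⟩, x.2⟩, hfxy⟩
    · exact contMDiffOn_iff_contDiffOn.2 (hf.mono fun z hz => hz.1.1)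
    · exact contMDiffOn_iff_contDiffOn.2 (hf'.mono fun z hz => hz.1.1)
    · intro z w _ hzw
      rw [id, Quotient.eq, MulAction.orbitRel_apply, MulAction.mem_orbit_iff]
      refine ⟨γ⁻¹, Subtype.ext ?_⟩
      rw [← hfx ⟨z.1, hU z.2⟩]
      exact hzw
    · rw [Set.mem_preimage, hfxy]
      exact y.2

end Quotient

/-! #### The tangent orbibundle -/

lemma lift_hasFDerivAt {Q : Type*} {U₁ U₂ : TopologicalSpace.Opens E} {p₁ : U₁ → Q} {p₂ : U₂ → Q}
    {h : OpenPartialHomeomorph E E} (hh : IsSmoothLift E E p₁ p₂ id h) {x : E}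
    (hx : x ∈ h.source) : HasFDerivAt h (fderiv ℝ h x) x :=
  (((contMDiffOn_iff_contDiffOn.1 hh.smooth).contDiffAt
    (h.open_source.mem_nhds hx)).differentiableAt (by simp)).hasFDerivAt

lemma lift_symm {Q : Type*} {U₁ U₂ : TopologicalSpace.Opens E} {p₁ : U₁ → Q} {p₂ : U₂ → Q}
    {h : OpenPartialHomeomorph E E} (hh : IsSmoothLift E E p₁ p₂ id h) :
    IsSmoothLift E E p₂ p₁ id h.symm where
  source_subset := hh.target_subset
  target_subset := hh.source_subset
  smooth := hh.smooth_symm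
  smooth_symm := hh.smooth
  comm x y hx hxy := by
    have hy : y.1 ∈ h.source := hxy ▸ h.map_target hx
    exact (hh.comm y x hy (by rw [← hxy]; exact h.right_inv hx)).symm

lemma lift_trans {Q : Type*} {U₁ U₂ U₃ : TopologicalSpace.Opens E} {p₁ : U₁ → Q} {p₂ : U₂ → Q} {p₃ : U₃ → Q}
    {h k : OpenPartialHomeomorph E E} (hh : IsSmoothLift E E p₁ p₂ id h)
    (hk : IsSmoothLift E E p₂ p₃ id k) : IsSmoothLift E E p₁ p₃ id (h.trans k) where
  source_subset x hx := hh.source_subset (by simp at hx; exact hx.1)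
  target_subset x hx := hk.target_subset (by simp at hx; exact hx.1)
  smooth := by
    refine hk.smooth.comp (hh.smooth.mono ?_) ?_ <;> intro x hx <;> simp at hx
    exacts [hx.1, hx.2]
  smooth_symm := by
    refine hh.smooth_symm.comp (hk.smooth_symm.mono ?_) ?_ <;> intro x hx <;> simp at hx
    exacts [hx.1, hx.2]
  comm x y hx hxy := by
    simp at hx
    rw [hk.comm ⟨h x.1, hk.source_subset hx.2⟩ y hx.2 hxy,
      hh.comm x ⟨h x.1, hk.source_subset hx.2⟩ hx.1 rfl]
    rfl

lemma lift_fderiv_symm {Q : Type*} {U₁ U₂ : TopologicalSpace.Opens E} {p₁ : U₁ → Q} {p₂ : U₂ → Q}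
    {h : OpenPartialHomeomorph E E} (hh : IsSmoothLift E E p₁ p₂ id h) {x : E}
    (hx : x ∈ h.source) (v : E) : fderiv ℝ h.symm (h x) (fderiv ℝ h x v) = v := by
  have h1 := (lift_hasFDerivAt (lift_symm hh) (h.map_source hx)).comp x (lift_hasFDerivAt hh hx)
  have h2 : HasFDerivAt (h.symm ∘ h) (ContinuousLinearMap.id ℝ E) x :=
    (hasFDerivAt_id x).congr_of_eventuallyEq (by
      filter_upwards [h.open_source.mem_nhds hx] with z hz using h.left_inv hz)
  simpa using DFunLike.congr_fun (h1.unique h2) v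

namespace Orbifold
variable {Q : Type*} [TopologicalSpace Q] (O : Orbifold E Q)

/-- Tangent vectors in the charts of an orbifold. -/
abbrev ChartVector : Type _ := Σ i : O.ι, (O.dom i) × E

/-- Two tangent vectors in charts are identified if the differential of a local diffeomorphism over
`Q` between the two charts maps one to the other. -/
def tangentRel (a b : O.ChartVector) : Prop :=
  ∃ h : OpenPartialHomeomorph E E,
    IsSmoothLift E E (O.chart a.1) (O.chart b.1) id h ∧
    a.2.1.1 ∈ h.source ∧ h a.2.1.1 = b.2.1.1 ∧ fderiv ℝ h a.2.1.1 a.2.2 = b.2.2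


/-- The relation that identifies tangent vectors in charts is an equivalence relation. -/
def tangentSetoid : Setoid O.ChartVector where
  r := O.tangentRel
  iseqv :=
    { refl := fun a => by
        refine ⟨OpenPartialHomeomorph.ofSet (O.dom a.1 : Set E) (O.dom a.1).isOpen,
          ⟨fun x hx => hx, fun x hx => hx, contMDiffOn_id, contMDiffOn_id, ?_⟩, a.2.1.2, rfl, ?_⟩
        · intro x y _ hxy
          exact congrArg _ (Subtype.ext hxy).symm
        · simp
      symm := by
        rintro ⟨i, x, v⟩ ⟨j, y, w⟩ ⟨h, hh, hx, hxy, hvw⟩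
        dsimp only at hx hxy hvw
        refine ⟨h.symm, lift_symm hh, ?_, ?_, ?_⟩ <;> dsimp only
        · rw [← hxy]; exact h.map_source hx
        · rw [← hxy]; exact h.left_inv hx
        · rw [← hxy, ← hvw, lift_fderiv_symm hh hx]
      trans := by
        rintro ⟨i, x, v⟩ ⟨j, y, w⟩ ⟨l, z, u⟩ ⟨h, hh, hx, hxy, hvw⟩ ⟨k, hk, hy, hyz, hwu⟩
        dsimp only at hx hxy hvw hy hyz hwu
        have hy' : h x.1 ∈ k.source := by rwa [hxy]
        refine ⟨h.trans k, lift_trans hh hk, ?_, ?_, ?_⟩ <;> dsimp only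
        · simp [hx, hy']
        · simp [hxy, hyz]
        · have h1 := (lift_hasFDerivAt hk hy').comp x.1 (lift_hasFDerivAt hh hx)
          rw [show ⇑(h.trans k) = k ∘ h from rfl, h1.fderiv]
          simp [hvw, hxy, hwu] }

/-- The total space of the tangent orbibundle. -/
def TangentTotal : Type _ := Quotient O.tangentSetoid

instance : TopologicalSpace O.TangentTotal :=
  inferInstanceAs (TopologicalSpace (Quotient O.tangentSetoid))

/-- The domain `U × E` of the chart of the tangent orbibundle that comes from a chart with
domain `U`. -/
def tangentDom (i : O.ι) : TopologicalSpace.Opens (E × E) :=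
  ⟨(O.dom i : Set E) ×ˢ Set.univ, (O.dom i).isOpen.prod isOpen_univ⟩

/-- The chart of the tangent orbibundle that comes from a chart of the orbifold. -/
def tangentChart (i : O.ι) (a : O.tangentDom i) : O.TangentTotal :=
  Quotient.mk O.tangentSetoid ⟨i, ⟨a.1.1, a.2.1⟩, a.1.2⟩

lemma tangentChart_eq_iff (i j : O.ι) (a : O.tangentDom i) (b : O.tangentDom j) :
    O.tangentChart i a = O.tangentChart j b ↔ ∃ h : OpenPartialHomeomorph E E,
      IsSmoothLift E E (O.chart i) (O.chart j) id h ∧ a.1.1 ∈ h.source ∧ h a.1.1 = b.1.1 ∧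
        fderiv ℝ h a.1.1 a.1.2 = b.1.2 := by
  exact Quotient.eq (r := O.tangentSetoid)

lemma contDiffOn_tangentMap {f : E → E} {s : Set E} (hs : IsOpen s) (hf : ContDiffOn ℝ ∞ f s) :
    ContDiffOn ℝ ∞ (fun a : E × E => (f a.1, fderiv ℝ f a.1 a.2)) (s ×ˢ Set.univ) := by
  have h1 : Set.MapsTo (Prod.fst : E × E → E) (s ×ˢ Set.univ) s := fun a ha => ha.1
  refine (hf.comp contDiffOn_fst h1).prodMk ?_
  exact ((hf.fderiv_of_isOpen hs (m := ∞) (by simp)).comp contDiffOn_fst h1).clm_apply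
    contDiffOn_snd

/-- The differential of a change of charts. -/
def tangentLift {U₁ U₂ : TopologicalSpace.Opens E} {p₁ : U₁ → Q} {p₂ : U₂ → Q}
    (h : OpenPartialHomeomorph E E) (hh : IsSmoothLift E E p₁ p₂ id h) :
    OpenPartialHomeomorph (E × E) (E × E) where
  toFun a := (h a.1, fderiv ℝ h a.1 a.2)
  invFun a := (h.symm a.1, fderiv ℝ h.symm a.1 a.2)
  source := h.source ×ˢ Set.univ
  target := h.target ×ˢ Set.univ
  map_source' _ ha := ⟨h.map_source ha.1, trivial⟩
  map_target' _ ha := ⟨h.map_target ha.1, trivial⟩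
  left_inv' a ha := Prod.ext (h.left_inv ha.1) (lift_fderiv_symm hh ha.1 a.2)
  right_inv' a ha := Prod.ext (h.right_inv ha.1) (lift_fderiv_symm (lift_symm hh) ha.1 a.2)
  open_source := h.open_source.prod isOpen_univ
  open_target := h.open_target.prod isOpen_univ
  continuousOn_toFun := (contDiffOn_tangentMap h.open_source
    (contMDiffOn_iff_contDiffOn.1 hh.smooth)).continuousOn
  continuousOn_invFun := (contDiffOn_tangentMap h.open_target
    (contMDiffOn_iff_contDiffOn.1 hh.smooth_symm)).continuousOn

lemma isOpenMap_tangentChart (i : O.ι) : IsOpenMap (O.tangentChart i) := by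
  intro s hs
  have hs' : IsOpen (Subtype.val '' s : Set (E × E)) :=
    (O.tangentDom i).isOpen.isOpenMap_subtype_val s hs
  refine isOpen_coinduced.2 (isOpen_sigma_iff.2 fun j => isOpen_iff_mem_nhds.2 ?_)
  rintro ⟨y, w⟩ ⟨a, ha, hab⟩
  obtain ⟨h, hh, hx, hxy, hvw⟩ := (O.tangentChart_eq_iff i j a ⟨(y.1, w), y.2, trivial⟩).1 hab
  dsimp only at hxy hvw
  let k := (tangentLift h hh).symm
  have hmem : ((y.1, w) : E × E) ∈ k.source := by
    change y.1 ∈ h.target ∧ _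
    exact ⟨hxy ▸ h.map_source hx, trivial⟩
  have hk : k (y.1, w) = a.1 := by
    change (h.symm y.1, fderiv ℝ h.symm y.1 w) = a.1
    rw [← hxy, ← hvw, lift_fderiv_symm hh hx, h.left_inv hx]
  have hcont : Filter.Tendsto (fun b : O.dom j × E => k (b.1.1, b.2)) (𝓝 (y, w)) (𝓝 a.1) := by
    rw [← hk]
    refine (k.continuousAt hmem).tendsto.comp ?_
    exact Continuous.tendsto (f := fun b : O.dom j × E => ((b.1.1, b.2) : E × E))
      (by fun_prop) (y, w)
  have hsrc : Filter.Tendsto (fun b : O.dom j × E => ((b.1.1, b.2) : E × E)) (𝓝 (y, w))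
      (𝓝 (y.1, w)) :=
    Continuous.tendsto (f := fun b : O.dom j × E => ((b.1.1, b.2) : E × E)) (by fun_prop) (y, w)
  filter_upwards [hcont (hs'.mem_nhds ⟨a, ha, rfl⟩), hsrc (k.open_source.mem_nhds hmem)]
    with b hb1 hb2
  obtain ⟨c, hc, hcb⟩ := hb1
  refine ⟨c, hc, ?_⟩
  refine (O.tangentChart_eq_iff i j c ⟨(b.1.1, b.2), b.1.2, trivial⟩).2 ⟨h, hh, ?_⟩
  have h1 : c.1 = (h.symm b.1.1, fderiv ℝ h.symm b.1.1 b.2) := hcb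
  have hb : b.1.1 ∈ h.target := hb2.1
  rw [h1]
  exact ⟨h.map_target hb, h.right_inv hb, lift_fderiv_symm (lift_symm hh) hb b.2⟩

lemma exists_group_tangentChart (i : O.ι) : ∃ G : Subgroup (Equiv.Perm (O.tangentDom i)), Finite G ∧
    (∀ g ∈ G, ∃ f : E × E → E × E, ContDiffOn ℝ ∞ f (O.tangentDom i) ∧
      ∀ a : O.tangentDom i, f a = g a) ∧
    ∀ a b : O.tangentDom i, O.tangentChart i a = O.tangentChart i b ↔ ∃ g ∈ G, g a = b := by
  obtain ⟨G, hfin, hG, hq⟩ := (O.isChart i).exists_group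
  choose! F hF hFx using hG
  have hd : ∀ g ∈ G, ∀ x : O.dom i, HasFDerivAt (F g) (fderiv ℝ (F g) x.1) x.1 := fun g hg x =>
    (((hF g hg).contDiffAt ((O.dom i).isOpen.mem_nhds x.2)).differentiableAt (by simp)).hasFDerivAt
  have hF1 : ∀ (x : O.dom i) (v : E), fderiv ℝ (F 1) x.1 v = v := by
    intro x v
    have h2 : HasFDerivAt (F 1) (ContinuousLinearMap.id ℝ E) x.1 :=
      (hasFDerivAt_id x.1).congr_of_eventuallyEq (by
        filter_upwards [(O.dom i).isOpen.mem_nhds x.2] with z hz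
        exact hFx 1 G.one_mem ⟨z, hz⟩)
    rw [h2.fderiv]; rfl
  have hFmul : ∀ g ∈ G, ∀ k ∈ G, ∀ (x : O.dom i) (v : E),
      fderiv ℝ (F (g * k)) x.1 v = fderiv ℝ (F g) (k x).1 (fderiv ℝ (F k) x.1 v) := by
    intro g hg k hk x v
    have h0 : HasFDerivAt (F g) (fderiv ℝ (F g) (k x).1) (F k x.1) := by
      rw [hFx k hk x]; exact hd g hg (k x)
    have h2 : HasFDerivAt (F (g * k)) ((fderiv ℝ (F g) (k x).1).comp (fderiv ℝ (F k) x.1)) x.1 :=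
      (h0.comp x.1 (hd k hk x)).congr_of_eventuallyEq (by
        filter_upwards [(O.dom i).isOpen.mem_nhds x.2] with z hz
        rw [hFx (g * k) (G.mul_mem hg hk) ⟨z, hz⟩, Function.comp, hFx k hk ⟨z, hz⟩, hFx g hg]
        rfl)
    rw [h2.fderiv]; rfl
  let act : MulAction G (O.tangentDom i) :=
    { smul := fun g a => ⟨((g.1 ⟨a.1.1, a.2.1⟩).1, fderiv ℝ (F g.1) a.1.1 a.1.2),
        (g.1 ⟨a.1.1, a.2.1⟩).2, trivial⟩
      one_smul := fun a => Subtype.ext (Prod.ext rfl (hF1 ⟨a.1.1, a.2.1⟩ a.1.2))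
      mul_smul := fun g k a => Subtype.ext (Prod.ext rfl
        (hFmul g.1 g.2 k.1 k.2 ⟨a.1.1, a.2.1⟩ a.1.2)) }
  refine ⟨(MulAction.toPermHom G (O.tangentDom i)).range,
    Finite.of_surjective _ (MulAction.toPermHom G (O.tangentDom i)).rangeRestrict_surjective, ?_, ?_⟩
  · rintro _ ⟨g, rfl⟩
    refine ⟨_, contDiffOn_tangentMap (O.dom i).isOpen (hF g.1 g.2), fun a => ?_⟩
    exact Prod.ext (hFx g.1 g.2 ⟨a.1.1, a.2.1⟩) rfl
  · intro a b
    rw [O.tangentChart_eq_iff]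
    constructor
    · rintro ⟨h, hh, hx, hxy, hvw⟩
      set x : O.dom i := ⟨a.1.1, a.2.1⟩ with hxdef
      by_contra hcon
      have hline : Filter.Tendsto (fun t : ℝ => x.1 + t • a.1.2) (𝓝[≠] 0) (𝓝 x.1) := by
        have h0 : Filter.Tendsto (fun t : ℝ => x.1 + t • a.1.2) (𝓝 0) (𝓝 (x.1 + (0 : ℝ) • a.1.2)) :=
          Continuous.tendsto (by fun_prop) 0
        rw [zero_smul, add_zero] at h0
        exact h0.mono_left nhdsWithin_le_nhds
      have hlineD : HasDerivAt (fun t : ℝ => x.1 + t • a.1.2) a.1.2 0 := by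
        simpa using ((hasDerivAt_id (0 : ℝ)).smul_const a.1.2).const_add x.1
      have hev : ∀ g : G, ∀ᶠ t : ℝ in 𝓝[≠] 0,
          h (x.1 + t • a.1.2) - F g.1 (x.1 + t • a.1.2) ≠ 0 := by
        intro g
        have hD : HasDerivAt (fun t : ℝ => h (x.1 + t • a.1.2) - F g.1 (x.1 + t • a.1.2))
            (fderiv ℝ h x.1 a.1.2 - fderiv ℝ (F g.1) x.1 a.1.2) 0 := by
          refine HasDerivAt.sub ?_ ?_
          · exact HasFDerivAt.comp_hasDerivAt (0 : ℝ)
              (by simpa using lift_hasFDerivAt hh (x := x.1) hx) hlineD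
          · exact HasFDerivAt.comp_hasDerivAt (0 : ℝ) (by simpa using hd g.1 g.2 x) hlineD
        by_cases h0 : (g.1 x).1 = b.1.1
        · refine hD.eventually_ne fun h1 => hcon ?_
          refine ⟨_, ⟨g, rfl⟩, Subtype.ext (Prod.ext h0 ?_)⟩
          rw [← hvw]
          exact (sub_eq_zero.1 h1).symm
        · have h2 := hD.continuousAt.tendsto.mono_left (nhdsWithin_le_nhds (s := {0}ᶜ))
          refine h2.eventually_ne ?_
          simp only [zero_smul, add_zero]
          rw [hFx g.1 g.2 x, hxdef]
          dsimp only
          rw [hxy]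
          exact fun h1 => h0 (sub_eq_zero.1 h1).symm
      have hall : ∀ᶠ t : ℝ in 𝓝[≠] 0, False := by
        filter_upwards [Filter.eventually_all.2 hev, hline (h.open_source.mem_nhds hx)] with t h1 h2
        have h3 : x.1 + t • a.1.2 ∈ h.source := h2
        obtain ⟨g, hg, hgx⟩ := (hq ⟨_, hh.source_subset h3⟩
          ⟨_, hh.target_subset (h.map_source h3)⟩).1 (hh.comm _ _ h3 rfl).symm
        refine h1 ⟨g, hg⟩ ?_
        rw [hFx g hg ⟨_, hh.source_subset h3⟩, hgx, sub_self]
      exact hall.exists.elim fun _ hf => hf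
    · rintro ⟨_, ⟨g, rfl⟩, rfl⟩
      have hinv : ∀ z ∈ O.dom i, F (g.1⁻¹) (F g.1 z) = z := fun z hz => by
        rw [hFx g.1 g.2 ⟨z, hz⟩, hFx _ (G.inv_mem g.2)]; simp
      have hinv' : ∀ z ∈ O.dom i, F g.1 (F (g.1⁻¹) z) = z := fun z hz => by
        rw [hFx _ (G.inv_mem g.2) ⟨z, hz⟩, hFx _ g.2]; simp
      have hm : ∀ k ∈ G, ∀ z ∈ O.dom i, F k z ∈ O.dom i := fun k hk z hz => by
        rw [hFx k hk ⟨z, hz⟩]; exact Subtype.prop _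
      let h : OpenPartialHomeomorph E E :=
        { toFun := F g.1
          invFun := F (g.1⁻¹)
          source := O.dom i
          target := O.dom i
          map_source' := hm g.1 g.2
          map_target' := hm _ (G.inv_mem g.2)
          left_inv' := hinv
          right_inv' := hinv'
          open_source := (O.dom i).isOpen
          open_target := (O.dom i).isOpen
          continuousOn_toFun := (hF g.1 g.2).continuousOn
          continuousOn_invFun := (hF _ (G.inv_mem g.2)).continuousOn }
      refine ⟨h, ⟨fun _ hz => hz, fun _ hz => hz, contMDiffOn_iff_contDiffOn.2 (hF g.1 g.2),
        contMDiffOn_iff_contDiffOn.2 (hF _ (G.inv_mem g.2)), ?_⟩, a.2.1,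
        hFx g.1 g.2 ⟨a.1.1, a.2.1⟩, rfl⟩
      intro z w _ hzw
      refine ((hq z w).2 ⟨g.1, g.2, Subtype.ext ?_⟩).symm
      rw [← hFx g.1 g.2 z]
      exact hzw

/-- The tangent orbibundle of an orbifold, as an orbifold: its total space is glued from the
`U × E`, where `U` runs over the domains of the charts, by the differentials of the changes of
charts. -/
def tangentOrbibundle : Orbifold (E × E) O.TangentTotal where
  ι := O.ι
  dom := O.tangentDom
  chart := O.tangentChart
  isChart i :=
    { continuous := by
        refine continuous_quotient_mk'.comp ?_
        have h1 : Continuous fun a : O.tangentDom i =>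
            ((⟨a.1.1, a.2.1⟩, a.1.2) : O.dom i × E) := by fun_prop
        exact (continuous_sigmaMk (σ := fun i : O.ι => O.dom i × E) (i := i)).comp h1
      isOpenMap := O.isOpenMap_tangentChart i
      exists_group := O.exists_group_tangentChart i }
  cover y := by
    induction y using Quotient.inductionOn with | _ a
    exact ⟨a.1, ⟨(a.2.1.1, a.2.2), a.2.1.2, trivial⟩, rfl⟩
  compatible i j a b hab := by
    obtain ⟨h, hh, hx, hxy, hvw⟩ := (O.tangentChart_eq_iff i j a b).1 hab
    refine ⟨tangentLift h hh, ⟨fun c hc => ⟨hh.source_subset hc.1, trivial⟩,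
      fun c hc => ⟨hh.target_subset hc.1, trivial⟩, ?_, ?_, ?_⟩, ⟨hx, trivial⟩, Prod.ext hxy hvw⟩
    · exact contMDiffOn_iff_contDiffOn.2 (contDiffOn_tangentMap h.open_source
        (contMDiffOn_iff_contDiffOn.1 hh.smooth))
    · exact contMDiffOn_iff_contDiffOn.2 (contDiffOn_tangentMap h.open_target
        (contMDiffOn_iff_contDiffOn.1 hh.smooth_symm))
    · intro c d hc hcd
      refine ((O.tangentChart_eq_iff i j c d).2 ⟨h, hh, hc.1, ?_, ?_⟩).symm
      · exact congrArg Prod.fst hcd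
      · exact congrArg Prod.snd hcd

end Orbifold
end Orbifold

/-! ### Hyperbolic structures -/

section Hyperbolic

/-- The model vector space of a real `n`-manifold. -/
abbrev RSpace (n : ℕ) : Type := EuclideanSpace ℝ (Fin n)

/-- A hyperbolic structure on the smooth `n`-manifold `M`: an atlas of smooth charts with values in
`H^n_ℝ` whose changes of charts are locally given by isometries of `H^n_ℝ`. -/
structure HyperbolicStructure (n : ℕ) (M : Type*) [TopologicalSpace M]
    [ChartedSpace (RSpace n) M] where
  charts : Set (OpenPartialHomeomorph M (HypSpace ℝ n))
  cover : ∀ x : M, ∃ e ∈ charts, x ∈ e.source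
  smooth : ∀ e ∈ charts, ContMDiffOn 𝓘(ℝ, RSpace n) 𝓘(ℝ, RSpace n) ∞ e e.source
  smooth_symm : ∀ e ∈ charts, ContMDiffOn 𝓘(ℝ, RSpace n) 𝓘(ℝ, RSpace n) ∞ e.symm e.target
  compatible : ∀ e ∈ charts, ∀ e' ∈ charts, ∀ x ∈ e.source ∩ e'.source,
    ∃ g : pseudoUnitary ℝ n, ∀ᶠ y in 𝓝 x, e' y = g • e y

/-- `dev` is a developing map of the hyperbolic structure `S` on `M`, defined on the (universal)
covering `p : N → M`: in the hyperbolic charts it is locally an isometry of `H^n_ℝ`. -/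
def HyperbolicStructure.IsDevelopingMap {n : ℕ} {M N : Type*} [TopologicalSpace M]
    [ChartedSpace (RSpace n) M] [TopologicalSpace N] (S : HyperbolicStructure n M) (p : N → M)
    (dev : N → HypSpace ℝ n) : Prop :=
  ∀ e ∈ S.charts, ∀ z : N, p z ∈ e.source →
    ∃ g : pseudoUnitary ℝ n, ∀ᶠ z' in 𝓝 z, e (p z') = g • dev z'

/-- `ρ` is the holonomy representation of the developing map `dev`. The element `γ` of the
fundamental group acts on the universal covering `N` by the deck transformation `τ` that maps the
base point `z₀` to the end point of the lift of `γ` that starts at `z₀`, and `dev` is equivariant.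
In Mathlib's fundamental group, `γ * δ` stands for the loop `δ` followed by `γ`; the fundamental
group with the usual order of composition is therefore its opposite. -/
def IsHolonomy {n : ℕ} {M N : Type*} [TopologicalSpace M] [TopologicalSpace N]
    {p : N → M} (hp : IsCoveringMap p) (z₀ : N) (dev : N → HypSpace ℝ n)
    (ρ : (FundamentalGroup M (p z₀))ᵐᵒᵖ →* specialPseudoUnitary ℝ n) : Prop :=
  ∀ (γ : FundamentalGroup M (p z₀)) (τ : N ≃ₜ N), (∀ z, p (τ z) = p z) →
    τ z₀ = hp.monodromy γ.toPath ⟨z₀, rfl⟩ →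
    ∀ z, dev (τ z) = ρ (MulOpposite.op γ) • dev z

/-- A hyperbolic structure on an `n`-orbifold: a family of local uniformizations by open subsets of
`H^n_ℝ`, compatible with the smooth charts, such that all changes of charts are locally given by
isometries of `H^n_ℝ`. -/
structure HyperbolicOrbifoldStructure (n : ℕ) {Q : Type*} [TopologicalSpace Q]
    (O : Orbifold (RSpace n) Q) where
  ι : Type*
  dom : ι → TopologicalSpace.Opens (HypSpace ℝ n)
  chart : ∀ a, dom a → Q
  cover : ∀ y : Q, ∃ (a : ι) (x : dom a), chart a x = y
  smooth : ∀ (a : ι) (i : O.ι) (x : dom a) (u : O.dom i), chart a x = O.chart i u →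
    ∃ h : OpenPartialHomeomorph (HypSpace ℝ n) (RSpace n),
      IsSmoothLift (RSpace n) (RSpace n) (chart a) (O.chart i) id h ∧ x.1 ∈ h.source ∧ h x.1 = u.1
  compatible : ∀ (a b : ι) (h : OpenPartialHomeomorph (HypSpace ℝ n) (HypSpace ℝ n)),
    IsSmoothLift (RSpace n) (RSpace n) (chart a) (chart b) id h →
    ∀ x ∈ h.source, ∃ g : pseudoUnitary ℝ n, ∀ᶠ y in 𝓝 x, h y = g • y

/-- The map `p : N → Q`, regarded as a map on the open set `N ⊆ N`. -/
def onTop {N Q : Type*} [TopologicalSpace N] (p : N → Q) : (⊤ : TopologicalSpace.Opens N) → Q :=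
  fun z => p z.1

/-- `p : N → Q` exhibits the orbifold `Q` as the quotient orbifold of the smooth manifold `N` by the
action of `Γ`. If `N` is simply connected and the action is faithful and properly discontinuous,
then `N` is the universal orbifold covering of `Q`, and `Γ` is the orbifold fundamental group. -/
structure IsOrbifoldQuotientMap {n : ℕ} {Q : Type*} [TopologicalSpace Q]
    (O : Orbifold (RSpace n) Q) (Γ : Type*) {N : Type*} [Group Γ] [TopologicalSpace N]
    [ChartedSpace (RSpace n) N] [MulAction Γ N] (p : N → Q) : Prop where
  smooth_smul : ∀ γ : Γ, ContMDiff 𝓘(ℝ, RSpace n) 𝓘(ℝ, RSpace n) ∞ fun z : N => γ • z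
  surjective : Function.Surjective p
  apply_eq_iff : ∀ z w : N, p z = p w ↔ ∃ γ : Γ, γ • z = w
  exists_lift : ∀ (z : N) (i : O.ι) (x : O.dom i), p z = O.chart i x →
    ∃ h : OpenPartialHomeomorph N (RSpace n),
      IsSmoothLift (RSpace n) (RSpace n) (onTop p) (O.chart i) id h ∧ z ∈ h.source ∧ h z = x.1

/-- `dev` is a developing map of the hyperbolic structure `S` on an orbifold, defined on the
(universal) covering `p : N → Q`. -/
def HyperbolicOrbifoldStructure.IsDevelopingMap {n : ℕ} {Q N : Type*} [TopologicalSpace Q]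
    {O : Orbifold (RSpace n) Q} [TopologicalSpace N] [ChartedSpace (RSpace n) N]
    (S : HyperbolicOrbifoldStructure n O) (p : N → Q) (dev : N → HypSpace ℝ n) : Prop :=
  ∀ (a : S.ι) (h : OpenPartialHomeomorph N (HypSpace ℝ n)),
    IsSmoothLift (RSpace n) (RSpace n) (onTop p) (S.chart a) id h →
    ∀ z ∈ h.source, ∃ g : pseudoUnitary ℝ n, ∀ᶠ z' in 𝓝 z, h z' = g • dev z'

/-- The subgroup `ι(ρ(Γ))` of `SU(n,1)`. -/
def kleinianGroup {n : ℕ} {Γ : Type*} [Group Γ] (ρ : Γ →* specialPseudoUnitary ℝ n) :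
    Subgroup (specialPseudoUnitary ℂ n) :=
  ((iotaSO n).comp ρ).range

/-- The orbifold `H^n_ℂ / Λ`, for a subgroup `Λ` of `SU(n,1)` that acts properly
discontinuously. -/
def complexHyperbolicOrbifold {n : ℕ} (Λ : Subgroup (specialPseudoUnitary ℂ n))
    [ProperlyDiscontinuousSMul Λ (HypSpace ℂ n)] :
    Orbifold (EuclideanSpace ℂ (Fin n)) (MulAction.orbitRel.Quotient Λ (HypSpace ℂ n)) :=
  quotientOrbifold fun γ => ⟨projMap γ.1.1.1.val, projMap_contDiffOn γ.1.1.2, fun _ => rfl⟩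

end Hyperbolic

end

/-! A tangent vector of real hyperbolic space is, in the hyperboloid model, a pair of vectors X, V
of ℝ^{n,1} with ⟨X, X⟩ = -1 and V orthogonal to X. The vector √(1 + ⟨V, V⟩) X + iV has Hermitian
square -1, so it spans a negative complex line. Conversely, multiply a negative vector Z by a phase
that makes its bilinear square ⟨Z, Z⟩ real and negative: its real and imaginary parts become
orthogonal, and the pair (X, V) is recovered up to a common sign and a real scale. For Z = (z, 1)
the number -⟨Z, Z⟩ = 1 - ∑ zᵢ² has positive real part on the ball, so the phase can be chosen
smoothly. This gives a diffeomorphism between T H^n_ℝ and H^n_ℂ, with explicit mutually inverse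
formulas (`complexToTangent_tangentToComplex`, `tangentToComplex_complexToTangent`). The
construction uses only the form, so it intertwines the differentials of the isometries in O(n,1)
with the same real matrices acting on H^n_ℂ (`tangentToComplex_equivariant`).

By completeness the developing map is a covering between simply connected spaces, hence a
homeomorphism (`exists_homeomorph_of_isCoveringMap`). The manifold or orbifold is therefore the
quotient of H^n_ℝ by ρ(Γ). The foot-point projection `realProj` from H^n_ℂ to H^n_ℝ is continuous
and equivariant, so proper discontinuity and freeness pass from the real to the complex ball. For
manifolds, proper discontinuity on the real ball comes from freeness and the Hausdorff property
(`isProperlyDiscontinuousRep_of_free`); for orbifolds it is transported from the universal covering.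

It remains to divide the equivariant diffeomorphism by the group. For a manifold, the differential
of the covering H^n_ℝ → M descends to the required map (`nonempty_diffeomorph_tangentBundle`). For
an orbifold, the tangent orbibundle is glued by the differentials of all local diffeomorphisms over
Q, and not just of group elements. The crucial `IsUniformization.exists_fderiv_eq` shows that on
each single tangent vector both have the same effect, so the fibres of the projection from H^n_ℂ to
TQ are exactly the orbits. -/

noncomputable section

/-! ### The tangent bundle of real hyperbolic space and complex hyperbolic space -/

section TangentModel
variable {n : ℕ}

/-- The real part of a vector in `ℂⁿ`. -/
def reVec (z : EuclideanSpace ℂ (Fin n)) : RSpace n := WithLp.toLp 2 fun i => (z i).re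

/-- The imaginary part of a vector in `ℂⁿ`. -/
def imVec (z : EuclideanSpace ℂ (Fin n)) : RSpace n := WithLp.toLp 2 fun i => (z i).im

lemma contDiff_reVec : ContDiff ℝ ∞ (reVec (n := n)) := by
  rw [contDiff_piLp]
  exact fun i => Complex.reCLM.contDiff.comp
    ((EuclideanSpace.proj (𝕜 := ℂ) i : _ →L[ℂ] ℂ).restrictScalars ℝ).contDiff

lemma contDiff_imVec : ContDiff ℝ ∞ (imVec (n := n)) := by
  rw [contDiff_piLp]
  exact fun i => Complex.imCLM.contDiff.comp
    ((EuclideanSpace.proj (𝕜 := ℂ) i : _ →L[ℂ] ℂ).restrictScalars ℝ).contDiff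

lemma norm_sq_eq_reVec_imVec (z : EuclideanSpace ℂ (Fin n)) :
    ‖z‖ ^ 2 = ‖reVec z‖ ^ 2 + ‖imVec z‖ ^ 2 := by
  rw [EuclideanSpace.norm_sq_eq, EuclideanSpace.norm_sq_eq, EuclideanSpace.norm_sq_eq,
    ← Finset.sum_add_distrib]
  refine Finset.sum_congr rfl fun i _ => ?_
  rw [← Complex.normSq_eq_norm_sq, Complex.normSq_apply]
  simp [reVec, imVec, sq]

lemma mem_hypBall_iff {𝕜 : Type*} [RCLike 𝕜] (x : EuclideanSpace 𝕜 (Fin n)) :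
    x ∈ hypBall 𝕜 n ↔ 0 < 1 - ‖x‖ ^ 2 := by
  have h : x ∈ hypBall 𝕜 n ↔ ‖x‖ < 1 := by
    rw [← SetLike.mem_coe]
    simp [hypBall]
  rw [h, sub_pos, sq_lt_one_iff₀ (norm_nonneg x)]

lemma mem_hypBall_complex_iff (z : EuclideanSpace ℂ (Fin n)) :
    z ∈ hypBall ℂ n ↔ 0 < 1 - ‖reVec z‖ ^ 2 - ‖imVec z‖ ^ 2 := by
  rw [mem_hypBall_iff, norm_sq_eq_reVec_imVec, sub_sub]

/-- The last coordinate of the lift of the tangent vector `v` at `x` to a vector of `ℝ^{n+1}`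
orthogonal to `(x, 1)`. -/
def tangentSlope (x v : RSpace n) : ℝ := inner ℝ x v / (1 - ‖x‖ ^ 2)

/-- The coefficient of `(x, 1)` in the vector of `ℂ^{n+1}` that represents the tangent
vector `v` at `x`. -/
def tangentHeight (x v : RSpace n) : ℝ :=
  √(1 + ‖v‖ ^ 2 / (1 - ‖x‖ ^ 2) + tangentSlope x v ^ 2)

/-- The map from the tangent bundle of `H^n_ℝ` to `H^n_ℂ`. In terms of the hyperboloid model, a
tangent vector `V` at `X` is mapped to the line spanned by `√(1 + ⟨V, V⟩) X + i V`. -/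
def tangentToComplex (a : RSpace n × RSpace n) : EuclideanSpace ℂ (Fin n) :=
  WithLp.toLp 2 fun i => (a.1 i : ℂ) + Complex.I * (a.2 i : ℂ)
    / ((tangentHeight a.1 a.2 : ℂ) + Complex.I * (tangentSlope a.1 a.2 : ℂ))

/-- The real part of `1 - ∑ zᵢ²`. -/
def quadRe (z : EuclideanSpace ℂ (Fin n)) : ℝ := 1 - ‖reVec z‖ ^ 2 + ‖imVec z‖ ^ 2

/-- The absolute value of `1 - ∑ zᵢ²`. -/
def quadAbs (z : EuclideanSpace ℂ (Fin n)) : ℝ :=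
  √(quadRe z ^ 2 + 4 * inner ℝ (reVec z) (imVec z) ^ 2)

/-- The negative of the tangent of half the argument of `1 - ∑ zᵢ²`. -/
def quadSlope (z : EuclideanSpace ℂ (Fin n)) : ℝ :=
  2 * inner ℝ (reVec z) (imVec z) / (quadAbs z + quadRe z)

/-- The ratio of the tangent vector that corresponds to `z` and the imaginary part of `z`. -/
def tangentScale (z : EuclideanSpace ℂ (Fin n)) : ℝ :=
  √(2 * (quadAbs z + (1 - ‖reVec z‖ ^ 2 - ‖imVec z‖ ^ 2))) * quadAbs z
    / ((quadAbs z + quadRe z) * √(1 - ‖reVec z‖ ^ 2 - ‖imVec z‖ ^ 2))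

/-- The inverse of `tangentToComplex`. -/
def complexToTangent (z : EuclideanSpace ℂ (Fin n)) : RSpace n × RSpace n :=
  (reVec z - quadSlope z • imVec z, tangentScale z • imVec z)

/-! ### Positivity and smoothness of the two explicit maps, and the composition starting from the
tangent bundle. -/

lemma tangentHeight_arg_pos {x : RSpace n} (hx : x ∈ hypBall ℝ n) (v : RSpace n) :
    0 < 1 + ‖v‖ ^ 2 / (1 - ‖x‖ ^ 2) + tangentSlope x v ^ 2 := by
  have := (mem_hypBall_iff x).1 hx
  positivity

lemma tangentHeight_pos {x : RSpace n} (hx : x ∈ hypBall ℝ n) (v : RSpace n) :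
    0 < tangentHeight x v := Real.sqrt_pos.2 (tangentHeight_arg_pos hx v)

lemma tangentHeight_sq {x : RSpace n} (hx : x ∈ hypBall ℝ n) (v : RSpace n) :
    tangentHeight x v ^ 2 = 1 + ‖v‖ ^ 2 / (1 - ‖x‖ ^ 2) + tangentSlope x v ^ 2 :=
  Real.sq_sqrt (tangentHeight_arg_pos hx v).le

lemma tangent_denom_ne {x : RSpace n} (hx : x ∈ hypBall ℝ n) (v : RSpace n) :
    (tangentHeight x v : ℂ) + Complex.I * (tangentSlope x v : ℂ) ≠ 0 := by
  intro h
  have := congrArg Complex.re h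
  simp at this
  exact (tangentHeight_pos hx v).ne' this

lemma reVec_tangentToComplex (x v : RSpace n) :
    reVec (tangentToComplex (x, v)) = x + (tangentSlope x v
      / (tangentHeight x v ^ 2 + tangentSlope x v ^ 2)) • v := by
  ext i
  simp only [reVec, tangentToComplex, Complex.add_re, Complex.div_re, Complex.normSq_apply]
  simp
  ring

lemma imVec_tangentToComplex (x v : RSpace n) :
    imVec (tangentToComplex (x, v)) = (tangentHeight x v
      / (tangentHeight x v ^ 2 + tangentSlope x v ^ 2)) • v := by
  ext i
  simp only [imVec, tangentToComplex, Complex.add_im, Complex.div_im, Complex.normSq_apply]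
  simp
  ring

/-- This keeps `1 - ∑ zᵢ²` in the right half-plane. Half of its argument is then a smooth function,
and the denominators `quadAbs z + quadRe z` do not vanish. -/
lemma quadRe_pos {z : EuclideanSpace ℂ (Fin n)} (hz : z ∈ hypBall ℂ n) : 0 < quadRe z := by
  have := (mem_hypBall_complex_iff z).1 hz
  unfold quadRe
  nlinarith [sq_nonneg ‖imVec z‖]

lemma quadAbs_arg_pos {z : EuclideanSpace ℂ (Fin n)} (hz : z ∈ hypBall ℂ n) :
    0 < quadRe z ^ 2 + 4 * inner ℝ (reVec z) (imVec z) ^ 2 := by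
  have := quadRe_pos hz
  positivity

lemma quadAbs_pos {z : EuclideanSpace ℂ (Fin n)} (hz : z ∈ hypBall ℂ n) : 0 < quadAbs z :=
  Real.sqrt_pos.2 (quadAbs_arg_pos hz)

lemma contDiffOn_complexToTangent :
    ContDiffOn ℝ ∞ (complexToTangent (n := n)) (hypBall ℂ n : Set (EuclideanSpace ℂ (Fin n))) := by
  have hR : ContDiff ℝ ∞ (quadRe (n := n)) :=
    (contDiff_const.sub (contDiff_reVec.norm_sq ℝ)).add (contDiff_imVec.norm_sq ℝ)
  have hI : ContDiff ℝ ∞ fun z : EuclideanSpace ℂ (Fin n) => inner ℝ (reVec z) (imVec z) :=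
    contDiff_reVec.inner ℝ contDiff_imVec
  have hd : ContDiff ℝ ∞ fun z : EuclideanSpace ℂ (Fin n) => 1 - ‖reVec z‖ ^ 2 - ‖imVec z‖ ^ 2 :=
    (contDiff_const.sub (contDiff_reVec.norm_sq ℝ)).sub (contDiff_imVec.norm_sq ℝ)
  have hA : ContDiffOn ℝ ∞ (quadAbs (n := n)) (hypBall ℂ n : Set (EuclideanSpace ℂ (Fin n))) :=
    ((hR.pow 2).add (contDiff_const.mul (hI.pow 2))).contDiffOn.sqrt
      fun z hz => (quadAbs_arg_pos hz).ne'
  have hk : ∀ z ∈ hypBall ℂ n, quadAbs z + quadRe z ≠ 0 := fun z hz =>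
    (add_pos (quadAbs_pos hz) (quadRe_pos hz)).ne'
  have hS : ContDiffOn ℝ ∞ (quadSlope (n := n)) (hypBall ℂ n : Set (EuclideanSpace ℂ (Fin n))) :=
    (contDiff_const.mul hI).contDiffOn.div (hA.add hR.contDiffOn) hk
  have hT : ContDiffOn ℝ ∞ (tangentScale (n := n))
      (hypBall ℂ n : Set (EuclideanSpace ℂ (Fin n))) := by
    refine ContDiffOn.div (((contDiffOn_const.mul (hA.add hd.contDiffOn)).sqrt fun z hz => ?_).mul hA)
      ((hA.add hR.contDiffOn).mul (hd.contDiffOn.sqrt fun z hz => ?_)) fun z hz => ?_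
    · have h1 := (mem_hypBall_complex_iff z).1 hz
      have h2 := quadAbs_pos hz
      positivity
    · exact ((mem_hypBall_complex_iff z).1 hz).ne'
    · exact mul_ne_zero (hk z hz) (Real.sqrt_pos.2 ((mem_hypBall_complex_iff z).1 hz)).ne'
  exact (contDiff_reVec.contDiffOn.sub (hS.smul contDiff_imVec.contDiffOn)).prodMk
    (hT.smul contDiff_imVec.contDiffOn)

lemma contDiffOn_tangentToComplex :
    ContDiffOn ℝ ∞ (tangentToComplex (n := n)) ((hypBall ℝ n : Set (RSpace n)) ×ˢ Set.univ) := by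
  have hd : ContDiff ℝ ∞ fun a : RSpace n × RSpace n => 1 - ‖a.1‖ ^ 2 :=
    contDiff_const.sub (contDiff_fst.norm_sq ℝ)
  have hd0 : ∀ a ∈ (hypBall ℝ n : Set (RSpace n)) ×ˢ (Set.univ : Set (RSpace n)),
      1 - ‖a.1‖ ^ 2 ≠ 0 := fun a ha => ((mem_hypBall_iff a.1).1 ha.1).ne'
  have hb : ContDiffOn ℝ ∞ (fun a : RSpace n × RSpace n => tangentSlope a.1 a.2)
      ((hypBall ℝ n : Set (RSpace n)) ×ˢ Set.univ) :=
    (contDiff_fst.inner ℝ contDiff_snd).contDiffOn.div hd.contDiffOn hd0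
  have ha : ContDiffOn ℝ ∞ (fun a : RSpace n × RSpace n => tangentHeight a.1 a.2)
      ((hypBall ℝ n : Set (RSpace n)) ×ˢ Set.univ) :=
    ((contDiffOn_const.add ((contDiff_snd.norm_sq ℝ).contDiffOn.div hd.contDiffOn hd0)).add
      (hb.pow 2)).sqrt fun a ha => (tangentHeight_arg_pos ha.1 a.2).ne'
  have hof : ContDiff ℝ ∞ (fun t : ℝ => (t : ℂ)) := Complex.ofRealCLM.contDiff
  rw [contDiffOn_piLp]
  intro i
  have hpr : ContDiff ℝ ∞ fun x : RSpace n => ((x i : ℝ) : ℂ) :=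
    hof.comp (EuclideanSpace.proj (𝕜 := ℝ) i : _ →L[ℝ] ℝ).contDiff
  simp only [tangentToComplex, div_eq_mul_inv]
  refine (hpr.comp contDiff_fst).contDiffOn.add
    ((contDiffOn_const.mul (hpr.comp contDiff_snd).contDiffOn).mul (ContDiffOn.inv ?_ ?_))
  · exact (hof.comp_contDiffOn ha).add (contDiffOn_const.mul (hof.comp_contDiffOn hb))
  · exact fun a ha => tangent_denom_ne ha.1 a.2

lemma norm_add_smul_sq (x v : RSpace n) (c : ℝ) :
    ‖x + c • v‖ ^ 2 = ‖x‖ ^ 2 + 2 * c * inner ℝ x v + c ^ 2 * ‖v‖ ^ 2 := by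
  rw [norm_add_sq_real, inner_smul_right, norm_smul, mul_pow, Real.norm_eq_abs, sq_abs]
  ring

lemma norm_smul_sq (v : RSpace n) (c : ℝ) : ‖c • v‖ ^ 2 = c ^ 2 * ‖v‖ ^ 2 := by
  rw [norm_smul, mul_pow, Real.norm_eq_abs, sq_abs]

/-- Write X = (x, 1), let V be the orthogonal lift of v, and let a, b be the height and the slope.
Since ⟨V, V⟩ = (a² - 1)(1 - ‖x‖²), the vector aX + iV has Hermitian square -(1 - ‖x‖²). Normalizing
its last coordinate a + ib to 1 divides this by a² + b². -/
lemma one_sub_norm_tangentToComplex {x : RSpace n} (hx : x ∈ hypBall ℝ n) (v : RSpace n) :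
    1 - ‖reVec (tangentToComplex (x, v))‖ ^ 2 - ‖imVec (tangentToComplex (x, v))‖ ^ 2
      = (1 - ‖x‖ ^ 2) / (tangentHeight x v ^ 2 + tangentSlope x v ^ 2) := by
  have hs := (mem_hypBall_iff x).1 hx
  have ha := tangentHeight_pos hx v
  have h1 := tangentHeight_sq hx v
  have h2 : inner ℝ x v = tangentSlope x v * (1 - ‖x‖ ^ 2) := by
    rw [tangentSlope, div_mul_cancel₀ _ hs.ne']
  rw [reVec_tangentToComplex, imVec_tangentToComplex, norm_add_smul_sq, norm_smul_sq, h2]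
  set a := tangentHeight x v
  set b := tangentSlope x v
  have hV : ‖v‖ ^ 2 = (a ^ 2 - 1 - b ^ 2) * (1 - ‖x‖ ^ 2) := by
    rw [h1]; field_simp; ring
  have hr : 0 < a ^ 2 + b ^ 2 := by positivity
  rw [hV]
  field_simp
  ring

lemma tangentToComplex_mem {x : RSpace n} (hx : x ∈ hypBall ℝ n) (v : RSpace n) :
    tangentToComplex (x, v) ∈ hypBall ℂ n := by
  have hs := (mem_hypBall_iff x).1 hx
  have ha := tangentHeight_pos hx v
  rw [mem_hypBall_complex_iff, one_sub_norm_tangentToComplex hx]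
  positivity

/-- Everything is expressed by a, b and s = 1 - ‖x‖². The identity behind `hR`, `hI` and `hA` is 1 -
∑ zᵢ² = s(2a² - 1)/(a + ib)². Half the argument of the left side is thus the negative of the
argument of a + ib, which yields the value b/a of `quadSlope`. -/
lemma complexToTangent_tangentToComplex {x : RSpace n} (hx : x ∈ hypBall ℝ n) (v : RSpace n) :
    complexToTangent (tangentToComplex (x, v)) = (x, v) := by
  have hs := (mem_hypBall_iff x).1 hx
  have ha := tangentHeight_pos hx v
  have h1 := tangentHeight_sq hx v
  have h2 : inner ℝ x v = tangentSlope x v * (1 - ‖x‖ ^ 2) := by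
    rw [tangentSlope, div_mul_cancel₀ _ hs.ne']
  have hd := one_sub_norm_tangentToComplex hx v
  -- The factor 2a² - 1 must be positive for the modulus in `hA` to come out without an absolute
  -- value; in fact a ≥ 1.
  have hm : 1 < 2 * tangentHeight x v ^ 2 := by
    have : 0 ≤ ‖v‖ ^ 2 / (1 - ‖x‖ ^ 2) := by positivity
    nlinarith [sq_nonneg (tangentSlope x v)]
  set z := tangentToComplex (x, v) with hz
  have hp : reVec z = _ := reVec_tangentToComplex x v
  have hy : imVec z = _ := imVec_tangentToComplex x v
  set a := tangentHeight x v
  set b := tangentSlope x v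
  have hV : ‖v‖ ^ 2 = (a ^ 2 - 1 - b ^ 2) * (1 - ‖x‖ ^ 2) := by
    rw [h1]; field_simp; ring
  set s := 1 - ‖x‖ ^ 2 with hsdef
  have hx2 : ‖x‖ ^ 2 = 1 - s := by rw [hsdef]; ring
  have hr : 0 < a ^ 2 + b ^ 2 := by positivity
  have hR : quadRe z = s * (2 * a ^ 2 - 1) * (a ^ 2 - b ^ 2) / (a ^ 2 + b ^ 2) ^ 2 := by
    rw [quadRe, hp, hy, norm_add_smul_sq, norm_smul_sq, h2, hV, hx2]
    field_simp
    ring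
  have hI : inner ℝ (reVec z) (imVec z)
      = s * (2 * a ^ 2 - 1) * (a * b) / (a ^ 2 + b ^ 2) ^ 2 := by
    rw [hp, hy, inner_smul_right, inner_add_left, inner_smul_left, real_inner_self_eq_norm_sq, h2,
      hV]
    simp only [conj_trivial]
    field_simp
    ring
  have hA : quadAbs z = s * (2 * a ^ 2 - 1) / (a ^ 2 + b ^ 2) := by
    rw [quadAbs, Real.sqrt_eq_iff_eq_sq (by positivity)
      (div_nonneg (mul_nonneg hs.le (by linarith)) hr.le), hR, hI]
    field_simp
    ring
  have hk : quadAbs z + quadRe z = 2 * a ^ 2 * (s * (2 * a ^ 2 - 1)) / (a ^ 2 + b ^ 2) ^ 2 := by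
    rw [hA, hR]
    field_simp
    ring
  have hm' : 0 < 2 * a ^ 2 - 1 := by linarith
  have ht : quadSlope z = b / a := by
    rw [quadSlope, hk, hI]
    field_simp
  have hmu : tangentScale z = (a ^ 2 + b ^ 2) / a := by
    have h3 : 2 * (quadAbs z + s / (a ^ 2 + b ^ 2)) = (2 * a) ^ 2 * (s / (a ^ 2 + b ^ 2)) := by
      rw [hA]
      field_simp
      ring
    have h4 : 0 < √(s / (a ^ 2 + b ^ 2)) := Real.sqrt_pos.2 (by positivity)
    rw [tangentScale, hd, h3, Real.sqrt_mul (by positivity), Real.sqrt_sq (by positivity), hk, hA]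
    field_simp
  rw [complexToTangent, ht, hmu, hp, hy]
  refine Prod.ext ?_ ?_
  · simp only
    rw [smul_smul, add_sub_assoc, ← sub_smul]
    rw [show b / (a ^ 2 + b ^ 2) - b / a * (a / (a ^ 2 + b ^ 2)) = 0 by field_simp; ring]
    simp
  · simp only
    rw [smul_smul, show (a ^ 2 + b ^ 2) / a * (a / (a ^ 2 + b ^ 2)) = 1 by field_simp, one_smul]

lemma quad_identities {z : EuclideanSpace ℂ (Fin n)} (hz : z ∈ hypBall ℂ n) :
    quadAbs z ^ 2 = quadRe z ^ 2 + 4 * inner ℝ (reVec z) (imVec z) ^ 2 :=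
  Real.sq_sqrt (quadAbs_arg_pos hz).le

/-- With m = `quadAbs z`, R = `quadRe z` and P the inner product of the real and imaginary parts,
the only relation needed besides the definitions is P² = (m² - R²)/4. The right side is visibly
positive, so the foot point lies in the real ball. -/
lemma one_sub_norm_complexToTangent {z : EuclideanSpace ℂ (Fin n)} (hz : z ∈ hypBall ℂ n) :
    1 - ‖(complexToTangent z).1‖ ^ 2
      = quadAbs z * (quadAbs z + (1 - ‖reVec z‖ ^ 2 - ‖imVec z‖ ^ 2))
        / (quadAbs z + quadRe z) := by
  have hk := add_pos (quadAbs_pos hz) (quadRe_pos hz)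
  have hm := quad_identities hz
  have hR : quadRe z = 1 - ‖reVec z‖ ^ 2 + ‖imVec z‖ ^ 2 := rfl
  rw [complexToTangent, sub_eq_add_neg (reVec z), ← neg_smul, norm_add_smul_sq, quadSlope]
  set m := quadAbs z
  set R := quadRe z
  set P := inner ℝ (reVec z) (imVec z)
  have hP : P ^ 2 = (m ^ 2 - R ^ 2) / 4 := by linarith
  have hre : ‖reVec z‖ ^ 2 = 1 + ‖imVec z‖ ^ 2 - R := by linarith
  rw [hre]
  field_simp
  linear_combination (4 * R + 4 * m - 4 * ‖imVec z‖ ^ 2) * hP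

lemma complexToTangent_fst_mem {z : EuclideanSpace ℂ (Fin n)} (hz : z ∈ hypBall ℂ n) :
    (complexToTangent z).1 ∈ hypBall ℝ n := by
  have h1 := quadAbs_pos hz
  have h2 := quadRe_pos hz
  have h3 := (mem_hypBall_complex_iff z).1 hz
  rw [mem_hypBall_iff, one_sub_norm_complexToTangent hz]
  positivity

end TangentModel

/-! ### The composition starting from the complex ball, and equivariance. -/

section TangentModel
variable {n : ℕ}

lemma ext_reVec_imVec {z w : EuclideanSpace ℂ (Fin n)} (h1 : reVec z = reVec w)
    (h2 : imVec z = imVec w) : z = w := by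
  ext i
  refine Complex.ext ?_ ?_
  · simpa [reVec] using congrArg (fun x : RSpace n => x i) h1
  · simpa [imVec] using congrArg (fun x : RSpace n => x i) h2

/-- Here everything is expressed by m, R, d, the slope t and the scale μ. The height and slope of
the recovered tangent vector turn out to be a and ta with a = μ(m + R)/(2m), so that a + ib = a(1 +
it) has the phase that was divided out. -/
lemma tangentToComplex_complexToTangent {z : EuclideanSpace ℂ (Fin n)} (hz : z ∈ hypBall ℂ n) :
    tangentToComplex (complexToTangent z) = z := by
  have hm0 := quadAbs_pos hz
  have hk := add_pos hm0 (quadRe_pos hz)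
  have hm := quad_identities hz
  have hd := (mem_hypBall_complex_iff z).1 hz
  have hR : quadRe z = 1 - ‖reVec z‖ ^ 2 + ‖imVec z‖ ^ 2 := rfl
  have hs := one_sub_norm_complexToTangent hz
  set x := (complexToTangent z).1 with hx
  set v := (complexToTangent z).2 with hv
  have hx' : x = reVec z + (-quadSlope z) • imVec z := by
    rw [hx, complexToTangent, sub_eq_add_neg, neg_smul]
  have hv' : v = tangentScale z • imVec z := rfl
  have ht : quadSlope z = 2 * inner ℝ (reVec z) (imVec z) / (quadAbs z + quadRe z) := rfl
  have hmu : tangentScale z ^ 2 = 2 * (quadAbs z + (1 - ‖reVec z‖ ^ 2 - ‖imVec z‖ ^ 2))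
      * quadAbs z ^ 2 / ((quadAbs z + quadRe z) ^ 2 * (1 - ‖reVec z‖ ^ 2 - ‖imVec z‖ ^ 2)) := by
    rw [tangentScale, div_pow, mul_pow, mul_pow, Real.sq_sqrt (by positivity), Real.sq_sqrt hd.le]
  have hmu0 : 0 < tangentScale z := by
    have h1 : 0 < √(1 - ‖reVec z‖ ^ 2 - ‖imVec z‖ ^ 2) := Real.sqrt_pos.2 hd
    have h2 : 0 < √(2 * (quadAbs z + (1 - ‖reVec z‖ ^ 2 - ‖imVec z‖ ^ 2))) :=
      Real.sqrt_pos.2 (by positivity)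
    rw [tangentScale]
    positivity
  set m := quadAbs z
  set R := quadRe z
  set t := quadSlope z
  set μ := tangentScale z
  set P := inner ℝ (reVec z) (imVec z) with hPdef
  set d := 1 - ‖reVec z‖ ^ 2 - ‖imVec z‖ ^ 2 with hddef
  have hY : ‖imVec z‖ ^ 2 = (R - d) / 2 := by rw [hR, hddef]; ring
  have hP : P = t * (m + R) / 2 := by rw [ht]; field_simp
  -- Half-angle identity: up to sign, t is the tangent of half the argument of a complex number of
  -- modulus m and real part R.
  have ht2 : t ^ 2 * (m + R) = m - R := by
    have h1 : m ^ 2 - R ^ 2 = (t * (m + R)) ^ 2 := by rw [hm, hP]; ring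
    refine mul_right_cancel₀ hk.ne' ?_
    linear_combination -h1
  have hb : tangentSlope x v = t * (μ * (m + R) / (2 * m)) := by
    rw [tangentSlope, hs, hx', hv', inner_smul_right, inner_add_left, inner_smul_left,
      real_inner_self_eq_norm_sq, ← hPdef, hP, hY]
    simp only [conj_trivial]
    field_simp
    ring
  have ha : tangentHeight x v = μ * (m + R) / (2 * m) := by
    rw [tangentHeight, Real.sqrt_eq_iff_eq_sq ?_ (by positivity), hb, hs, hv', norm_smul_sq, hY]
    · have h3 : (t * (μ * (m + R) / (2 * m))) ^ 2 = (m - R) * (m + d) / (2 * d * (m + R)) := by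
        rw [mul_pow, div_pow, mul_pow μ, hmu]
        field_simp
        linear_combination ht2
      rw [h3, div_pow, mul_pow μ, hmu]
      field_simp
      ring
    · have : 0 < 1 - ‖x‖ ^ 2 := by rw [hs]; positivity
      positivity
  have ht3 : (1 + t ^ 2) * (m + R) = 2 * m := by linear_combination ht2
  -- This is a² + b² = μa, so the factor a/(a² + b²) in the imaginary part cancels μ.
  have hr : (μ * (m + R) / (2 * m)) ^ 2 + (t * (μ * (m + R) / (2 * m))) ^ 2
      = μ ^ 2 * (m + R) / (2 * m) := by
    field_simp
    linear_combination ht3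
  have hxv : complexToTangent z = (x, v) := rfl
  rw [hxv]
  refine ext_reVec_imVec ?_ ?_
  · rw [reVec_tangentToComplex, hb, ha, hr, hx', hv', smul_smul, add_assoc, ← add_smul,
      show -t + t * (μ * (m + R) / (2 * m)) / (μ ^ 2 * (m + R) / (2 * m)) * μ = 0 by
        field_simp; ring, zero_smul, add_zero]
  · rw [imVec_tangentToComplex, hb, ha, hr, hv', smul_smul,
      show (μ * (m + R) / (2 * m)) / (μ ^ 2 * (m + R) / (2 * m)) * μ = 1 by field_simp, one_smul]

/-- The diffeomorphism from `H^n_ℂ` to the tangent bundle of `H^n_ℝ`. -/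
def complexTangentHomeo (n : ℕ) :
    OpenPartialHomeomorph (EuclideanSpace ℂ (Fin n)) (RSpace n × RSpace n) where
  toFun := complexToTangent
  invFun := tangentToComplex
  source := hypBall ℂ n
  target := (hypBall ℝ n : Set (RSpace n)) ×ˢ Set.univ
  map_source' _ hz := ⟨complexToTangent_fst_mem hz, trivial⟩
  map_target' a ha := tangentToComplex_mem ha.1 a.2
  left_inv' _ hz := tangentToComplex_complexToTangent hz
  right_inv' a ha := complexToTangent_tangentToComplex ha.1 a.2
  open_source := (hypBall ℂ n).isOpen
  open_target := (hypBall ℝ n).isOpen.prod isOpen_univ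
  continuousOn_toFun := contDiffOn_complexToTangent.continuousOn
  continuousOn_invFun := contDiffOn_tangentToComplex.continuousOn

/-! #### Equivariance -/

/-- The symmetric bilinear form of signature `(n,1)`. -/
def lorentzInner (u w : Fin n ⊕ Unit → ℝ) : ℝ :=
  (∑ i, u (Sum.inl i) * w (Sum.inl i)) - u (Sum.inr ()) * w (Sum.inr ())

lemma lorentzInner_add_right (u w w' : Fin n ⊕ Unit → ℝ) :
    lorentzInner u (w + w') = lorentzInner u w + lorentzInner u w' := by
  simp only [lorentzInner, Pi.add_apply, mul_add, Finset.sum_add_distrib]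
  ring

lemma lorentzInner_smul_right (c : ℝ) (u w : Fin n ⊕ Unit → ℝ) :
    lorentzInner u (c • w) = c * lorentzInner u w := by
  simp only [lorentzInner, Pi.smul_apply, smul_eq_mul, mul_sub, Finset.mul_sum]
  congr 1
  · exact Finset.sum_congr rfl fun i _ => by ring
  · ring

lemma lorentzInner_comm (u w : Fin n ⊕ Unit → ℝ) : lorentzInner u w = lorentzInner w u := by
  simp only [lorentzInner, mul_comm]

lemma lorentzInner_self_mulVec {g : GL (Fin n ⊕ Unit) ℝ} (hg : g ∈ pseudoUnitary ℝ n)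
    (u : Fin n ⊕ Unit → ℝ) :
    lorentzInner (g.val *ᵥ u) (g.val *ᵥ u) = lorentzInner u u := by
  have h := form_preserved hg u
  simpa [lorentzInner, sq] using h

/-- Polarization of the invariance of the quadratic form. -/
lemma lorentzInner_mulVec {g : GL (Fin n ⊕ Unit) ℝ} (hg : g ∈ pseudoUnitary ℝ n)
    (u w : Fin n ⊕ Unit → ℝ) :
    lorentzInner (g.val *ᵥ u) (g.val *ᵥ w) = lorentzInner u w := by
  have key : ∀ a b : Fin n ⊕ Unit → ℝ, lorentzInner (a + b) (a + b)
      = lorentzInner a a + 2 * lorentzInner a b + lorentzInner b b := by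
    intro a b
    rw [lorentzInner_add_right, lorentzInner_comm (a + b), lorentzInner_comm (a + b),
      lorentzInner_add_right, lorentzInner_add_right, lorentzInner_comm b a]
    ring
  have h1 := lorentzInner_self_mulVec hg (u + w)
  rw [Matrix.mulVec_add, key, key, lorentzInner_self_mulVec hg, lorentzInner_self_mulVec hg] at h1
  linarith

/-- The vector `(v, 0)`. -/
def tangentVec (v : RSpace n) : Fin n ⊕ Unit → ℝ := Sum.elim v (fun _ => 0)

lemma sum_mul_eq_inner (x v : RSpace n) : ∑ i, x i * v i = inner ℝ x v := by
  simp only [PiLp.inner_apply, RCLike.inner_apply, conj_trivial]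
  exact Finset.sum_congr rfl fun i _ => mul_comm _ _

lemma lorentzInner_homVec_self (x : RSpace n) :
    lorentzInner (homVec x) (homVec x) = -(1 - ‖x‖ ^ 2) := by
  simp only [lorentzInner, homVec, Sum.elim_inl, Sum.elim_inr]
  rw [sum_mul_eq_inner, real_inner_self_eq_norm_sq]
  ring

lemma lorentzInner_homVec_tangentVec (x v : RSpace n) :
    lorentzInner (homVec x) (tangentVec v) = inner ℝ x v := by
  simp only [lorentzInner, homVec, tangentVec, Sum.elim_inl, Sum.elim_inr]
  rw [sum_mul_eq_inner]
  ring

lemma lorentzInner_tangentVec_self (v : RSpace n) :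
    lorentzInner (tangentVec v) (tangentVec v) = ‖v‖ ^ 2 := by
  simp only [lorentzInner, tangentVec, Sum.elim_inl, Sum.elim_inr]
  rw [sum_mul_eq_inner, real_inner_self_eq_norm_sq]
  ring

/-- The lift of the tangent vector `v` at `x` to a vector orthogonal to `(x, 1)`. -/
def tangentLiftVec (x v : RSpace n) : Fin n ⊕ Unit → ℝ :=
  tangentVec v + tangentSlope x v • homVec x

lemma lorentzInner_homVec_tangentLiftVec {x : RSpace n} (hx : x ∈ hypBall ℝ n) (v : RSpace n) :
    lorentzInner (homVec x) (tangentLiftVec x v) = 0 := by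
  have := ((mem_hypBall_iff x).1 hx).ne'
  rw [tangentLiftVec, lorentzInner_add_right, lorentzInner_smul_right, lorentzInner_homVec_self,
    lorentzInner_homVec_tangentVec, tangentSlope]
  field_simp
  ring

lemma lorentzInner_tangentLiftVec_self {x : RSpace n} (hx : x ∈ hypBall ℝ n) (v : RSpace n) :
    lorentzInner (tangentLiftVec x v) (tangentLiftVec x v)
      = (tangentHeight x v ^ 2 - 1) * (1 - ‖x‖ ^ 2) := by
  have hs := ((mem_hypBall_iff x).1 hx).ne'
  have h1 : lorentzInner (tangentLiftVec x v) (tangentLiftVec x v)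
      = lorentzInner (tangentLiftVec x v) (tangentVec v) := by
    conv_lhs => rw [tangentLiftVec, lorentzInner_add_right, lorentzInner_smul_right,
      ← tangentLiftVec, lorentzInner_comm _ (homVec x), lorentzInner_homVec_tangentLiftVec hx]
    ring
  rw [h1, lorentzInner_comm, tangentLiftVec, lorentzInner_add_right, lorentzInner_smul_right,
    lorentzInner_tangentVec_self, lorentzInner_comm, lorentzInner_homVec_tangentVec,
    tangentHeight_sq hx, tangentSlope]
  field_simp
  ring

/-- This is the derivative at t = 0 of the homogeneous identity g(x + tv, 1) = τ(t) (g·(x + tv), 1),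
where τ(t) is the last coordinate of the left side. The second summand carries τ'(0), the last
coordinate of g(v, 0). The proof obtains the derivative of each coordinate from the quotient rule.
-/
lemma mulVec_tangentVec {g : GL (Fin n ⊕ Unit) ℝ} (hg : g ∈ pseudoUnitary ℝ n)
    {x : RSpace n} (hx : x ∈ hypBall ℝ n) (v : RSpace n) :
    g.val *ᵥ tangentVec v = (g.val *ᵥ homVec x) (Sum.inr ())
        • tangentVec (fderiv ℝ (projMap g.val) x v)
      + (g.val *ᵥ tangentVec v) (Sum.inr ()) • homVec (projMap g.val x) := by
  have h0 := projMap_denom_ne hg hx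
  have hlineD : HasDerivAt (fun t : ℝ => x + t • v) v 0 := by
    simpa using ((hasDerivAt_id (0 : ℝ)).smul_const v).const_add x
  have hd : HasFDerivAt (projMap g.val) (fderiv ℝ (projMap g.val) x) (x + (0 : ℝ) • v) := by
    rw [zero_smul, add_zero]
    exact (((projMap_contDiffOn hg).contDiffAt ((hypBall ℝ n).isOpen.mem_nhds hx)).differentiableAt
      (by simp)).hasFDerivAt
  have h1 := hd.comp_hasDerivAt (0 : ℝ) hlineD
  have hhom : ∀ t : ℝ, homVec (x + t • v) = homVec x + t • tangentVec v := by
    intro t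
    ext j
    rcases j with j | j <;> simp [homVec, tangentVec]
  have h2 : ∀ i, fderiv ℝ (projMap g.val) x v i
      = ((g.val *ᵥ tangentVec v) (Sum.inl i) * (g.val *ᵥ homVec x) (Sum.inr ())
          - (g.val *ᵥ homVec x) (Sum.inl i) * (g.val *ᵥ tangentVec v) (Sum.inr ()))
        / (g.val *ᵥ homVec x) (Sum.inr ()) ^ 2 := by
    intro i
    have h3 := ((EuclideanSpace.proj (𝕜 := ℝ) i : RSpace n →L[ℝ] ℝ).hasFDerivAt).comp_hasDerivAt
      (0 : ℝ) h1
    have haff : ∀ j, HasDerivAt (fun t : ℝ => (g.val *ᵥ homVec (x + t • v)) j)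
        ((g.val *ᵥ tangentVec v) j) 0 := by
      intro j
      have : (fun t : ℝ => (g.val *ᵥ homVec (x + t • v)) j)
          = fun t : ℝ => (g.val *ᵥ homVec x) j + t * (g.val *ᵥ tangentVec v) j := by
        funext t
        rw [hhom, Matrix.mulVec_add, Matrix.mulVec_smul]
        rfl
      rw [this]
      simpa using ((hasDerivAt_id (0 : ℝ)).mul_const ((g.val *ᵥ tangentVec v) j)).const_add
        ((g.val *ᵥ homVec x) j)
    have h4 := (haff (Sum.inl i)).div (haff (Sum.inr ())) (by simpa using h0)
    simp only [zero_smul, add_zero] at h4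
    exact h3.unique h4
  ext j
  rcases j with j | j
  · change (g.val *ᵥ tangentVec v) (Sum.inl j)
      = (g.val *ᵥ homVec x) (Sum.inr ()) * fderiv ℝ (projMap g.val) x v j
        + (g.val *ᵥ tangentVec v) (Sum.inr ())
          * ((g.val *ᵥ homVec x) (Sum.inl j) / (g.val *ᵥ homVec x) (Sum.inr ()))
    rw [h2 j]
    field_simp
    ring
  · simp [tangentVec, homVec]

/-- By `mulVec_tangentVec` the two sides differ by a multiple of the vector (gx, 1). Both are
orthogonal to that vector, since g preserves the form, and it is not isotropic, so the multiple is
zero. -/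
lemma mulVec_tangentLiftVec {g : GL (Fin n ⊕ Unit) ℝ} (hg : g ∈ pseudoUnitary ℝ n)
    {x : RSpace n} (hx : x ∈ hypBall ℝ n) (v : RSpace n) :
    g.val *ᵥ tangentLiftVec x v = (g.val *ᵥ homVec x) (Sum.inr ())
      • tangentLiftVec (projMap g.val x) (fderiv ℝ (projMap g.val) x v) := by
  have h0 := projMap_denom_ne hg hx
  have hx' := projMap_mem hg hx
  set τ := (g.val *ᵥ homVec x) (Sum.inr ()) with hτ
  set v' := fderiv ℝ (projMap g.val) x v
  set ξ := homVec (projMap g.val x) with hξ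
  have h1 : g.val *ᵥ homVec x = τ • ξ := by
    rw [hξ, homVec_projMap hg hx, ← hτ, smul_smul, mul_inv_cancel₀ h0, one_smul]
  obtain ⟨c, hc⟩ : ∃ c : ℝ, g.val *ᵥ tangentLiftVec x v
      = τ • tangentLiftVec (projMap g.val x) v' + c • ξ := by
    refine ⟨(g.val *ᵥ tangentVec v) (Sum.inr ()) + tangentSlope x v * τ
      - τ * tangentSlope (projMap g.val x) v', ?_⟩
    have hT : g.val *ᵥ tangentVec v = τ • tangentVec v'
      + (g.val *ᵥ tangentVec v) (Sum.inr ()) • ξ := mulVec_tangentVec hg hx v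
    generalize (g.val *ᵥ tangentVec v) (Sum.inr ()) = c at hT ⊢
    rw [tangentLiftVec, Matrix.mulVec_add, Matrix.mulVec_smul, h1, hT, tangentLiftVec, ← hξ]
    module
  -- Pairing with the image of (x, 1) isolates the coefficient `c`.
  have h2 : lorentzInner (g.val *ᵥ homVec x) (g.val *ᵥ tangentLiftVec x v) = 0 := by
    rw [lorentzInner_mulVec hg, lorentzInner_homVec_tangentLiftVec hx]
  rw [h1, hc, lorentzInner_add_right, lorentzInner_smul_right, lorentzInner_smul_right,
    lorentzInner_comm (τ • ξ), lorentzInner_comm (τ • ξ), lorentzInner_smul_right,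
    lorentzInner_smul_right, lorentzInner_homVec_self, lorentzInner_comm _ ξ,
    lorentzInner_homVec_tangentLiftVec hx'] at h2
  have hs := (mem_hypBall_iff _).1 hx'
  have hc0 : c = 0 := by
    have h3 : c * (τ * (1 - ‖projMap g.val x‖ ^ 2)) = 0 := by linarith
    rcases mul_eq_zero.1 h3 with h | h
    · exact h
    · rcases mul_eq_zero.1 h with h | h
      · exact absurd h h0
      · exact absurd h hs.ne'
  rw [hc, hc0, zero_smul, add_zero]

/-- The squared height minus 1 is ⟨V, V⟩/(1 - ‖x‖²). Under g, the numerator and the denominator are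
rescaled by the same factor τ⁻². -/
lemma tangentHeight_equivariant {g : GL (Fin n ⊕ Unit) ℝ} (hg : g ∈ pseudoUnitary ℝ n)
    {x : RSpace n} (hx : x ∈ hypBall ℝ n) (v : RSpace n) :
    tangentHeight (projMap g.val x) (fderiv ℝ (projMap g.val) x v) = tangentHeight x v := by
  have h0 := projMap_denom_ne hg hx
  have hx' := projMap_mem hg hx
  have h1 : g.val *ᵥ homVec x = (g.val *ᵥ homVec x) (Sum.inr ()) • homVec (projMap g.val x) := by
    rw [homVec_projMap hg hx, smul_smul, mul_inv_cancel₀ h0, one_smul]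
  have hs' := (mem_hypBall_iff _).1 hx'
  set τ := (g.val *ᵥ homVec x) (Sum.inr ())
  have h2 := lorentzInner_mulVec hg (homVec x) (homVec x)
  rw [h1, lorentzInner_smul_right, lorentzInner_comm, lorentzInner_smul_right,
    lorentzInner_homVec_self, lorentzInner_homVec_self] at h2
  have h3 := lorentzInner_mulVec hg (tangentLiftVec x v) (tangentLiftVec x v)
  rw [mulVec_tangentLiftVec hg hx, lorentzInner_smul_right, lorentzInner_comm,
    lorentzInner_smul_right, lorentzInner_tangentLiftVec_self hx,
    lorentzInner_tangentLiftVec_self hx'] at h3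
  rw [← pow_left_inj₀ (tangentHeight_pos hx' _).le (tangentHeight_pos hx v).le two_ne_zero]
  set A := tangentHeight (projMap g.val x) (fderiv ℝ (projMap g.val) x v) ^ 2
  refine mul_right_cancel₀ (mul_ne_zero (mul_ne_zero h0 h0) hs'.ne') ?_
  linear_combination h3 + (tangentHeight x v ^ 2 - 1) * h2

/-- The homogeneous form aX + iV of the map, free of denominators, on which linear maps act
transparently. -/
lemma homVec_tangentToComplex {x : RSpace n} (hx : x ∈ hypBall ℝ n) (v : RSpace n)
    (j : Fin n ⊕ Unit) :
    ((tangentHeight x v : ℂ) + Complex.I * (tangentSlope x v : ℂ))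
        * homVec (tangentToComplex (x, v)) j
      = (tangentHeight x v : ℂ) * (homVec x j : ℝ)
        + Complex.I * (tangentLiftVec x v j : ℝ) := by
  have h0 := tangent_denom_ne hx v
  rcases j with j | j
  · simp only [homVec, tangentToComplex, tangentLiftVec, tangentVec, Sum.elim_inl, Pi.add_apply,
      Pi.smul_apply, smul_eq_mul]
    push_cast
    field_simp
    ring
  · simp [homVec, tangentLiftVec, tangentVec]

lemma map_mulVec_ofReal (A : Matrix (Fin n ⊕ Unit) (Fin n ⊕ Unit) ℝ) (u : Fin n ⊕ Unit → ℝ)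
    (j : Fin n ⊕ Unit) :
    (A.map (algebraMap ℝ ℂ) *ᵥ fun i => (u i : ℂ)) j = ((A *ᵥ u) j : ℝ) := by
  simp [Matrix.mulVec, dotProduct]

/-- The diffeomorphism between the tangent bundle of `H^n_ℝ` and `H^n_ℂ` is equivariant under
`O(n,1)`. -/
lemma tangentToComplex_equivariant {g : GL (Fin n ⊕ Unit) ℝ} (hg : g ∈ pseudoUnitary ℝ n)
    {x : RSpace n} (hx : x ∈ hypBall ℝ n) (v : RSpace n) :
    tangentToComplex (projMap g.val x, fderiv ℝ (projMap g.val) x v)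
      = projMap (g.val.map (algebraMap ℝ ℂ)) (tangentToComplex (x, v)) := by
  have h0 := projMap_denom_ne hg hx
  have hx' := projMap_mem hg hx
  have h1 : g.val *ᵥ homVec x = (g.val *ᵥ homVec x) (Sum.inr ()) • homVec (projMap g.val x) := by
    rw [homVec_projMap hg hx, smul_smul, mul_inv_cancel₀ h0, one_smul]
  have hl := mulVec_tangentLiftVec hg hx v
  have hh := tangentHeight_equivariant hg hx v
  set τ := (g.val *ᵥ homVec x) (Sum.inr ())
  set x' := projMap g.val x
  set v' := fderiv ℝ (projMap g.val) x v
  set z := tangentToComplex (x, v)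
  set z' := tangentToComplex (x', v')
  set D : ℂ := (tangentHeight x v : ℂ) + Complex.I * (tangentSlope x v : ℂ)
  set D' : ℂ := (tangentHeight x' v' : ℂ) + Complex.I * (tangentSlope x' v' : ℂ)
  have hD : D ≠ 0 := tangent_denom_ne hx v
  have hD' : D' ≠ 0 := tangent_denom_ne hx' v'
  have hτ : (τ : ℂ) ≠ 0 := by exact_mod_cast h0
  have hz : D • homVec z = (tangentHeight x v : ℂ) • (fun i => ((homVec x i : ℝ) : ℂ))
      + Complex.I • fun i => ((tangentLiftVec x v i : ℝ) : ℂ) := by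
    ext j
    exact homVec_tangentToComplex hx v j
  -- A real matrix acts separately on real and imaginary parts, and both are multiplied by the same
  -- τ when compared with the vectors of the image. The scalars then cancel in the quotients that
  -- define `projMap`.
  have key : ∀ j, D * (g.val.map (algebraMap ℝ ℂ) *ᵥ homVec z) j = τ * (D' * homVec z' j) := by
    intro j
    have e1 : D * (g.val.map (algebraMap ℝ ℂ) *ᵥ homVec z) j
        = (g.val.map (algebraMap ℝ ℂ) *ᵥ (D • homVec z)) j := by
      rw [Matrix.mulVec_smul]; rfl
    rw [e1, hz, Matrix.mulVec_add, Matrix.mulVec_smul, Matrix.mulVec_smul, Pi.add_apply,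
      Pi.smul_apply, Pi.smul_apply, map_mulVec_ofReal, map_mulVec_ofReal,
      homVec_tangentToComplex hx' v' j, h1, hl, hh]
    simp only [Pi.smul_apply, smul_eq_mul]
    push_cast
    ring
  have hlast : D * (g.val.map (algebraMap ℝ ℂ) *ᵥ homVec z) (Sum.inr ()) = τ * D' := by
    rw [key]
    simp [homVec]
  ext i
  have hi := key (Sum.inl i)
  simp only [projMap]
  rw [← mul_div_mul_left _ _ hD, hlast, hi]
  simp only [homVec, Sum.elim_inl]
  field_simp

end TangentModel

/-! ### Coverings and deck transformations -/

section Covering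
variable {N X : Type*} [TopologicalSpace N] [TopologicalSpace X]

/-- A covering map between simply connected spaces is a homeomorphism, provided that the base is
locally path-connected. -/
lemma exists_homeomorph_of_isCoveringMap [SimplyConnectedSpace N] [SimplyConnectedSpace X]
    [LocallyPathConnectedSpace X] {f : N → X} (hf : IsCoveringMap f) :
    ∃ D : N ≃ₜ X, ⇑D = f := by
  obtain ⟨z₀⟩ : Nonempty N := inferInstance
  obtain ⟨s, ⟨hs0, hs⟩, -⟩ := hf.existsUnique_continuousMap_lifts (ContinuousMap.id X) (f z₀) z₀ rfl
  have h1 : ∀ x, f (s x) = x := fun x => congrFun hs x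
  -- Both sides are lifts of `f` through itself that agree at `z₀`, and `N` is connected.
  have h2 : s ∘ f = id := hf.eq_of_comp_eq (s.continuous.comp hf.continuous) continuous_id
    (funext fun z => h1 (f z)) z₀ hs0
  exact ⟨{ toFun := f, invFun := s, left_inv := fun z => congrFun h2 z, right_inv := h1,
           continuous_toFun := hf.continuous, continuous_invFun := s.continuous }, rfl⟩

/-- A simply connected covering is normal. -/
lemma exists_deckTransformation [SimplyConnectedSpace N] [LocallyPathConnectedSpace N] {p : N → X}
    (hp : IsCoveringMap p) {z w : N} (h : p z = p w) :
    ∃ τ : N ≃ₜ N, (∀ y, p (τ y) = p y) ∧ τ z = w := by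
  obtain ⟨s, ⟨hs0, hs⟩, -⟩ :=
    hp.existsUnique_continuousMap_lifts ⟨p, hp.continuous⟩ z w h.symm
  obtain ⟨t, ⟨ht0, ht⟩, -⟩ :=
    hp.existsUnique_continuousMap_lifts ⟨p, hp.continuous⟩ w z h
  have hs' : ∀ y, p (s y) = p y := fun y => congrFun hs y
  have ht' : ∀ y, p (t y) = p y := fun y => congrFun ht y
  have h1 : t ∘ s = id := hp.eq_of_comp_eq (t.continuous.comp s.continuous) continuous_id
    (funext fun y => (ht' _).trans (hs' y)) z (by simp [hs0, ht0])
  have h2 : s ∘ t = id := hp.eq_of_comp_eq (s.continuous.comp t.continuous) continuous_id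
    (funext fun y => (hs' _).trans (ht' y)) w (by simp [hs0, ht0])
  exact ⟨{ toFun := s, invFun := t, left_inv := fun y => congrFun h1 y,
           right_inv := fun y => congrFun h2 y, continuous_toFun := s.continuous,
           continuous_invFun := t.continuous }, hs', hs0⟩

/-- Project a path from `z₀` to `w`: the result is a loop, and its lift from `z₀` is the original
path. -/
lemma exists_monodromy_eq [PathConnectedSpace N] {p : N → X} (hp : IsCoveringMap p) {z₀ w : N}
    (h : p w = p z₀) :
    ∃ γ : FundamentalGroup X (p z₀), w = hp.monodromy γ.toPath ⟨z₀, rfl⟩ := by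
  let c : Path z₀ w := PathConnectedSpace.somePath z₀ w
  let Γ : Path.Homotopic.Quotient z₀ w := .mk c
  refine ⟨FundamentalGroup.fromPath ((Γ.map ⟨p, hp.continuous⟩).cast rfl h.symm), ?_⟩
  -- The end points `p w` and `p z₀` are only propositionally equal; this moves a class of paths to
  -- the base point and back.
  have hcast : ∀ {x y y' : X} (e : y = y') (a : Path.Homotopic.Quotient x y),
      a = (a.cast rfl e.symm).cast rfl e := by
    rintro x y _ rfl a
    simp
  have := hp.monodromy_eq_of_map_eq (γ := (Γ.map ⟨p, hp.continuous⟩).cast rfl h.symm)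
    (ex := ⟨z₀, rfl⟩) (ey := ⟨w, h⟩) Γ (hcast h _)
  exact (congrArg Subtype.val this).symm

/-- The lifts of the two loops from `z₀` have the same end point, so they are homotopic in the
simply connected `N`. Projecting the homotopy shows that the loops are equal in the fundamental
group. -/
lemma eq_of_monodromy_eq [SimplyConnectedSpace N] {p : N → X} (hp : IsCoveringMap p) {z₀ : N}
    {γ δ : FundamentalGroup X (p z₀)}
    (h : hp.monodromy γ.toPath ⟨z₀, rfl⟩ = hp.monodromy δ.toPath ⟨z₀, rfl⟩) : γ = δ := by
  have key : ∀ (γ : Path.Homotopic.Quotient (p z₀) (p z₀)) (y : p ⁻¹' {p z₀})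
      (_ : hp.monodromy γ ⟨z₀, rfl⟩ = y) (c : Path.Homotopic.Quotient z₀ y.1),
      γ.cast rfl y.2 = c.map ⟨p, hp.continuous⟩ := by
    rintro γ _ rfl c
    rw [Subsingleton.elim c (hp.liftPathQuotient γ ⟨z₀, rfl⟩)]
    exact (hp.map_liftPathQuotient γ ⟨z₀, rfl⟩).symm
  have c := hp.liftPathQuotient δ.toPath ⟨z₀, rfl⟩
  have h1 := (key γ.toPath _ h c).trans (key δ.toPath _ rfl c).symm
  have inj : ∀ {x y y' : X} (e : y' = y) (a b : Path.Homotopic.Quotient x y),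
      a.cast rfl e = b.cast rfl e → a = b := by
    rintro x y _ rfl a b hab
    simpa using hab
  exact inj _ _ _ h1

/-- A covering of a connected space by a nonempty space is surjective. -/
lemma surjective_of_isCoveringMap [Nonempty N] [PathConnectedSpace X] {p : N → X}
    (hp : IsCoveringMap p) : Function.Surjective p := by
  intro x
  obtain ⟨z₀⟩ : Nonempty N := inferInstance
  let c : Path (p z₀) x := PathConnectedSpace.somePath _ _
  obtain ⟨Γ, hΓ, -⟩ := hp.exists_path_lifts c.toContinuousMap z₀ (by simp)
  exact ⟨Γ 1, by simpa using congrFun hΓ 1⟩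

end Covering

/-! ### From the real to the complex hyperbolic space -/

section HypSpace
variable {n : ℕ}

lemma convex_hypBall : Convex ℝ (hypBall ℝ n : Set (RSpace n)) := convex_ball 0 1

/-- This and the next instance make the real ball an admissible base in
`exists_homeomorph_of_isCoveringMap`. -/
instance : ContractibleSpace (HypSpace ℝ n) :=
  convex_hypBall.contractibleSpace ⟨0, by simp [hypBall]⟩

instance : LocallyPathConnectedSpace (HypSpace ℝ n) :=
  (hypBall ℝ n).isOpen.locallyPathConnectedSpace

lemma coe_smul_real (g : specialPseudoUnitary ℝ n) (x : HypSpace ℝ n) :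
    (g • x).1 = projMap g.1.1.val x.1 := rfl

lemma complexToTangent_smul (g : specialPseudoUnitary ℝ n) (z : HypSpace ℂ n) :
    complexToTangent (iotaSO n g • z).1 = (projMap g.1.1.val (complexToTangent z.1).1,
      fderiv ℝ (projMap g.1.1.val) (complexToTangent z.1).1 (complexToTangent z.1).2) := by
  have h := complexToTangent_fst_mem z.2
  rw [← complexToTangent_tangentToComplex (projMap_mem g.1.2 h),
    tangentToComplex_equivariant g.1.2 h, tangentToComplex_complexToTangent z.2]
  rfl

/-- The projection from `H^n_ℂ` to `H^n_ℝ` along the fibres of the tangent bundle. -/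
def realProj (z : HypSpace ℂ n) : HypSpace ℝ n :=
  ⟨(complexToTangent z.1).1, complexToTangent_fst_mem z.2⟩

lemma continuous_realProj : Continuous (realProj (n := n)) :=
  Continuous.subtype_mk (continuous_fst.comp (continuousOn_iff_continuous_domRestrict.1
    contDiffOn_complexToTangent.continuousOn)) _

lemma realProj_smul (g : specialPseudoUnitary ℝ n) (z : HypSpace ℂ n) :
    realProj (iotaSO n g • z) = g • realProj z :=
  Subtype.ext (congrArg Prod.fst (complexToTangent_smul g z))

variable {Γ : Type*} [Group Γ] (ρ : Γ →* specialPseudoUnitary ℝ n)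

/-- The action of `ρ(Γ)` on `H^n_ℝ` is properly discontinuous. -/
def IsProperlyDiscontinuousRep : Prop :=
  ∀ K L : Set (HypSpace ℝ n), IsCompact K → IsCompact L →
    {g : specialPseudoUnitary ℝ n | g ∈ ρ.range ∧ ((g • ·) '' K ∩ L).Nonempty}.Finite

variable {ρ}

/-- Proper discontinuity pulls back along the continuous equivariant map `realProj`: an element that
moves K to meet L also moves the compact image of K to meet that of L. -/
lemma IsProperlyDiscontinuousRep.kleinianGroup (h : IsProperlyDiscontinuousRep ρ) :
    ProperlyDiscontinuousSMul (kleinianGroup ρ) (HypSpace ℂ n) where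
  finite_disjoint_inter_image {K L} hK hL := by
    have h1 := (h _ _ (hK.image continuous_realProj) (hL.image continuous_realProj)).image
      (iotaSO n)
    refine Set.Finite.of_finite_image (f := Subtype.val) (h1.subset ?_) Subtype.val_injective.injOn
    rintro _ ⟨⟨_, γ, rfl⟩, ⟨_, ⟨z, hz, rfl⟩, hz'⟩, rfl⟩
    refine ⟨ρ γ, ⟨⟨γ, rfl⟩, realProj (iotaSO n (ρ γ) • z), ⟨_, ⟨z, hz, rfl⟩, ?_⟩, ⟨_, hz', rfl⟩⟩,
      rfl⟩
    exact (realProj_smul (ρ γ) z).symm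

/-- A fixed point in the complex ball projects to a fixed point in the real ball. -/
lemma isCancelSMul_kleinianGroup (h : ∀ γ (x : HypSpace ℝ n), ρ γ • x = x → ρ γ = 1) :
    IsCancelSMul (kleinianGroup ρ) (HypSpace ℂ n) := by
  refine isCancelSMul_iff_eq_one_of_smul_eq.2 ?_
  rintro ⟨_, γ, rfl⟩ z hz
  have h1 : ρ γ • realProj z = realProj z := by
    rw [← realProj_smul]
    exact congrArg realProj hz
  exact Subtype.ext (by simp [h γ _ h1])

lemma orbit_kleinianGroup_iff {z w : HypSpace ℂ n} :
    (Quotient.mk _ z : MulAction.orbitRel.Quotient (kleinianGroup ρ) (HypSpace ℂ n))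
      = Quotient.mk _ w ↔ ∃ γ, iotaSO n (ρ γ) • z = w := by
  rw [Quotient.eq, MulAction.orbitRel_apply, MulAction.mem_orbit_iff]
  constructor
  · rintro ⟨⟨_, γ, rfl⟩, hγ⟩
    refine ⟨γ⁻¹, ?_⟩
    rw [map_inv, map_inv, inv_smul_eq_iff]
    exact hγ.symm
  · rintro ⟨γ, rfl⟩
    refine ⟨⟨_, γ⁻¹, rfl⟩, ?_⟩
    change iotaSO n (ρ γ⁻¹) • iotaSO n (ρ γ) • z = z
    rw [map_inv, map_inv, inv_smul_smul]

end HypSpace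

/-! ### Quotients of real hyperbolic space and their tangent orbibundles -/

lemma tangentLift_trans {Q E : Type*} [NormedAddCommGroup E] [NormedSpace ℝ E]
    {U₁ U₂ U₃ : TopologicalSpace.Opens E} {p₁ : U₁ → Q} {p₂ : U₂ → Q} {p₃ : U₃ → Q}
    {h k : OpenPartialHomeomorph E E} (hh : IsSmoothLift E E p₁ p₂ id h)
    (hk : IsSmoothLift E E p₂ p₃ id k) {a : E × E} (ha : a.1 ∈ h.source)
    (ha' : h a.1 ∈ k.source) :
    Orbifold.tangentLift (h.trans k) (lift_trans hh hk) a
      = Orbifold.tangentLift k hk (Orbifold.tangentLift h hh a) := by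
  have h1 := (lift_hasFDerivAt hk ha').comp a.1 (lift_hasFDerivAt hh ha)
  refine Prod.ext rfl ?_
  change fderiv ℝ (k ∘ h) a.1 a.2 = fderiv ℝ k (h a.1) (fderiv ℝ h a.1 a.2)
  rw [h1.fderiv]
  rfl

lemma contDiffOn_tangentLift {Q E : Type*} [NormedAddCommGroup E] [NormedSpace ℝ E]
    {U₁ U₂ : TopologicalSpace.Opens E} {p₁ : U₁ → Q} {p₂ : U₂ → Q}
    {h : OpenPartialHomeomorph E E} (hh : IsSmoothLift E E p₁ p₂ id h) :
    ContDiffOn ℝ ∞ (Orbifold.tangentLift h hh) (h.source ×ˢ Set.univ) :=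
  Orbifold.contDiffOn_tangentMap h.open_source (contMDiffOn_iff_contDiffOn.1 hh.smooth)

section Uniformization
variable {n : ℕ} {Q : Type*} [TopologicalSpace Q] {O : Orbifold (RSpace n) Q}
  {Γ : Type*} [Group Γ] {ρ : Γ →* specialPseudoUnitary ℝ n} {q : HypSpace ℝ n → Q}

/-- The map `q` exhibits the orbifold `O` as the quotient of `H^n_ℝ` by `ρ(Γ)`. -/
structure IsUniformization (O : Orbifold (RSpace n) Q) (ρ : Γ →* specialPseudoUnitary ℝ n)
    (q : HypSpace ℝ n → Q) : Prop where
  surjective : Function.Surjective q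
  apply_eq_iff : ∀ x y, q x = q y ↔ ∃ γ, ρ γ • x = y
  exists_lift : ∀ (x : HypSpace ℝ n) (i : O.ι) (u : O.dom i), q x = O.chart i u →
    ∃ k : OpenPartialHomeomorph (RSpace n) (RSpace n),
      IsSmoothLift (RSpace n) (RSpace n) q (O.chart i) id k ∧ x.1 ∈ k.source ∧ k x.1 = u.1
  properlyDiscontinuous : IsProperlyDiscontinuousRep ρ

/-- The projective transformation of an element of `SO(n,1)`, restricted to the unit ball. -/
def projHomeo (g : specialPseudoUnitary ℝ n) : OpenPartialHomeomorph (RSpace n) (RSpace n) where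
  toFun := projMap g.1.1.val
  invFun := projMap (g⁻¹).1.1.val
  source := hypBall ℝ n
  target := hypBall ℝ n
  map_source' _ hx := projMap_mem g.1.2 hx
  map_target' _ hx := projMap_mem (g⁻¹).1.2 hx
  left_inv' x hx := congrArg Subtype.val (inv_smul_smul g (⟨x, hx⟩ : HypSpace ℝ n))
  right_inv' x hx := congrArg Subtype.val (smul_inv_smul g (⟨x, hx⟩ : HypSpace ℝ n))
  open_source := (hypBall ℝ n).isOpen
  open_target := (hypBall ℝ n).isOpen
  continuousOn_toFun := (projMap_contDiffOn g.1.2).continuousOn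
  continuousOn_invFun := (projMap_contDiffOn (g⁻¹).1.2).continuousOn

/-- The property of the projection from `H^n_ℂ` to the total space of the tangent orbibundle that
in local lifts it is given by the differential. -/
def IsTangentProj (O : Orbifold (RSpace n) Q) (q : HypSpace ℝ n → Q)
    (θ : HypSpace ℂ n → O.TangentTotal) : Prop :=
  ∀ (z : HypSpace ℂ n) (j : O.ι) (l : OpenPartialHomeomorph (RSpace n) (RSpace n))
      (hl : IsSmoothLift (RSpace n) (RSpace n) q (O.chart j) id l)
      (hz : (complexToTangent z.1).1 ∈ l.source),
      θ z = O.tangentChart j ⟨Orbifold.tangentLift l hl (complexToTangent z.1),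
        hl.target_subset (l.map_source hz), trivial⟩

namespace IsUniformization

/-- Group elements are themselves local lifts of the identity of `Q`, so they can be composed with
chart lifts. -/
lemma isSmoothLift_projHomeo (hU : IsUniformization O ρ q) (γ : Γ) :
    IsSmoothLift (RSpace n) (RSpace n) q q id (projHomeo (ρ γ)) where
  source_subset _ hx := hx
  target_subset _ hx := hx
  smooth := contMDiffOn_iff_contDiffOn.2 (projMap_contDiffOn (ρ γ).1.2)
  smooth_symm := contMDiffOn_iff_contDiffOn.2 (projMap_contDiffOn ((ρ γ)⁻¹).1.2)
  comm x y _ hxy := ((hU.apply_eq_iff x y).2 ⟨γ, Subtype.ext hxy⟩).symm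

/-- A local diffeomorphism of `H^n_ℝ` over the quotient agrees to first order, in any given
direction, with an element of the group. -/
lemma exists_fderiv_eq (hU : IsUniformization O ρ q)
    {f : OpenPartialHomeomorph (RSpace n) (RSpace n)}
    (hf : IsSmoothLift (RSpace n) (RSpace n) q q id f) {x : RSpace n} (hx : x ∈ f.source)
    (v : RSpace n) :
    ∃ γ, projMap (ρ γ).1.1.val x = f x ∧ fderiv ℝ (projMap (ρ γ).1.1.val) x v = fderiv ℝ f x v := by
  by_contra hcon
  have hxb : x ∈ hypBall ℝ n := hf.source_subset hx
  have hyb : f x ∈ hypBall ℝ n := hf.target_subset (f.map_source hx)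
  -- Compact neighbourhoods of `x` and `f x` leave only finitely many group elements as candidates.
  obtain ⟨K, hK, hKx⟩ := exists_compact_mem_nhds (⟨x, hxb⟩ : HypSpace ℝ n)
  obtain ⟨L, hL, hLx⟩ := exists_compact_mem_nhds (⟨f x, hyb⟩ : HypSpace ℝ n)
  have hfin := hU.properlyDiscontinuous K L hK hL
  have hK' : Subtype.val '' K ∈ 𝓝 x :=
    (hypBall ℝ n).isOpen.isOpenEmbedding_subtypeVal.image_mem_nhds.2 hKx
  have hL' : Subtype.val '' L ∈ 𝓝 (f x) :=
    (hypBall ℝ n).isOpen.isOpenEmbedding_subtypeVal.image_mem_nhds.2 hLx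
  have hline : Filter.Tendsto (fun t : ℝ => x + t • v) (𝓝[≠] 0) (𝓝 x) := by
    have h0 : Filter.Tendsto (fun t : ℝ => x + t • v) (𝓝 0) (𝓝 (x + (0 : ℝ) • v)) :=
      Continuous.tendsto (by fun_prop) 0
    rw [zero_smul, add_zero] at h0
    exact h0.mono_left nhdsWithin_le_nhds
  have hlineD : HasDerivAt (fun t : ℝ => x + t • v) v 0 := by
    simpa using ((hasDerivAt_id (0 : ℝ)).smul_const v).const_add x
  -- By the assumed contradiction each candidate differs from `f` at `x` in its value or in its
  -- derivative along `v`. In either case it differs from `f` at x + tv for all small t ≠ 0.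
  have hev : ∀ g ∈ {g : specialPseudoUnitary ℝ n | g ∈ ρ.range ∧ ((g • ·) '' K ∩ L).Nonempty},
      ∀ᶠ t : ℝ in 𝓝[≠] 0, f (x + t • v) - projMap g.1.1.val (x + t • v) ≠ 0 := by
    rintro _ ⟨⟨γ, rfl⟩, -⟩
    have hD : HasDerivAt (fun t : ℝ => f (x + t • v) - projMap (ρ γ).1.1.val (x + t • v))
        (fderiv ℝ f x v - fderiv ℝ (projMap (ρ γ).1.1.val) x v) 0 := by
      refine HasDerivAt.sub ?_ ?_
      · exact HasFDerivAt.comp_hasDerivAt (0 : ℝ)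
          (by simpa using lift_hasFDerivAt hf (x := x) hx) hlineD
      · exact HasFDerivAt.comp_hasDerivAt (0 : ℝ)
          (by simpa using lift_hasFDerivAt (hU.isSmoothLift_projHomeo γ) (x := x) hxb) hlineD
    by_cases h0 : projMap (ρ γ).1.1.val x = f x
    · exact hD.eventually_ne fun h1 => hcon ⟨γ, h0, (sub_eq_zero.1 h1).symm⟩
    · have h2 := hD.continuousAt.tendsto.mono_left (nhdsWithin_le_nhds (s := {0}ᶜ))
      refine h2.eventually_ne ?_
      simp only [zero_smul, add_zero]
      exact fun h1 => h0 (sub_eq_zero.1 h1).symm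
  -- Yet for each small t the points x + tv and f(x + tv) lie over the same point of `Q`, so some
  -- candidate maps one to the other.
  have hall : ∀ᶠ t : ℝ in 𝓝[≠] 0, False := by
    filter_upwards [(Filter.eventually_all_finite hfin).2 hev,
      hline (f.open_source.mem_nhds hx), hline hK',
      ((f.continuousAt hx).tendsto.comp hline) hL'] with t h1 h2 h3 h4
    have h2' : x + t • v ∈ f.source := h2
    obtain ⟨a, ha, hax⟩ := h3
    have hax' : a.1 = x + t • v := hax
    obtain ⟨b, hb, hbx⟩ := h4
    have hbx' : b.1 = f (x + t • v) := hbx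
    have hab := hf.comm a b (hax' ▸ h2') (by rw [hax', hbx'])
    obtain ⟨γ, hγ⟩ := (hU.apply_eq_iff a b).1 hab.symm
    refine h1 (ρ γ) ⟨⟨γ, rfl⟩, b, ⟨a, ha, hγ⟩, hb⟩ ?_
    rw [← hbx', ← hax', ← hγ, coe_smul_real, sub_self]
  exact hall.exists.elim fun _ hf => hf

lemma exists_lift_at (hU : IsUniformization O ρ q) (x : HypSpace ℝ n) :
    ∃ (j : O.ι) (l : OpenPartialHomeomorph (RSpace n) (RSpace n)),
      IsSmoothLift (RSpace n) (RSpace n) q (O.chart j) id l ∧ x.1 ∈ l.source := by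
  obtain ⟨i, u, hu⟩ := O.cover (q x)
  obtain ⟨k, hk, hx, -⟩ := hU.exists_lift x i u hu.symm
  exact ⟨i, k, hk, hx⟩

/-- The projection from `H^n_ℂ` to the total space of the tangent orbibundle. -/
lemma exists_tangentProj (hU : IsUniformization O ρ q) :
    ∃ θ : HypSpace ℂ n → O.TangentTotal, IsTangentProj O q θ := by
  choose i k hk hx using hU.exists_lift_at
  refine ⟨fun z => O.tangentChart (i (realProj z)) ⟨Orbifold.tangentLift _ (hk (realProj z))
    (complexToTangent z.1), (hk _).target_subset ((k _).map_source (hx (realProj z))), trivial⟩,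
    fun z j l hl hz => ?_⟩
  refine (O.tangentChart_eq_iff _ _ _ _).2
    -- The transition from the chosen lift to `l` goes back to the ball and out again. Its
    -- differential carries the vector obtained from the chosen lift to the one obtained from `l`.
    ⟨(k (realProj z)).symm.trans l, lift_trans (lift_symm (hk (realProj z))) hl, ?_⟩
  have hx' : (complexToTangent z.1).1 ∈ (k (realProj z)).source := hx (realProj z)
  have h1 : k (realProj z) (complexToTangent z.1).1 ∈ (k (realProj z)).symm.source :=
    (k (realProj z)).map_source hx'
  have h2 : (k (realProj z)).symm (k (realProj z) (complexToTangent z.1).1) ∈ l.source := by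
    rwa [(k (realProj z)).left_inv hx']
  have h3 := tangentLift_trans (lift_symm (hk (realProj z))) hl
    (a := Orbifold.tangentLift _ (hk (realProj z)) (complexToTangent z.1)) h1 h2
  have h4 : Orbifold.tangentLift _ (lift_symm (hk (realProj z)))
      (Orbifold.tangentLift _ (hk (realProj z)) (complexToTangent z.1)) = complexToTangent z.1 :=
    (Orbifold.tangentLift _ (hk (realProj z))).left_inv ⟨hx', trivial⟩
  rw [h4] at h3
  refine ⟨?_, congrArg Prod.fst h3, congrArg Prod.snd h3⟩
  simp only [OpenPartialHomeomorph.trans_source]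
  exact ⟨h1, h2⟩

end IsUniformization

/-! ### The projection from complex hyperbolic space to the tangent orbibundle and its fibres. -/

namespace IsTangentProj
variable {θ : HypSpace ℂ n → O.TangentTotal}

/-- The local lift of the projection `H^n_ℂ → T Q` to a chart. -/
lemma exists_localLift (hθ : IsTangentProj O q θ) {j : O.ι}
    {l : OpenPartialHomeomorph (RSpace n) (RSpace n)}
    (hl : IsSmoothLift (RSpace n) (RSpace n) q (O.chart j) id l) :
    ∃ T : OpenPartialHomeomorph (EuclideanSpace ℂ (Fin n)) (RSpace n × RSpace n),
      (∀ z : HypSpace ℂ n, z.1 ∈ T.source ↔ (complexToTangent z.1).1 ∈ l.source) ∧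
      (∀ z, T z = Orbifold.tangentLift l hl (complexToTangent z)) ∧
      T.source ⊆ hypBall ℂ n ∧ T.target ⊆ O.tangentDom j ∧
      ContDiffOn ℝ ∞ T T.source ∧ ContDiffOn ℝ ∞ T.symm T.target ∧
      ∀ (z : HypSpace ℂ n) (y : O.tangentDom j), z.1 ∈ T.source → T z.1 = y.1 →
        θ z = O.tangentChart j y := by
  have hsrc : ∀ z : HypSpace ℂ n,
      z.1 ∈ ((complexTangentHomeo n).trans (Orbifold.tangentLift l hl)).source
        ↔ (complexToTangent z.1).1 ∈ l.source := by
    intro z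
    simp only [OpenPartialHomeomorph.trans_source]
    exact ⟨fun h => h.2.1, fun h => ⟨z.2, h, trivial⟩⟩
  refine ⟨(complexTangentHomeo n).trans (Orbifold.tangentLift l hl), hsrc, fun _ => rfl,
    ?_, ?_, ?_, ?_, ?_⟩
  · intro z hz
    simp only [OpenPartialHomeomorph.trans_source] at hz
    exact hz.1
  · intro a ha
    simp only [OpenPartialHomeomorph.trans_target] at ha
    exact ⟨hl.target_subset ha.1.1, trivial⟩
  · refine (contDiffOn_tangentLift hl).comp (contDiffOn_complexToTangent.mono ?_) ?_ <;>
      intro z hz <;> simp only [OpenPartialHomeomorph.trans_source] at hz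
    exacts [hz.1, hz.2]
  · refine contDiffOn_tangentToComplex.comp
      ((contDiffOn_tangentLift (lift_symm hl)).mono ?_) ?_ <;>
      intro z hz <;> simp only [OpenPartialHomeomorph.trans_target] at hz
    exacts [hz.1, hz.2]
  · intro z y hz hzy
    rw [hθ z j l hl ((hsrc z).1 hz)]
    exact congrArg _ (Subtype.ext hzy)

lemma continuous (hθ : IsTangentProj O q θ) (hU : IsUniformization O ρ q) :
    Continuous θ := by
  refine continuous_iff_continuousAt.2 fun z => ?_
  obtain ⟨j, l, hl, hz⟩ := hU.exists_lift_at (realProj z)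
  obtain ⟨T, hT, -, -, hTt, -, -, hTθ⟩ := hθ.exists_localLift hl
  let W : Set (HypSpace ℂ n) := Subtype.val ⁻¹' T.source
  have hW : IsOpen W := T.open_source.preimage continuous_subtype_val
  refine ContinuousOn.continuousAt ?_ (hW.mem_nhds ((hT z).2 hz))
  rw [continuousOn_iff_continuous_domRestrict]
  have h1 : W.domRestrict θ = O.tangentChart j ∘
      fun w : W => (⟨T w.1.1, hTt (T.map_source w.2)⟩ : O.tangentDom j) :=
    funext fun w => hTθ w.1 _ w.2 rfl
  rw [h1]
  refine (O.tangentOrbibundle.isChart j).continuous.comp (Continuous.subtype_mk ?_ _)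
  exact T.continuousOn.comp_continuous (by fun_prop) fun w => w.2

lemma isOpenMap (hθ : IsTangentProj O q θ) (hU : IsUniformization O ρ q) :
    IsOpenMap θ := by
  intro s hs
  refine isOpen_iff_mem_nhds.2 ?_
  rintro _ ⟨z, hzs, rfl⟩
  obtain ⟨j, l, hl, hz⟩ := hU.exists_lift_at (realProj z)
  obtain ⟨T, hT, -, -, hTt, -, -, hTθ⟩ := hθ.exists_localLift hl
  have hs' : IsOpen (Subtype.val '' s : Set (EuclideanSpace ℂ (Fin n))) :=
    (hypBall ℂ n).isOpen.isOpenMap_subtype_val s hs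
  have hV := T.isOpen_image_source_inter hs'
  have hB := O.isOpenMap_tangentChart j _
    (hV.preimage (continuous_subtype_val (p := fun a => a ∈ O.tangentDom j)))
  refine Filter.mem_of_superset (hB.mem_nhds ?_) ?_
  · have hzT := (hT z).2 hz
    exact ⟨⟨T z.1, hTt (T.map_source hzT)⟩, ⟨z.1, ⟨hzT, z, hzs, rfl⟩, rfl⟩, (hTθ z _ hzT rfl).symm⟩
  · rintro _ ⟨a, ⟨_, ⟨hwT, w, hws, rfl⟩, hwa⟩, rfl⟩
    exact ⟨w, hws, hTθ w a hwT hwa⟩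

/-- A tangent vector in a chart is pulled back to the ball by the inverse differential of a chart
lift, and then moved to the complex ball by `tangentToComplex`. -/
lemma surjective (hθ : IsTangentProj O q θ) (hU : IsUniformization O ρ q) :
    Function.Surjective θ := by
  intro y
  obtain ⟨j, a, rfl⟩ := O.tangentOrbibundle.cover y
  obtain ⟨x, hx⟩ := hU.surjective (O.chart j ⟨a.1.1, a.2.1⟩)
  obtain ⟨l, hl, hxl, hlx⟩ := hU.exists_lift x j _ hx
  have ha : a.1 ∈ (Orbifold.tangentLift l hl).target :=
    ⟨by have := l.map_source hxl; rwa [hlx] at this, trivial⟩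
  have h1 := (Orbifold.tangentLift l hl).map_target ha
  let b := (Orbifold.tangentLift l hl).symm a.1
  have hb : b.1 ∈ hypBall ℝ n := hl.source_subset h1.1
  have hc : complexToTangent (tangentToComplex b) = b := complexToTangent_tangentToComplex hb b.2
  refine ⟨⟨tangentToComplex b, tangentToComplex_mem hb b.2⟩, ?_⟩
  rw [hθ _ j l hl (by rw [hc]; exact h1.1)]
  refine congrArg (O.tangentChart j) (Subtype.ext ?_)
  change Orbifold.tangentLift l hl (complexToTangent (tangentToComplex b)) = a.1
  rw [hc]
  exact (Orbifold.tangentLift l hl).right_inv ha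

/-- If z and w have the same image, then a chart lift, a change of charts and the inverse of a chart
lift compose to a local diffeomorphism of the real ball over `Q` whose differential carries the
tangent vector of z to that of w. By `exists_fderiv_eq` a group element does the same to this one
vector, and equivariance turns this into γz = w. The converse is the chain rule. -/
lemma apply_eq_iff (hθ : IsTangentProj O q θ) (hU : IsUniformization O ρ q)
    (z w : HypSpace ℂ n) : θ z = θ w ↔ ∃ γ, iotaSO n (ρ γ) • z = w := by
  obtain ⟨j, l, hl, hw⟩ := hU.exists_lift_at (realProj w)
  have hw' : (complexToTangent w.1).1 ∈ l.source := hw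
  constructor
  · intro h
    obtain ⟨i, k, hk, hz⟩ := hU.exists_lift_at (realProj z)
    have hz' : (complexToTangent z.1).1 ∈ k.source := hz
    rw [hθ z i k hk hz, hθ w j l hl hw, O.tangentChart_eq_iff] at h
    obtain ⟨h, hh, h1, h2, h3⟩ := h
    have h1' : k (complexToTangent z.1).1 ∈ h.source := h1
    have h2' : h (k (complexToTangent z.1).1) = l (complexToTangent w.1).1 := h2
    have hsrc : (complexToTangent z.1).1 ∈ (k.trans (h.trans l.symm)).source := by
      simp only [OpenPartialHomeomorph.trans_source]
      refine ⟨hz', h1', ?_⟩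
      rw [Set.mem_preimage, h2']
      exact l.map_source hw'
    have hT : Orbifold.tangentLift (k.trans (h.trans l.symm))
        (lift_trans hk (lift_trans hh (lift_symm hl))) (complexToTangent z.1)
        = complexToTangent w.1 := by
      have h4 : h (k (complexToTangent z.1).1) ∈ l.symm.source := by
        rw [h2']
        exact l.map_source hw'
      have h5 : k (complexToTangent z.1).1 ∈ (h.trans l.symm).source := ⟨h1', h4⟩
      rw [tangentLift_trans hk (lift_trans hh (lift_symm hl)) hz' h5,
        tangentLift_trans hh (lift_symm hl) h1 h4]
      have : Orbifold.tangentLift h hh (Orbifold.tangentLift k hk (complexToTangent z.1))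
          = Orbifold.tangentLift l hl (complexToTangent w.1) := Prod.ext h2 h3
      rw [this]
      exact (Orbifold.tangentLift l hl).left_inv ⟨hw', trivial⟩
    obtain ⟨γ, h4, h5⟩ := hU.exists_fderiv_eq
      (lift_trans hk (lift_trans hh (lift_symm hl))) hsrc (complexToTangent z.1).2
    refine ⟨γ, Subtype.ext ?_⟩
    rw [← tangentToComplex_complexToTangent (iotaSO n (ρ γ) • z).2,
      ← tangentToComplex_complexToTangent w.2, complexToTangent_smul, h4, h5, ← hT]
    rfl
  · rintro ⟨γ, rfl⟩
    have hgz := complexToTangent_smul (ρ γ) z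
    have hz0 := complexToTangent_fst_mem z.2
    have hg := hU.isSmoothLift_projHomeo γ
    have hT : Orbifold.tangentLift (projHomeo (ρ γ)) hg (complexToTangent z.1)
        = complexToTangent (iotaSO n (ρ γ) • z).1 := hgz.symm
    have h1 : projHomeo (ρ γ) (complexToTangent z.1).1 ∈ l.source := by
      have := congrArg Prod.fst hT
      change projHomeo (ρ γ) (complexToTangent z.1).1 = _ at this
      rw [this]; exact hw
    rw [hθ z j ((projHomeo (ρ γ)).trans l) (lift_trans hg hl) ⟨hz0, h1⟩,
      hθ _ j l hl hw]
    refine congrArg (O.tangentChart j) (Subtype.ext ?_)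
    exact (tangentLift_trans hg hl hz0 h1).trans (congrArg _ hT)

/-- The quotient of `H^n_ℂ` is homeomorphic to the tangent orbibundle. -/
lemma exists_homeomorph (hθ : IsTangentProj O q θ) (hU : IsUniformization O ρ q) :
    ∃ F : MulAction.orbitRel.Quotient (kleinianGroup ρ) (HypSpace ℂ n) ≃ₜ O.TangentTotal,
      ∀ z, F (Quotient.mk _ z) = θ z := by
  let f : MulAction.orbitRel.Quotient (kleinianGroup ρ) (HypSpace ℂ n) → O.TangentTotal :=
    Quotient.lift θ fun z w h =>
      (hθ.apply_eq_iff hU z w).2 (orbit_kleinianGroup_iff.1 (Quotient.sound h))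
  have hinj : Function.Injective f := by
    intro a b
    induction a using Quotient.inductionOn with | _ z
    induction b using Quotient.inductionOn with | _ w
    exact fun h => orbit_kleinianGroup_iff.2 ((hθ.apply_eq_iff hU z w).1 h)
  have hsurj : Function.Surjective f := fun y => by
    obtain ⟨z, rfl⟩ := hθ.surjective hU y
    exact ⟨Quotient.mk _ z, rfl⟩
  have hcont : Continuous f := continuous_quot_lift _ (hθ.continuous hU)
  have hopen : IsOpenMap f := by
    intro s hs
    have : f '' s = θ '' (Quotient.mk _ ⁻¹' s) := by
      ext y
      constructor
      · rintro ⟨a, ha, rfl⟩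
        induction a using Quotient.inductionOn with | _ z
        exact ⟨z, ha, rfl⟩
      · rintro ⟨z, hz, rfl⟩
        exact ⟨_, hz, rfl⟩
    rw [this]
    exact hθ.isOpenMap hU _ (hs.preimage continuous_quotient_mk')
  exact ⟨(Equiv.ofBijective f ⟨hinj, hsurj⟩).toHomeomorphOfContinuousOpen hcont hopen, fun _ => rfl⟩

end IsTangentProj

/-- Charts of the quotient are adapted open subsets of the complex ball itself. A lift is therefore
`complexToTangent` followed by the differential of a lift of `q` to chart j, restricted to the
adapted set. -/
lemma IsUniformization.nonempty_orbifoldDiffeo (hU : IsUniformization O ρ q)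
    [ProperlyDiscontinuousSMul (kleinianGroup ρ) (HypSpace ℂ n)] :
    Nonempty (OrbifoldDiffeo (complexHyperbolicOrbifold (kleinianGroup ρ)) O.tangentOrbibundle) := by
  obtain ⟨θ, hθ⟩ := hU.exists_tangentProj
  obtain ⟨F, hF⟩ := hθ.exists_homeomorph hU
  refine ⟨⟨F, ?_⟩⟩
  rintro ⟨U, hUb, hUA⟩ j ⟨x, hx⟩ y hxy
  have hxy' : θ ⟨x, hUb hx⟩ = O.tangentChart j y := (hF _).symm.trans hxy
  obtain ⟨i, k, hk, hxk⟩ := hU.exists_lift_at (realProj ⟨x, hUb hx⟩)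
  have hxk' : (complexToTangent x).1 ∈ k.source := hxk
  -- The change of charts `h` corrects an arbitrary lift to one that hits the prescribed point `y`.
  obtain ⟨h, hh, h1, h2, h3⟩ :=
    (O.tangentChart_eq_iff i j _ y).1 ((hθ _ i k hk hxk).symm.trans hxy')
  have h1' : k (complexToTangent x).1 ∈ h.source := h1
  obtain ⟨T, hT, hTz, hTs, hTt, hTc, hTc', hTθ⟩ := hθ.exists_localLift (lift_trans hk hh)
  refine ⟨T.restrOpen U U.isOpen, ⟨?_, ?_, ?_, ?_, ?_⟩, ?_, ?_⟩
  · exact fun z hz => hz.2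
  · exact fun a ha => hTt ha.1
  · exact contMDiffOn_iff_contDiffOn.2 (hTc.mono fun z hz => hz.1)
  · exact contMDiffOn_iff_contDiffOn.2 (hTc'.mono fun z hz => hz.1)
  · intro z w hz hzw
    refine ((hF _).trans (hTθ ⟨z.1, hUb z.2⟩ w hz.1 hzw)).symm
  · exact ⟨(hT ⟨x, hUb hx⟩).2 ⟨hxk', h1'⟩, hx⟩
  · change T x = y.1
    rw [hTz, tangentLift_trans hk hh hxk' h1']
    exact Prod.ext h2 h3

end Uniformization

/-! ### Complete hyperbolic orbifolds -/

section GeneralLifts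
variable {E₁ E₂ E₃ N₁ N₂ N₃ Q : Type*}
  [NormedAddCommGroup E₁] [NormedSpace ℝ E₁] [NormedAddCommGroup E₂] [NormedSpace ℝ E₂]
  [NormedAddCommGroup E₃] [NormedSpace ℝ E₃]
  [TopologicalSpace N₁] [ChartedSpace E₁ N₁] [TopologicalSpace N₂] [ChartedSpace E₂ N₂]
  [TopologicalSpace N₃] [ChartedSpace E₃ N₃]
  {U₁ : TopologicalSpace.Opens N₁} {U₂ : TopologicalSpace.Opens N₂}
  {U₃ : TopologicalSpace.Opens N₃} {p₁ : U₁ → Q} {p₂ : U₂ → Q} {p₃ : U₃ → Q}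

/-- This and the next lemma are `lift_symm` and `lift_trans` for lifts between different manifolds,
as needed to pass between `N`, the ball and the charts. -/
lemma IsSmoothLift.symm_id {h : OpenPartialHomeomorph N₁ N₂}
    (hh : IsSmoothLift E₁ E₂ p₁ p₂ id h) : IsSmoothLift E₂ E₁ p₂ p₁ id h.symm where
  source_subset := hh.target_subset
  target_subset := hh.source_subset
  smooth := hh.smooth_symm
  smooth_symm := hh.smooth
  comm x y hx hxy := by
    have hy : y.1 ∈ h.source := hxy ▸ h.map_target hx
    exact (hh.comm y x hy (by rw [← hxy]; exact h.right_inv hx)).symm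

lemma IsSmoothLift.trans_id {h : OpenPartialHomeomorph N₁ N₂} {k : OpenPartialHomeomorph N₂ N₃}
    (hh : IsSmoothLift E₁ E₂ p₁ p₂ id h) (hk : IsSmoothLift E₂ E₃ p₂ p₃ id k) :
    IsSmoothLift E₁ E₃ p₁ p₃ id (h.trans k) where
  source_subset x hx := hh.source_subset (by simp at hx; exact hx.1)
  target_subset x hx := hk.target_subset (by simp at hx; exact hx.1)
  smooth := by
    refine hk.smooth.comp (hh.smooth.mono ?_) ?_ <;> intro x hx <;> simp at hx
    exacts [hx.1, hx.2]
  smooth_symm := by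
    refine hh.smooth_symm.comp (hk.smooth_symm.mono ?_) ?_ <;> intro x hx <;> simp at hx
    exacts [hx.1, hx.2]
  comm x y hx hxy := by
    simp at hx
    rw [hk.comm ⟨h x.1, hk.source_subset hx.2⟩ y hx.2 hxy,
      hh.comm x ⟨h x.1, hk.source_subset hx.2⟩ hx.1 rfl]
    rfl

end GeneralLifts

/-- Outside `X` the inverse of the inclusion takes junk values, which is why `X` has to be nonempty.
-/
lemma opensIncl_symm_coe {E : Type*} [TopologicalSpace E] {X : TopologicalSpace.Opens E}
    (hX : Nonempty X) {x : E} (hx : x ∈ X) :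
    (X.openPartialHomeomorphSubtypeCoe hX).symm x = ⟨x, hx⟩ :=
  (X.openPartialHomeomorphSubtypeCoe hX).left_inv (x := ⟨x, hx⟩) (by simp)

lemma contMDiffAt_opensIncl_symm {E : Type*} [NormedAddCommGroup E] [NormedSpace ℝ E]
    {X : TopologicalSpace.Opens E} (hX : Nonempty X) {x : E} (hx : x ∈ X) :
    ContMDiffAt 𝓘(ℝ, E) 𝓘(ℝ, E) ∞ (X.openPartialHomeomorphSubtypeCoe hX).symm x := by
  rw [← ContMDiffAt.subtypeVal_comp_iff]
  refine contMDiffAt_id.congr_of_eventuallyEq ?_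
  filter_upwards [X.isOpen.mem_nhds hx] with y hy
  simp only [Function.comp, id]
  rw [opensIncl_symm_coe hX hy]

/-! ### The unit ball as an open subset and as a manifold. -/

section HypChart
variable {n : ℕ}

/-- The inclusion of the unit ball, as a partial homeomorphism. -/
def ballIncl (𝕜 : Type*) [RCLike 𝕜] (n : ℕ) :
    OpenPartialHomeomorph (HypSpace 𝕜 n) (EuclideanSpace 𝕜 (Fin n)) :=
  (hypBall 𝕜 n).openPartialHomeomorphSubtypeCoe ⟨⟨0, by simp [hypBall]⟩⟩

lemma ballIncl_symm_coe {𝕜 : Type*} [RCLike 𝕜] {x : EuclideanSpace 𝕜 (Fin n)}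
    (hx : x ∈ hypBall 𝕜 n) : (ballIncl 𝕜 n).symm x = ⟨x, hx⟩ :=
  opensIncl_symm_coe _ hx

lemma contMDiffAt_ballIncl_symm {𝕜 : Type*} [RCLike 𝕜] {x : EuclideanSpace 𝕜 (Fin n)}
    (hx : x ∈ hypBall 𝕜 n) :
    ContMDiffAt 𝓘(ℝ, EuclideanSpace 𝕜 (Fin n)) 𝓘(ℝ, EuclideanSpace 𝕜 (Fin n)) ∞
      (ballIncl 𝕜 n).symm x :=
  contMDiffAt_opensIncl_symm _ hx

lemma contMDiff_smul_hypSpace (g : pseudoUnitary ℝ n) :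
    ContMDiff 𝓘(ℝ, RSpace n) 𝓘(ℝ, RSpace n) ∞ fun x : HypSpace ℝ n => g • x := by
  intro x
  rw [← ContMDiffAt.subtypeVal_comp_iff]
  have h : ContMDiffAt 𝓘(ℝ, RSpace n) 𝓘(ℝ, RSpace n) ∞ (projMap g.1.val) x.1 :=
    ((projMap_contDiffOn g.2).contDiffAt ((hypBall ℝ n).isOpen.mem_nhds x.2)).contMDiffAt
  exact contMDiffAt_subtype_iff.2 h

/-- A map on the ball can be regarded as defined on an open subset of the vector space, or on the
whole of the manifold `HypSpace ℝ n`. This lift translates between the two readings. -/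
lemma isSmoothLift_ballIncl_symm {Q : Type*} (q : HypSpace ℝ n → Q) :
    IsSmoothLift (RSpace n) (RSpace n) q (onTop q) id (ballIncl ℝ n).symm where
  source_subset x hx := by simpa [ballIncl] using hx
  target_subset _ _ := trivial
  smooth x hx := (contMDiffAt_ballIncl_symm (by simpa [ballIncl] using hx)).contMDiffWithinAt
  smooth_symm := by
    have : ⇑(ballIncl ℝ n).symm.symm = Subtype.val := by ext; simp [ballIncl]
    rw [this]
    exact contMDiff_subtype_val.contMDiffOn
  comm x y _ hxy := by
    rw [ballIncl_symm_coe x.2] at hxy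
    exact congrArg q hxy.symm

end HypChart

section CompleteOrbifold
variable {n : ℕ} {Q : Type*} [TopologicalSpace Q] {O : Orbifold (RSpace n) Q}
  {N : Type*} [TopologicalSpace N] [ChartedSpace (RSpace n) N]

/-- Both the covering `p` and the hyperbolic chart lift to one smooth chart of `O`. Composing one
lift with the inverse of the other gives a diffeomorphism from an open piece of `N` to the
hyperbolic chart, to which the developing condition applies. -/
lemma HyperbolicOrbifoldStructure.IsDevelopingMap.exists_local_isometry
    {S : HyperbolicOrbifoldStructure n O} {p : N → Q} {dev : N → HypSpace ℝ n}
    (hdev : S.IsDevelopingMap p dev) {Γ : Type*} [Group Γ] [MulAction Γ N]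
    (hp : IsOrbifoldQuotientMap O Γ p) (z : N) :
    ∃ h : OpenPartialHomeomorph N (HypSpace ℝ n), z ∈ h.source ∧
      ContMDiffOn 𝓘(ℝ, RSpace n) 𝓘(ℝ, RSpace n) ∞ h h.source ∧
      ContMDiffOn 𝓘(ℝ, RSpace n) 𝓘(ℝ, RSpace n) ∞ h.symm h.target ∧
      ∃ g : pseudoUnitary ℝ n, ∀ᶠ z' in 𝓝 z, h z' = g • dev z' := by
  obtain ⟨a, x, hx⟩ := S.cover (p z)
  obtain ⟨i, u, hu⟩ := O.cover (p z)
  obtain ⟨h₁, hh₁, hz, hzu⟩ := hp.exists_lift z i u hu.symm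
  obtain ⟨h₂, hh₂, hx, hxu⟩ := S.smooth a i x u (hx.trans hu.symm)
  have hh := hh₁.trans_id hh₂.symm_id
  have hsrc : z ∈ (h₁.trans h₂.symm).source := by
    simp only [OpenPartialHomeomorph.trans_source]
    refine ⟨hz, ?_⟩
    change h₁ z ∈ h₂.target
    rw [hzu, ← hxu]
    exact h₂.map_source hx
  exact ⟨h₁.trans h₂.symm, hsrc, hh.smooth, hh.smooth_symm, hdev a _ hh z hsrc⟩

/-- A bijective local isometry to `H^n_ℝ` is a diffeomorphism. -/
lemma contMDiff_of_local_isometry {D : N ≃ₜ HypSpace ℝ n}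
    (hloc : ∀ z, ∃ h : OpenPartialHomeomorph N (HypSpace ℝ n), z ∈ h.source ∧
      ContMDiffOn 𝓘(ℝ, RSpace n) 𝓘(ℝ, RSpace n) ∞ h h.source ∧
      ContMDiffOn 𝓘(ℝ, RSpace n) 𝓘(ℝ, RSpace n) ∞ h.symm h.target ∧
      ∃ g : pseudoUnitary ℝ n, ∀ᶠ z' in 𝓝 z, h z' = g • D z') :
    ContMDiff 𝓘(ℝ, RSpace n) 𝓘(ℝ, RSpace n) ∞ D ∧
      ContMDiff 𝓘(ℝ, RSpace n) 𝓘(ℝ, RSpace n) ∞ D.symm := by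
  constructor
  · intro z
    obtain ⟨h, hz, hs, -, g, hg⟩ := hloc z
    -- Near `z` the map `D` is g⁻¹ ∘ h.
    have h1 : ContMDiffAt 𝓘(ℝ, RSpace n) 𝓘(ℝ, RSpace n) ∞ (fun z' => g⁻¹ • h z') z :=
      (contMDiff_smul_hypSpace g⁻¹).contMDiffAt.comp z (hs.contMDiffAt (h.open_source.mem_nhds hz))
    refine h1.congr_of_eventuallyEq ?_
    filter_upwards [hg] with z' hz'
    rw [hz', inv_smul_smul]
  · intro y
    obtain ⟨h, hz, -, hs, g, hg⟩ := hloc (D.symm y)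
    have hy : h (D.symm y) = g • y := by simpa using hg.self_of_nhds
    -- Near `y` the inverse of `D` is h⁻¹ ∘ g.
    have h1 : ContMDiffAt 𝓘(ℝ, RSpace n) 𝓘(ℝ, RSpace n) ∞ (fun y' => h.symm (g • y')) y := by
      refine ContMDiffAt.comp y ?_ (contMDiff_smul_hypSpace g).contMDiffAt
      exact hs.contMDiffAt (h.open_target.mem_nhds (hy ▸ h.map_source hz))
    refine h1.congr_of_eventuallyEq ?_
    filter_upwards [D.symm.continuous.continuousAt.tendsto hg,
      D.symm.continuous.continuousAt.tendsto (h.open_source.mem_nhds hz)] with y' hy1 hy2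
    have hy1' : h (D.symm y') = g • y' := by simpa using hy1
    rw [← hy1', h.left_inv hy2]

variable {Γ : Type*} [Group Γ] [MulAction Γ N] [ProperlyDiscontinuousSMul Γ N]
  {p : N → Q} {ρ : Γ →* specialPseudoUnitary ℝ n}

/-- The diffeomorphism `D` conjugates the action of `Γ` on `N` into that of ρ(Γ) on the ball, so
every property of `p` is transported to `p ∘ D.symm`. -/
lemma isUniformization_of_diffeo (hp : IsOrbifoldQuotientMap O Γ p) {D : N ≃ₜ HypSpace ℝ n}
    (hD : ContMDiff 𝓘(ℝ, RSpace n) 𝓘(ℝ, RSpace n) ∞ D)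
    (hD' : ContMDiff 𝓘(ℝ, RSpace n) 𝓘(ℝ, RSpace n) ∞ D.symm)
    (hρ : ∀ γ z, D (γ • z) = ρ γ • D z) : IsUniformization O ρ (p ∘ D.symm) where
  surjective := hp.surjective.comp D.symm.surjective
  apply_eq_iff x y := by
    simp only [Function.comp]
    rw [hp.apply_eq_iff]
    refine exists_congr fun γ => ?_
    rw [← D.injective.eq_iff, hρ, D.apply_symm_apply, D.apply_symm_apply]
  exists_lift x i u hxu := by
    obtain ⟨h, hh, hx, hxu⟩ := hp.exists_lift (D.symm x) i u hxu
    have h1 : IsSmoothLift (RSpace n) (RSpace n) (onTop (p ∘ D.symm)) (onTop p) id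
        D.symm.toOpenPartialHomeomorph :=
      { source_subset := fun _ _ => trivial
        target_subset := fun _ _ => trivial
        smooth := hD'.contMDiffOn
        smooth_symm := hD.contMDiffOn
        comm := fun x y _ hxy => congrArg p hxy.symm }
    have h2 := ((isSmoothLift_ballIncl_symm (p ∘ D.symm)).trans_id h1).trans_id hh
    refine ⟨_, h2, ?_, ?_⟩
    · have hx' : x.1 ∈ (ballIncl ℝ n).symm.source := by simp [ballIncl]
      simp only [OpenPartialHomeomorph.trans_source]
      refine ⟨⟨hx', trivial⟩, ?_⟩
      change D.symm ((ballIncl ℝ n).symm x.1) ∈ h.source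
      rwa [ballIncl_symm_coe x.2]
    · change h (D.symm ((ballIncl ℝ n).symm x.1)) = u.1
      rw [ballIncl_symm_coe x.2]
      exact hxu
  properlyDiscontinuous K L hK hL := by
    have hfin := ProperlyDiscontinuousSMul.finite_disjoint_inter_image (Γ := Γ)
      (hK.image D.symm.continuous) (hL.image D.symm.continuous)
    refine (hfin.image ρ).subset ?_
    rintro _ ⟨⟨γ, rfl⟩, _, ⟨x, hx, rfl⟩, hxL⟩
    refine ⟨γ, ⟨γ • D.symm x, ⟨_, ⟨x, hx, rfl⟩, rfl⟩, ⟨_, hxL, ?_⟩⟩, rfl⟩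
    change D.symm (ρ γ • x) = γ • D.symm x
    rw [D.symm_apply_eq, hρ, D.apply_symm_apply]

end CompleteOrbifold

/-- The quotient of `H^n_ℂ` by the holonomy group of a complete hyperbolic orbifold is
diffeomorphic to the tangent orbibundle. -/
theorem complexHyperbolicOrbifold_diffeo_tangentOrbibundle {n : ℕ} {Q : Type*} [TopologicalSpace Q]
    {O : Orbifold (RSpace n) Q} {S : HyperbolicOrbifoldStructure n O}
    {N : Type*} [TopologicalSpace N] [SimplyConnectedSpace N] [ChartedSpace (RSpace n) N]
    {Γ : Type*} [Group Γ] [MulAction Γ N] [ProperlyDiscontinuousSMul Γ N]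
    {p : N → Q} (hp : IsOrbifoldQuotientMap O Γ p) {dev : N → HypSpace ℝ n}
    (hdev : S.IsDevelopingMap p dev) (hcov : IsCoveringMap dev)
    {ρ : Γ →* specialPseudoUnitary ℝ n} (hρ : ∀ γ z, dev (γ • z) = ρ γ • dev z) :
    ∃ _ : ProperlyDiscontinuousSMul (kleinianGroup ρ) (HypSpace ℂ n),
      Nonempty (OrbifoldDiffeo (complexHyperbolicOrbifold (kleinianGroup ρ))
        O.tangentOrbibundle) := by
  obtain ⟨D, rfl⟩ := exists_homeomorph_of_isCoveringMap hcov
  obtain ⟨h1, h2⟩ := contMDiff_of_local_isometry (D := D) fun z => hdev.exists_local_isometry hp z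
  have hU := isUniformization_of_diffeo hp h1 h2 hρ
  have := hU.properlyDiscontinuous.kleinianGroup
  exact ⟨this, hU.nonempty_orbifoldDiffeo⟩

/-! ### The holonomy of a complete hyperbolic manifold -/

section Holonomy
variable {n : ℕ} {M N : Type*} [TopologicalSpace M] [TopologicalSpace N] [SimplyConnectedSpace N]
  {p : N → M} {hp : IsCoveringMap p} {z₀ : N} {D : N ≃ₜ HypSpace ℝ n}
  {ρ : (FundamentalGroup M (p z₀))ᵐᵒᵖ →* specialPseudoUnitary ℝ n}

/-- Every element of the fundamental group acts by a deck transformation. -/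
lemma IsHolonomy.exists_deck (hρ : IsHolonomy hp z₀ D ρ)
    (γ : (FundamentalGroup M (p z₀))ᵐᵒᵖ) :
    ∃ τ : N ≃ₜ N, (∀ z, p (τ z) = p z) ∧ τ z₀ = hp.monodromy γ.unop.toPath ⟨z₀, rfl⟩ ∧
      ∀ z, D (τ z) = ρ γ • D z := by
  -- Constructing deck transformations as lifts of `p` through itself requires this; it is inherited
  -- from the ball.
  have : LocallyPathConnectedSpace N := D.isOpenEmbedding.locallyPathConnectedSpace
  obtain ⟨τ, h1, h2⟩ := exists_deckTransformation hp (z := z₀)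
    (w := hp.monodromy γ.unop.toPath ⟨z₀, rfl⟩) (hp.monodromy γ.unop.toPath ⟨z₀, rfl⟩).2.symm
  exact ⟨τ, h1, h2, hρ γ.unop τ h1 h2⟩

/-- The simply connected covering is normal, so its fibres are orbits of deck transformations, and
each deck transformation is the action of some loop. -/
lemma IsHolonomy.apply_eq_iff (hρ : IsHolonomy hp z₀ D ρ) (x y : HypSpace ℝ n) :
    p (D.symm x) = p (D.symm y) ↔ ∃ γ, ρ γ • x = y := by
  have : LocallyPathConnectedSpace N := D.isOpenEmbedding.locallyPathConnectedSpace
  constructor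
  · intro h
    obtain ⟨τ, h1, h2⟩ := exists_deckTransformation hp h
    obtain ⟨γ, hγ⟩ := exists_monodromy_eq hp (h1 z₀)
    refine ⟨MulOpposite.op γ, ?_⟩
    have h3 := hρ γ τ h1 hγ (D.symm x)
    rw [h2, D.apply_symm_apply, D.apply_symm_apply] at h3
    exact h3.symm
  · rintro ⟨γ, rfl⟩
    obtain ⟨τ, h1, -, h3⟩ := hρ.exists_deck γ
    have h4 := h3 (D.symm x)
    rw [D.apply_symm_apply] at h4
    rw [← h4, D.symm_apply_apply, h1]

/-- A deck transformation with a fixed point is the identity. The loop then has trivial monodromy,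
so it is trivial. -/
lemma IsHolonomy.eq_one_of_smul_eq (hρ : IsHolonomy hp z₀ D ρ)
    (γ : (FundamentalGroup M (p z₀))ᵐᵒᵖ) (x : HypSpace ℝ n) (h : ρ γ • x = x) : ρ γ = 1 := by
  obtain ⟨τ, h1, h2, h3⟩ := hρ.exists_deck γ
  have h4 := h3 (D.symm x)
  rw [D.apply_symm_apply, h, ← D.eq_symm_apply] at h4
  have h5 : ⇑τ = id := hp.eq_of_comp_eq τ.continuous continuous_id (funext h1) (D.symm x) h4
  have h6 : hp.monodromy γ.unop.toPath ⟨z₀, rfl⟩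
      = hp.monodromy (1 : FundamentalGroup M (p z₀)).toPath ⟨z₀, rfl⟩ := by
    have h7 : hp.monodromy (1 : FundamentalGroup M (p z₀)).toPath ⟨z₀, rfl⟩ = ⟨z₀, rfl⟩ :=
      congrFun hp.monodromy_refl ⟨z₀, rfl⟩
    rw [h7]
    exact Subtype.ext (by rw [← h2, h5]; rfl)
  have h8 : γ = 1 := MulOpposite.unop_injective (eq_of_monodromy_eq hp h6)
  rw [h8, map_one]

end Holonomy

/-- A free action whose orbits are the fibres of a locally injective map to a Hausdorff space is
properly discontinuous. -/
lemma isProperlyDiscontinuousRep_of_free {n : ℕ} {M : Type*} [TopologicalSpace M] [T2Space M]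
    {Γ : Type*} [Group Γ] {ρ : Γ →* specialPseudoUnitary ℝ n} {q : HypSpace ℝ n → M}
    (hcont : Continuous q) (hinj : ∀ y, ∃ W ∈ 𝓝 y, Set.InjOn q W)
    (hq : ∀ x y, q x = q y ↔ ∃ γ, ρ γ • x = y)
    (hfree : ∀ γ (x : HypSpace ℝ n), ρ γ • x = x → ρ γ = 1) : IsProperlyDiscontinuousRep ρ := by
  intro K L hK hL
  -- The pairs in K × L that lie over one point of `M`. This set is compact because `M` is
  -- Hausdorff.
  let R : Set (HypSpace ℝ n × HypSpace ℝ n) := (K ×ˢ L) ∩ {a | q a.1 = q a.2}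
  have hR : IsCompact R := (hK.prod hL).inter_right
    (isClosed_eq (hcont.comp continuous_fst) (hcont.comp continuous_snd))
  -- Near a pair of `R`, one group element serves for all pairs in a common fibre: its value and the
  -- second entry lie in a set on which `q` is injective.
  have hloc : ∀ a : HypSpace ℝ n × HypSpace ℝ n, ∃ V : Set (HypSpace ℝ n × HypSpace ℝ n),
      a ∈ R → V ∈ 𝓝 a ∧ ∃ γ, ∀ b ∈ V, q b.1 = q b.2 → ρ γ • b.1 = b.2 := by
    intro a
    by_cases ha : a ∈ R
    · obtain ⟨γ, hγ⟩ := (hq a.1 a.2).1 ha.2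
      obtain ⟨W, hW, hWinj⟩ := hinj a.2
      refine ⟨{b | ρ γ • b.1 ∈ W ∧ b.2 ∈ W}, fun _ => ⟨?_, γ, ?_⟩⟩
      · have h1 : ContinuousAt (fun b : HypSpace ℝ n × HypSpace ℝ n => ρ γ • b.1) a :=
          ((continuous_const_smul (ρ γ)).comp continuous_fst).continuousAt
        exact Filter.inter_mem (h1 (by change W ∈ 𝓝 (ρ γ • a.1); rwa [hγ]))
          (continuous_snd.continuousAt hW)
      · intro b hb hqb
        exact hWinj hb.1 hb.2 (((hq b.1 _).2 ⟨γ, rfl⟩).symm.trans hqb)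
    · exact ⟨Set.univ, fun h => absurd h ha⟩
  choose V hV using hloc
  obtain ⟨t, ht, hcov⟩ := hR.elim_nhds_subcover V fun a ha => (hV a ha).1
  have hγ : ∀ a, ∃ γ, a ∈ R → ∀ b ∈ V a, q b.1 = q b.2 → ρ γ • b.1 = b.2 := by
    intro a
    by_cases ha : a ∈ R
    · obtain ⟨γ, h⟩ := (hV a ha).2
      exact ⟨γ, fun _ => h⟩
    · exact ⟨1, fun h => absurd h ha⟩
  choose δ hδ using hγ
  refine (t.finite_toSet.image fun a => ρ (δ a)).subset ?_
  rintro _ ⟨⟨γ, rfl⟩, _, ⟨x, hx, rfl⟩, hxL⟩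
  have hb : (x, ρ γ • x) ∈ R := ⟨⟨hx, hxL⟩, (hq _ _).2 ⟨γ, rfl⟩⟩
  obtain ⟨a, hat, hxa⟩ := Set.mem_iUnion₂.1 (hcov hb)
  refine ⟨a, hat, ?_⟩
  have h1 : ρ (δ a) • x = ρ γ • x := hδ a (ht a hat) _ hxa hb.2
  -- Two elements that agree at one point are equal, by freeness. So the finite subcover accounts
  -- for all elements.
  have h2 : ρ (γ⁻¹ * δ a) • x = x := by
    rw [map_mul, mul_smul, h1, map_inv, inv_smul_smul]
  have h3 := hfree _ x h2
  rw [map_mul, map_inv, inv_mul_eq_one] at h3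
  exact h3.symm

/-! ### Quotient manifolds -/

/-- A chart of `X` is the inclusion, so the chart of `Y` built from a local inverse of `f` has an
inverse that is a restriction of `f` itself. Applied to the projection to a quotient, this describes
all its charts. -/
lemma localInverse_chart_symm_apply {E : Type*} [NormedAddCommGroup E]
    {X : TopologicalSpace.Opens E} {Y : Type*} [TopologicalSpace Y] {f : X → Y}
    (hf : IsLocalHomeomorph f) (x : X) {u : E}
    (hu : u ∈ ((hf.localInverseAt x).trans (chartAt E x)).target) :
    ∃ h : u ∈ X, ((hf.localInverseAt x).trans (chartAt E x)).symm u = f ⟨u, h⟩ := by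
  rw [OpenPartialHomeomorph.trans_target] at hu
  have h1 : u ∈ (chartAt E x).target := hu.1
  have h2 : ((chartAt E x).symm u).1 = u := by
    have h3 := (chartAt E x).right_inv h1
    simpa [TopologicalSpace.Opens.chartAt_eq, chartAt_self_eq] using h3
  have h4 : u ∈ X := h2 ▸ Subtype.prop _
  refine ⟨h4, ?_⟩
  rw [OpenPartialHomeomorph.coe_trans_symm, Function.comp, Subtype.ext (a2 := ⟨u, h4⟩) h2,
    IsLocalHomeomorph.localInverseAt_symm]

lemma quotient_chart_symm_apply {E : Type*} [NormedAddCommGroup E] {X : TopologicalSpace.Opens E}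
    {Γ : Type*} [Group Γ] [MulAction Γ X] [T2Space X] [LocallyCompactSpace X]
    [ContinuousConstSMul Γ X] [ProperlyDiscontinuousSMul Γ X] [IsCancelSMul Γ X]
    {e : OpenPartialHomeomorph (MulAction.orbitRel.Quotient Γ X) E}
    (he : e ∈ atlas E (MulAction.orbitRel.Quotient Γ X)) {u : E} (hu : u ∈ e.target) :
    ∃ h : u ∈ X, e.symm u = Quotient.mk _ ⟨u, h⟩ := by
  obtain ⟨y, rfl⟩ := he
  exact localInverse_chart_symm_apply _ _ hu

section QuotientManifold
variable {E : Type*} [NormedAddCommGroup E] [NormedSpace ℝ E] {X : TopologicalSpace.Opens E}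
  {Γ : Type*} [Group Γ] [MulAction Γ X] [T2Space X] [LocallyCompactSpace X]
  [ContinuousConstSMul Γ X] [ProperlyDiscontinuousSMul Γ X] [IsCancelSMul Γ X]

/-- The projection to the quotient is given, in a chart and near a point, by an element of the
group. -/
lemma exists_smul_eq_quotient_chart
    (hs : ∀ γ : Γ, ∃ f : E → E, ContDiffOn ℝ ∞ f X ∧ ∀ x : X, f x = (γ • x).1)
    {e : OpenPartialHomeomorph (MulAction.orbitRel.Quotient Γ X) E}
    (he : e ∈ atlas E (MulAction.orbitRel.Quotient Γ X)) (x : X)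
    (hx : (Quotient.mk _ x : MulAction.orbitRel.Quotient Γ X) ∈ e.source) :
    ∃ f : E → E, ContDiffAt ℝ ∞ f x.1 ∧ f x.1 ∈ e.target ∧ ∀ᶠ u in 𝓝 x.1, f u ∈ e.target ∧
      ∃ h : u ∈ X, e.symm (f u) = (Quotient.mk _ ⟨u, h⟩ : MulAction.orbitRel.Quotient Γ X) ∧
        e (Quotient.mk _ ⟨u, h⟩) = f u := by
  have ht := e.map_source hx
  obtain ⟨hw, hwe⟩ := quotient_chart_symm_apply he ht
  rw [e.left_inv hx, Quotient.eq, MulAction.orbitRel_apply, MulAction.mem_orbit_iff] at hwe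
  obtain ⟨γ, hγ⟩ := hwe
  obtain ⟨f, hf, hfx⟩ := hs γ⁻¹
  have hfx0 : f x.1 = e (Quotient.mk _ x) := by
    have h : γ⁻¹ • x = ⟨e (Quotient.mk _ x), hw⟩ := by rw [inv_smul_eq_iff, hγ]
    rw [hfx, h]
  have hfc : ContDiffAt ℝ ∞ f x.1 := hf.contDiffAt (X.isOpen.mem_nhds x.2)
  have hmem : f x.1 ∈ e.target := hfx0 ▸ ht
  refine ⟨f, hfc, hmem, ?_⟩
  filter_upwards [X.isOpen.mem_nhds x.2, hfc.continuousAt (e.open_target.mem_nhds hmem)]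
    with u hu hfu
  have hfu' : f u ∈ e.target := hfu
  obtain ⟨h1, h2⟩ := quotient_chart_symm_apply he hfu'
  have h3 : e.symm (f u) = (Quotient.mk _ ⟨u, hu⟩ : MulAction.orbitRel.Quotient Γ X) := by
    rw [h2, Quotient.eq, MulAction.orbitRel_apply, MulAction.mem_orbit_iff]
    exact ⟨γ⁻¹, Subtype.ext (hfx ⟨u, hu⟩).symm⟩
  exact ⟨hfu', hu, h3, by rw [← h3, e.right_inv hfu']⟩

/-- The quotient of an open subset of a vector space by a free and properly discontinuous action
by diffeomorphisms is a smooth manifold. -/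
lemma isManifold_orbitRelQuotient
    (hs : ∀ γ : Γ, ∃ f : E → E, ContDiffOn ℝ ∞ f X ∧ ∀ x : X, f x = (γ • x).1) :
    IsManifold 𝓘(ℝ, E) ∞ (MulAction.orbitRel.Quotient Γ X) := by
  refine isManifold_of_contDiffOn _ _ _ fun e e' he he' => ?_
  simp only [modelWithCornersSelf_coe, modelWithCornersSelf_coe_symm, Function.comp_id,
    Function.id_comp, Set.preimage_id_eq, id_eq, Set.range_id, Set.inter_univ]
  intro u hu
  rw [OpenPartialHomeomorph.trans_source] at hu
  obtain ⟨hu1, hu2⟩ := hu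
  obtain ⟨hX, heu⟩ := quotient_chart_symm_apply he hu1
  have hu2' : e.symm u ∈ e'.source := hu2
  rw [heu] at hu2'
  obtain ⟨f, hf, -, hfe⟩ := exists_smul_eq_quotient_chart hs he' ⟨u, hX⟩ hu2'
  refine (hf.congr_of_eventuallyEq ?_).contDiffWithinAt
  filter_upwards [hfe, e.open_target.mem_nhds hu1] with w hw hwt
  obtain ⟨-, hwX, -, h2⟩ := hw
  obtain ⟨_, hew⟩ := quotient_chart_symm_apply he hwt
  rw [OpenPartialHomeomorph.coe_trans, Function.comp, hew, h2]

/-- Near a point, the projection is a group element followed by an inverse chart. -/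
lemma contMDiff_orbitRelQuotient_mk
    (hs : ∀ γ : Γ, ∃ f : E → E, ContDiffOn ℝ ∞ f X ∧ ∀ x : X, f x = (γ • x).1) :
    ContMDiff 𝓘(ℝ, E) 𝓘(ℝ, E) ∞
      (Quotient.mk _ : X → MulAction.orbitRel.Quotient Γ X) := by
  have := isManifold_orbitRelQuotient hs
  intro x
  let y : MulAction.orbitRel.Quotient Γ X := Quotient.mk _ x
  obtain ⟨f, hf, hft, hfe⟩ :=
    exists_smul_eq_quotient_chart hs (chart_mem_atlas E y) x (mem_chart_source E y)
  have h1 : ContMDiffAt 𝓘(ℝ, E) 𝓘(ℝ, E) ∞ (fun u : E => (chartAt E y).symm (f u)) x.1 :=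
    ((contMDiffOn_chart_symm (x := y)).contMDiffAt
      ((chartAt E y).open_target.mem_nhds hft)).comp x.1 hf.contMDiffAt
  refine (contMDiffAt_subtype_iff.2 h1).congr_of_eventuallyEq ?_
  filter_upwards [continuous_subtype_val.continuousAt.eventually hfe] with x' hx'
  obtain ⟨-, _, h2, -⟩ := hx'
  exact h2.symm

/-- A map on the quotient is smooth if its composition with the projection is smooth. -/
lemma contMDiff_of_comp_orbitRelQuotient_mk
    (hs : ∀ γ : Γ, ∃ f : E → E, ContDiffOn ℝ ∞ f X ∧ ∀ x : X, f x = (γ • x).1)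
    {E' H' Y : Type*} [NormedAddCommGroup E']
    [NormedSpace ℝ E'] [TopologicalSpace H'] {I : ModelWithCorners ℝ E' H'} [TopologicalSpace Y]
    [ChartedSpace H' Y] {F : MulAction.orbitRel.Quotient Γ X → Y}
    (hF : ContMDiff 𝓘(ℝ, E) I ∞ fun x : X => F (Quotient.mk _ x)) :
    ContMDiff 𝓘(ℝ, E) I ∞ F := by
  have := isManifold_orbitRelQuotient hs
  intro y
  let e := chartAt E y
  have hy : y ∈ e.source := mem_chart_source E y
  obtain ⟨hX, -⟩ := quotient_chart_symm_apply (chart_mem_atlas E y) (e.map_source hy)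
  have hne : Nonempty X := ⟨⟨_, hX⟩⟩
  -- The chart at `y`, read as a map into `X`, is a local section of the projection.
  have h1 : ContMDiffAt 𝓘(ℝ, E) I ∞ (fun y' => F (Quotient.mk _
      ((X.openPartialHomeomorphSubtypeCoe hne).symm (e y')))) y :=
    hF.contMDiffAt.comp y ((contMDiffAt_opensIncl_symm hne hX).comp y
      ((contMDiffOn_chart (x := y)).contMDiffAt (e.open_source.mem_nhds hy)))
  refine h1.congr_of_eventuallyEq ?_
  filter_upwards [e.open_source.mem_nhds hy] with y' hy'
  obtain ⟨hX', he⟩ := quotient_chart_symm_apply (chart_mem_atlas E y) (e.map_source hy')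
  rw [opensIncl_symm_coe hne hX', ← he]
  exact congrArg F (e.left_inv hy').symm

end QuotientManifold

/-! ### Tangent maps of local diffeomorphisms -/

section TangentMaps

lemma contMDiffOn_tangentMap_of_isOpen {E H M E' H' M' : Type*} [NormedAddCommGroup E]
    [NormedSpace ℝ E] [TopologicalSpace H] {I : ModelWithCorners ℝ E H} [TopologicalSpace M]
    [ChartedSpace H M] [IsManifold I 1 M] [NormedAddCommGroup E'] [NormedSpace ℝ E']
    [TopologicalSpace H'] {I' : ModelWithCorners ℝ E' H'} [TopologicalSpace M']
    [ChartedSpace H' M'] [IsManifold I' 1 M'] {f : M → M'} {s : Set M} (hs : IsOpen s)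
    (hf : ContMDiffOn I I' ∞ f s) :
    ContMDiffOn I.tangent I'.tangent ∞ (tangentMap I I' f)
      (Bundle.TotalSpace.proj ⁻¹' s : Set (TangentBundle I M)) := by
  refine (hf.contMDiffOn_tangentMapWithin (m := ∞) (by simp) hs.uniqueMDiffOn).congr ?_
  intro a ha
  simp only [tangentMap, tangentMapWithin]
  rw [mfderivWithin_of_isOpen hs ha]

lemma tangentMap_congr {E H M E' H' M' : Type*} [NormedAddCommGroup E]
    [NormedSpace ℝ E] [TopologicalSpace H] {I : ModelWithCorners ℝ E H} [TopologicalSpace M]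
    [ChartedSpace H M] [NormedAddCommGroup E'] [NormedSpace ℝ E']
    [TopologicalSpace H'] {I' : ModelWithCorners ℝ E' H'} [TopologicalSpace M']
    [ChartedSpace H' M'] {f f' : M → M'} {a : TangentBundle I M} (h : f =ᶠ[𝓝 a.1] f') :
    tangentMap I I' f a = tangentMap I I' f' a := by
  refine Bundle.TotalSpace.ext h.eq_of_nhds (heq_of_eq ?_)
  have h' : mfderiv I I' f a.1 = mfderiv I I' f' a.1 := h.mfderiv_eq
  change mfderiv I I' f a.1 a.2 = mfderiv I I' f' a.1 a.2
  rw [h']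
  rfl

/-- The identification of `E × E` with the tangent bundle of the vector space `E`. -/
def toTangentBundle {E : Type*} [NormedAddCommGroup E] [NormedSpace ℝ E] (a : E × E) :
    TangentBundle 𝓘(ℝ, E) E := ⟨a.1, a.2⟩

/-- The identification of the tangent bundle of the vector space `E` with `E × E`. -/
def ofTangentBundle {E : Type*} [NormedAddCommGroup E] [NormedSpace ℝ E]
    (a : TangentBundle 𝓘(ℝ, E) E) : E × E := (a.1, a.2)

lemma contMDiff_toTangentBundle {E : Type*} [NormedAddCommGroup E] [NormedSpace ℝ E] :
    ContMDiff 𝓘(ℝ, E × E) 𝓘(ℝ, E).tangent ∞ (toTangentBundle (E := E)) := by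
  intro a
  rw [Bundle.contMDiffAt_totalSpace]
  refine ⟨contDiffAt_fst.contMDiffAt, ?_⟩
  have h : ContMDiffAt 𝓘(ℝ, E × E) 𝓘(ℝ, E) ∞ (Prod.snd : E × E → E) a := contDiffAt_snd.contMDiffAt
  convert! h with b
  simp [toTangentBundle]
  rfl

lemma contMDiff_ofTangentBundle {E : Type*} [NormedAddCommGroup E] [NormedSpace ℝ E] :
    ContMDiff 𝓘(ℝ, E).tangent 𝓘(ℝ, E × E) ∞ (ofTangentBundle (E := E)) := by
  intro a
  rw [contMDiffAt_prod_module_iff]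
  exact ⟨(Bundle.contMDiff_proj _).contMDiffAt,
    (contMDiff_snd_tangentBundle_modelSpace E 𝓘(ℝ, E)).contMDiffAt⟩

end TangentMaps

/-! ### Manifolds covered by real hyperbolic space -/

/-- The map `φ` from the unit ball to the manifold `M` is a local diffeomorphism. -/
def IsBallLocalDiffeo {n : ℕ} {M : Type*} [TopologicalSpace M] [ChartedSpace (RSpace n) M]
    (φ : RSpace n → M) : Prop :=
  ∀ x ∈ hypBall ℝ n, ∃ k : OpenPartialHomeomorph (RSpace n) M, x ∈ k.source ∧
    k.source ⊆ hypBall ℝ n ∧ Set.EqOn φ k k.source ∧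
    ContMDiffOn 𝓘(ℝ, RSpace n) 𝓘(ℝ, RSpace n) ∞ k k.source ∧
    ContMDiffOn 𝓘(ℝ, RSpace n) 𝓘(ℝ, RSpace n) ∞ k.symm k.target

section CoveredManifold
variable {n : ℕ} {M : Type*} [TopologicalSpace M] [ChartedSpace (RSpace n) M]
  {φ : RSpace n → M}

/-- The chain rule. It is stated for `φ` instead of `k` because the global map to the tangent bundle
is built from `φ`, which agrees with `k` on its source. -/
lemma tangentMap_symm_tangentMap {k : OpenPartialHomeomorph (RSpace n) M}
    (hφ : Set.EqOn φ k k.source)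
    (hk : ContMDiffOn 𝓘(ℝ, RSpace n) 𝓘(ℝ, RSpace n) ∞ k k.source)
    (hk' : ContMDiffOn 𝓘(ℝ, RSpace n) 𝓘(ℝ, RSpace n) ∞ k.symm k.target)
    {a : TangentBundle 𝓘(ℝ, RSpace n) (RSpace n)} (ha : a.1 ∈ k.source) :
    tangentMap 𝓘(ℝ, RSpace n) 𝓘(ℝ, RSpace n) k.symm
      (tangentMap 𝓘(ℝ, RSpace n) 𝓘(ℝ, RSpace n) φ a) = a := by
  have h1 : φ =ᶠ[𝓝 a.1] k := hφ.eventuallyEq_of_mem (k.open_source.mem_nhds ha)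
  have h2 : MDifferentiableAt 𝓘(ℝ, RSpace n) 𝓘(ℝ, RSpace n) k a.1 :=
    (hk.contMDiffAt (k.open_source.mem_nhds ha)).mdifferentiableAt (by simp)
  have h3 : MDifferentiableAt 𝓘(ℝ, RSpace n) 𝓘(ℝ, RSpace n) k.symm (k a.1) :=
    (hk'.contMDiffAt (k.open_target.mem_nhds (k.map_source ha))).mdifferentiableAt (by simp)
  rw [tangentMap_congr h1, ← tangentMap_comp_at a h3 h2, tangentMap_congr (f' := id),
    tangentMap_id]
  · rfl
  · filter_upwards [k.open_source.mem_nhds ha] with y hy using k.left_inv hy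

lemma tangentMap_tangentMap_symm {k : OpenPartialHomeomorph (RSpace n) M}
    (hφ : Set.EqOn φ k k.source)
    (hk : ContMDiffOn 𝓘(ℝ, RSpace n) 𝓘(ℝ, RSpace n) ∞ k k.source)
    (hk' : ContMDiffOn 𝓘(ℝ, RSpace n) 𝓘(ℝ, RSpace n) ∞ k.symm k.target)
    {a : TangentBundle 𝓘(ℝ, RSpace n) M} (ha : a.1 ∈ k.target) :
    tangentMap 𝓘(ℝ, RSpace n) 𝓘(ℝ, RSpace n) φ
      (tangentMap 𝓘(ℝ, RSpace n) 𝓘(ℝ, RSpace n) k.symm a) = a := by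
  have hs := k.map_target ha
  have h1 : φ =ᶠ[𝓝 (k.symm a.1)] k := hφ.eventuallyEq_of_mem (k.open_source.mem_nhds hs)
  have h2 : MDifferentiableAt 𝓘(ℝ, RSpace n) 𝓘(ℝ, RSpace n) k (k.symm a.1) :=
    (hk.contMDiffAt (k.open_source.mem_nhds hs)).mdifferentiableAt (by simp)
  have h3 : MDifferentiableAt 𝓘(ℝ, RSpace n) 𝓘(ℝ, RSpace n) k.symm a.1 :=
    (hk'.contMDiffAt (k.open_target.mem_nhds ha)).mdifferentiableAt (by simp)
  rw [tangentMap_congr (a := tangentMap 𝓘(ℝ, RSpace n) 𝓘(ℝ, RSpace n) k.symm a) h1,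
    ← tangentMap_comp_at a h2 h3, tangentMap_congr (f' := id), tangentMap_id]
  · rfl
  · filter_upwards [k.open_target.mem_nhds ha] with y hy using k.right_inv hy

/-- The map from `H^n_ℂ` to the tangent bundle of `M` that is induced by the map from the unit ball
to `M`. -/
def ballTangentProj (φ : RSpace n → M) (z : HypSpace ℂ n) : TangentBundle 𝓘(ℝ, RSpace n) M :=
  tangentMap 𝓘(ℝ, RSpace n) 𝓘(ℝ, RSpace n) φ (toTangentBundle (complexToTangent z.1))

lemma IsBallLocalDiffeo.contMDiffOn (hφ : IsBallLocalDiffeo φ) :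
    ContMDiffOn 𝓘(ℝ, RSpace n) 𝓘(ℝ, RSpace n) ∞ φ (hypBall ℝ n) := by
  intro x hx
  obtain ⟨k, hxk, -, hk, hks, -⟩ := hφ x hx
  exact ((hks.contMDiffAt (k.open_source.mem_nhds hxk)).congr_of_eventuallyEq
    (hk.eventuallyEq_of_mem (k.open_source.mem_nhds hxk))).contMDiffWithinAt

lemma contMDiff_ballTangentProj [IsManifold 𝓘(ℝ, RSpace n) ∞ M] (hφ : IsBallLocalDiffeo φ) :
    ContMDiff 𝓘(ℝ, EuclideanSpace ℂ (Fin n)) 𝓘(ℝ, RSpace n).tangent ∞ (ballTangentProj φ) := by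
  have : IsManifold 𝓘(ℝ, RSpace n) 1 M := IsManifold.of_le (n := ∞) (by simp)
  intro z
  have h1 := contMDiffOn_tangentMap_of_isOpen (hypBall ℝ n).isOpen hφ.contMDiffOn
  have h2 : toTangentBundle (complexToTangent z.1)
      ∈ (Bundle.TotalSpace.proj ⁻¹' (hypBall ℝ n : Set (RSpace n)) :
        Set (TangentBundle 𝓘(ℝ, RSpace n) (RSpace n))) := complexToTangent_fst_mem z.2
  have h3 : IsOpen (Bundle.TotalSpace.proj ⁻¹' (hypBall ℝ n : Set (RSpace n)) :
      Set (TangentBundle 𝓘(ℝ, RSpace n) (RSpace n))) :=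
    (hypBall ℝ n).isOpen.preimage (FiberBundle.continuous_proj _ _)
  have h4 : ContMDiffAt 𝓘(ℝ, EuclideanSpace ℂ (Fin n)) 𝓘(ℝ, RSpace n).tangent ∞
      (fun u => tangentMap 𝓘(ℝ, RSpace n) 𝓘(ℝ, RSpace n) φ (toTangentBundle (complexToTangent u)))
      z.1 :=
    (h1.contMDiffAt (h3.mem_nhds h2)).comp z.1 (contMDiff_toTangentBundle.contMDiffAt.comp z.1
      (contDiffOn_complexToTangent.contDiffAt ((hypBall ℂ n).isOpen.mem_nhds z.2)).contMDiffAt)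
  exact contMDiffAt_subtype_iff.2 h4

variable {Γ : Type*} [Group Γ] {ρ : Γ →* specialPseudoUnitary ℝ n}

/-- On the ball φ ∘ g = φ for g in the group, so dφ ∘ dg = dφ; and g acts on H^n_ℂ through dg. -/
lemma ballTangentProj_smul (hφ : IsBallLocalDiffeo φ)
    (hq : ∀ x y : HypSpace ℝ n, φ x.1 = φ y.1 ↔ ∃ γ, ρ γ • x = y) (γ : Γ) (z : HypSpace ℂ n) :
    ballTangentProj φ (iotaSO n (ρ γ) • z) = ballTangentProj φ z := by
  have hx := complexToTangent_fst_mem z.2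
  set g := projMap (ρ γ).1.1.val with hg
  have hgd : ContMDiffAt 𝓘(ℝ, RSpace n) 𝓘(ℝ, RSpace n) ∞ g (complexToTangent z.1).1 :=
    ((projMap_contDiffOn (ρ γ).1.2).contDiffAt ((hypBall ℝ n).isOpen.mem_nhds hx)).contMDiffAt
  have hφd : ContMDiffAt 𝓘(ℝ, RSpace n) 𝓘(ℝ, RSpace n) ∞ φ (g (complexToTangent z.1).1) :=
    hφ.contMDiffOn.contMDiffAt ((hypBall ℝ n).isOpen.mem_nhds (projMap_mem (ρ γ).1.2 hx))
  have h1 : toTangentBundle (complexToTangent (iotaSO n (ρ γ) • z).1)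
      = tangentMap 𝓘(ℝ, RSpace n) 𝓘(ℝ, RSpace n) g (toTangentBundle (complexToTangent z.1)) := by
    rw [complexToTangent_smul, toTangentBundle, toTangentBundle, tangentMap, mfderiv_eq_fderiv]
    rfl
  rw [ballTangentProj, h1, ← tangentMap_comp_at (toTangentBundle (complexToTangent z.1))
    (hφd.mdifferentiableAt (by simp)) (hgd.mdifferentiableAt (by simp)), ballTangentProj]
  refine tangentMap_congr ?_
  filter_upwards [(hypBall ℝ n).isOpen.mem_nhds hx] with y hy
  exact ((hq ⟨y, hy⟩ (ρ γ • ⟨y, hy⟩)).2 ⟨γ, rfl⟩).symm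

/-- Equality of the base points in `M` yields a group element that makes the foot points in the ball
equal. There the differential of `φ` is injective, so the tangent vectors also agree. -/
lemma ballTangentProj_eq_iff (hφ : IsBallLocalDiffeo φ)
    (hq : ∀ x y : HypSpace ℝ n, φ x.1 = φ y.1 ↔ ∃ γ, ρ γ • x = y) (z w : HypSpace ℂ n) :
    ballTangentProj φ z = ballTangentProj φ w ↔ ∃ γ, iotaSO n (ρ γ) • z = w := by
  constructor
  · intro h
    obtain ⟨γ, hγ⟩ := (hq (realProj z) (realProj w)).1 (congrArg Bundle.TotalSpace.proj h)
    refine ⟨γ, ?_⟩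
    rw [← ballTangentProj_smul hφ hq γ z] at h
    obtain ⟨k, hk, -, hkφ, hks, hks'⟩ := hφ _ (realProj w).2
    have h1 : (complexToTangent (iotaSO n (ρ γ) • z).1).1 ∈ k.source := by
      have h2 := congrArg Subtype.val ((realProj_smul (ρ γ) z).trans hγ)
      change (complexToTangent (iotaSO n (ρ γ) • z).1).1 = _ at h2
      rw [h2]
      exact hk
    have h3 := congrArg (tangentMap 𝓘(ℝ, RSpace n) 𝓘(ℝ, RSpace n) k.symm) h
    rw [ballTangentProj, ballTangentProj, tangentMap_symm_tangentMap hkφ hks hks' h1,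
      tangentMap_symm_tangentMap hkφ hks hks' hk] at h3
    have h4 : complexToTangent (iotaSO n (ρ γ) • z).1 = complexToTangent w.1 :=
      congrArg ofTangentBundle h3
    refine Subtype.ext ?_
    rw [← tangentToComplex_complexToTangent (iotaSO n (ρ γ) • z).2, h4,
      tangentToComplex_complexToTangent w.2]
  · rintro ⟨γ, rfl⟩
    exact (ballTangentProj_smul hφ hq γ z).symm

/-- The local inverse of the map from `H^n_ℂ` to the tangent bundle. -/
lemma exists_ballTangentProj_inverse [IsManifold 𝓘(ℝ, RSpace n) ∞ M] (hφ : IsBallLocalDiffeo φ)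
    {x : RSpace n} (hx : x ∈ hypBall ℝ n) {y : TangentBundle 𝓘(ℝ, RSpace n) M} (hy : φ x = y.1) :
    ∃ s : TangentBundle 𝓘(ℝ, RSpace n) M → HypSpace ℂ n,
      ContMDiffAt 𝓘(ℝ, RSpace n).tangent 𝓘(ℝ, EuclideanSpace ℂ (Fin n)) ∞ s y ∧
      ∀ᶠ y' in 𝓝 y, ballTangentProj φ (s y') = y' := by
  have : IsManifold 𝓘(ℝ, RSpace n) 1 M := IsManifold.of_le (n := ∞) (by simp)
  obtain ⟨k, hk, hkb, hkφ, hks, hks'⟩ := hφ x hx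
  let V : Set (TangentBundle 𝓘(ℝ, RSpace n) M) := Bundle.TotalSpace.proj ⁻¹' k.target
  have hV : IsOpen V := k.open_target.preimage (FiberBundle.continuous_proj _ _)
  have hyV : y ∈ V := by
    change y.1 ∈ k.target
    rw [← hy, hkφ hk]
    exact k.map_source hk
  let T := tangentMap 𝓘(ℝ, RSpace n) 𝓘(ℝ, RSpace n) k.symm
  have hT : ContMDiffOn 𝓘(ℝ, RSpace n).tangent 𝓘(ℝ, RSpace n).tangent ∞ T V :=
    contMDiffOn_tangentMap_of_isOpen k.open_target hks'
  have hTb : ∀ y' ∈ V, (ofTangentBundle (T y')).1 ∈ hypBall ℝ n :=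
    fun y' hy' => hkb (k.map_target hy')
  have hTc : ∀ y' ∈ V, tangentToComplex (ofTangentBundle (T y')) ∈ hypBall ℂ n :=
    fun y' hy' => tangentToComplex_mem (hTb y' hy') _
  refine ⟨fun y' => (ballIncl ℂ n).symm (tangentToComplex (ofTangentBundle (T y'))), ?_, ?_⟩
  · refine ContMDiffAt.comp y (contMDiffAt_ballIncl_symm (hTc y hyV)) ?_
    refine ContMDiffAt.comp y (g := tangentToComplex) (contDiffOn_tangentToComplex.contDiffAt
      (((hypBall ℝ n).isOpen.prod isOpen_univ).mem_nhds ⟨hTb y hyV, trivial⟩)).contMDiffAt ?_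
    exact contMDiff_ofTangentBundle.contMDiffAt.comp y (hT.contMDiffAt (hV.mem_nhds hyV))
  · filter_upwards [hV.mem_nhds hyV] with y' hy'
    rw [ballIncl_symm_coe (hTc y' hy'), ballTangentProj]
    dsimp only
    rw [complexToTangent_tangentToComplex (hTb y' hy')]
    exact tangentMap_tangentMap_symm hkφ hks hks' hy'

/-- The quotient of `H^n_ℂ` is diffeomorphic to the tangent bundle of `M`. -/
lemma nonempty_diffeomorph_tangentBundle [IsManifold 𝓘(ℝ, RSpace n) ∞ M]
    [ProperlyDiscontinuousSMul (kleinianGroup ρ) (HypSpace ℂ n)]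
    [IsCancelSMul (kleinianGroup ρ) (HypSpace ℂ n)] (hφ : IsBallLocalDiffeo φ)
    (hsurj : ∀ m, ∃ x ∈ hypBall ℝ n, φ x = m)
    (hq : ∀ x y : HypSpace ℝ n, φ x.1 = φ y.1 ↔ ∃ γ, ρ γ • x = y) :
    IsManifold 𝓘(ℝ, EuclideanSpace ℂ (Fin n)) ∞
        (MulAction.orbitRel.Quotient (kleinianGroup ρ) (HypSpace ℂ n)) ∧
      Nonempty (Diffeomorph 𝓘(ℝ, EuclideanSpace ℂ (Fin n)) 𝓘(ℝ, RSpace n).tangent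
        (MulAction.orbitRel.Quotient (kleinianGroup ρ) (HypSpace ℂ n))
        (TangentBundle 𝓘(ℝ, RSpace n) M) ∞) := by
  have hs : ∀ γ : kleinianGroup ρ, ∃ f : EuclideanSpace ℂ (Fin n) → EuclideanSpace ℂ (Fin n),
      ContDiffOn ℝ ∞ f (hypBall ℂ n) ∧ ∀ x : HypSpace ℂ n, f x = (γ • x).1 :=
    fun γ => ⟨projMap γ.1.1.1.val, projMap_contDiffOn γ.1.1.2, fun _ => rfl⟩
  refine ⟨isManifold_orbitRelQuotient hs, ?_⟩
  let F : MulAction.orbitRel.Quotient (kleinianGroup ρ) (HypSpace ℂ n)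
      → TangentBundle 𝓘(ℝ, RSpace n) M :=
    Quotient.lift (ballTangentProj φ) fun z w h =>
      (ballTangentProj_eq_iff hφ hq z w).2 (orbit_kleinianGroup_iff.1 (Quotient.sound h))
  have hinj : Function.Injective F := by
    intro a b
    induction a using Quotient.inductionOn with | _ z
    induction b using Quotient.inductionOn with | _ w
    exact fun h => orbit_kleinianGroup_iff.2 ((ballTangentProj_eq_iff hφ hq z w).1 h)
  have hbij : Function.Bijective F := by
    refine ⟨hinj, fun y => ?_⟩
    obtain ⟨x, hx, hxy⟩ := hsurj y.1
    obtain ⟨s, -, hs⟩ := exists_ballTangentProj_inverse hφ hx hxy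
    exact ⟨Quotient.mk _ (s y), hs.self_of_nhds⟩
  refine ⟨{ toEquiv := Equiv.ofBijective F hbij
            contMDiff_toFun := contMDiff_of_comp_orbitRelQuotient_mk hs
              (contMDiff_ballTangentProj hφ)
            contMDiff_invFun := fun y => ?_ }⟩
  obtain ⟨x, hx, hxy⟩ := hsurj y.1
  obtain ⟨s, hsm, hsy⟩ := exists_ballTangentProj_inverse hφ hx hxy
  -- Near `y` the inverse map is the local inverse `s` followed by the projection to the quotient.
  refine ((contMDiff_orbitRelQuotient_mk hs).contMDiffAt.comp y hsm).congr_of_eventuallyEq ?_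
  filter_upwards [hsy] with y' hy'
  exact (Equiv.ofBijective F hbij).symm_apply_eq.2 hy'.symm

end CoveredManifold

/-! ### Complete hyperbolic manifolds -/

section CompleteManifold
variable {n : ℕ} {M N : Type*} [TopologicalSpace M] [ChartedSpace (RSpace n) M]
  [TopologicalSpace N] {p : N → M}

/-- The inverse of the developing map, followed by the covering map, is a local diffeomorphism. -/
lemma HyperbolicStructure.IsDevelopingMap.isBallLocalDiffeo {S : HyperbolicStructure n M}
    {D : N ≃ₜ HypSpace ℝ n} (hdev : S.IsDevelopingMap p D) (hp : Continuous p) :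
    IsBallLocalDiffeo fun x => p (D.symm ((ballIncl ℝ n).symm x)) := by
  intro x hx
  obtain ⟨e, he, hxe⟩ := S.cover (p (D.symm ⟨x, hx⟩))
  obtain ⟨g, hg⟩ := hdev e he _ hxe
  have hev : ∀ᶠ y in 𝓝 (⟨x, hx⟩ : HypSpace ℝ n),
      e (p (D.symm y)) = g • y ∧ p (D.symm y) ∈ e.source := by
    filter_upwards [D.symm.continuous.continuousAt.tendsto hg,
      (hp.comp D.symm.continuous).continuousAt (e.open_source.mem_nhds hxe)] with y h1 h2
    exact ⟨by simpa using h1, h2⟩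
  obtain ⟨A, hA, hAo, hxA⟩ := eventually_nhds_iff.1 hev
  -- Near `x` the composition of `e`, `p` and the inverse of `D` is `g`. So the map in question is
  -- e⁻¹ ∘ g there, and it has to be restricted to the set `A` where this holds.
  let k := (ballIncl ℝ n).symm.trans
    ((Homeomorph.smul g : HypSpace ℝ n ≃ₜ HypSpace ℝ n).toOpenPartialHomeomorph.trans e.symm)
  have hks : ∀ {y}, y ∈ k.source ↔
      ∃ hy : y ∈ hypBall ℝ n, g • (⟨y, hy⟩ : HypSpace ℝ n) ∈ e.target := by
    intro y
    have h1 : y ∈ k.source ↔ y ∈ hypBall ℝ n ∧ g • (ballIncl ℝ n).symm y ∈ e.target := by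
      simp [k, ballIncl]
    rw [h1]
    constructor
    · rintro ⟨hy, h⟩
      exact ⟨hy, by rwa [ballIncl_symm_coe hy] at h⟩
    · rintro ⟨hy, h⟩
      exact ⟨hy, by rwa [ballIncl_symm_coe hy]⟩
  have hkt : ∀ {m}, m ∈ k.target → m ∈ e.source := by
    intro m hm
    simp [k] at hm
    exact hm.1
  have hk : ContMDiffOn 𝓘(ℝ, RSpace n) 𝓘(ℝ, RSpace n) ∞ k k.source := by
    intro y hy
    obtain ⟨hyb, hyt⟩ := hks.1 hy
    refine ContMDiffAt.contMDiffWithinAt ?_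
    refine ContMDiffAt.comp y (g := fun z : HypSpace ℝ n => e.symm (g • z))
      (f := (ballIncl ℝ n).symm) ?_
      (contMDiffAt_ballIncl_symm hyb)
    rw [ballIncl_symm_coe hyb]
    exact ContMDiffAt.comp _ ((S.smooth_symm e he).contMDiffAt (e.open_target.mem_nhds hyt))
      (contMDiff_smul_hypSpace g).contMDiffAt
  have hk' : ContMDiffOn 𝓘(ℝ, RSpace n) 𝓘(ℝ, RSpace n) ∞ k.symm k.target := by
    intro m hm
    refine ContMDiffAt.contMDiffWithinAt ?_
    refine ContMDiffAt.comp m (g := Subtype.val) (f := fun m => g⁻¹ • e m)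
      contMDiff_subtype_val.contMDiffAt ?_
    exact (contMDiff_smul_hypSpace g⁻¹).contMDiffAt.comp m
      ((S.smooth e he).contMDiffAt (e.open_source.mem_nhds (hkt hm)))
  have hAv : IsOpen (Subtype.val '' A : Set (RSpace n)) :=
    (hypBall ℝ n).isOpen.isOpenMap_subtype_val A hAo
  refine ⟨k.restrOpen _ hAv, ?_, ?_, ?_, ?_, ?_⟩
  · refine ⟨hks.2 ⟨hx, ?_⟩, ⟨x, hx⟩, hxA, rfl⟩
    rw [← (hA _ hxA).1]
    exact e.map_source hxe
  · exact fun y hy => (hks.1 hy.1).1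
  · rintro _ ⟨-, y, hy, rfl⟩
    change p (D.symm ((ballIncl ℝ n).symm y.1)) = e.symm (g • (ballIncl ℝ n).symm y.1)
    rw [ballIncl_symm_coe y.2, ← (hA y hy).1, e.left_inv (hA y hy).2]
  · exact hk.mono fun y hy => hy.1
  · exact hk'.mono fun y hy => hy.1

/-- The quotient of `H^n_ℂ` by the holonomy group of a complete hyperbolic manifold is
diffeomorphic to the tangent bundle. -/
theorem diffeomorph_tangentBundle_of_isHolonomy [T2Space M] [ConnectedSpace M]
    [IsManifold 𝓘(ℝ, RSpace n) ∞ M] {S : HyperbolicStructure n M} [SimplyConnectedSpace N]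
    {hp : IsCoveringMap p} {z₀ : N} {dev : N → HypSpace ℝ n} (hdev : S.IsDevelopingMap p dev)
    (hcov : IsCoveringMap dev) {ρ : (FundamentalGroup M (p z₀))ᵐᵒᵖ →* specialPseudoUnitary ℝ n}
    (hρ : IsHolonomy hp z₀ dev ρ) :
    ∃ (_ : ProperlyDiscontinuousSMul (kleinianGroup ρ) (HypSpace ℂ n))
      (_ : IsCancelSMul (kleinianGroup ρ) (HypSpace ℂ n)),
      IsManifold 𝓘(ℝ, EuclideanSpace ℂ (Fin n)) ∞
        (MulAction.orbitRel.Quotient (kleinianGroup ρ) (HypSpace ℂ n)) ∧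
      Nonempty (Diffeomorph 𝓘(ℝ, EuclideanSpace ℂ (Fin n)) 𝓘(ℝ, RSpace n).tangent
        (MulAction.orbitRel.Quotient (kleinianGroup ρ) (HypSpace ℂ n))
        (TangentBundle 𝓘(ℝ, RSpace n) M) ∞) := by
  obtain ⟨D, rfl⟩ := exists_homeomorph_of_isCoveringMap hcov
  have : LocallyPathConnectedSpace M := ChartedSpace.locallyPathConnectedSpace (RSpace n) M
  have : PathConnectedSpace M := PathConnectedSpace.of_locallyPathConnectedSpace
  have hinj : ∀ y : HypSpace ℝ n, ∃ W ∈ 𝓝 y, Set.InjOn (p ∘ D.symm) W := fun y => by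
    obtain ⟨U, hU, hy, h⟩ := (hp.isLocalHomeomorph.comp
      D.symm.isLocalHomeomorph).isLocallyInjective y
    exact ⟨U, hU.mem_nhds hy, h⟩
  -- The fibres of the local homeomorphism `p ∘ D.symm` are the orbits of the free action, and `M`
  -- is Hausdorff.
  have hpd := (isProperlyDiscontinuousRep_of_free (hp.continuous.comp D.symm.continuous) hinj
    hρ.apply_eq_iff hρ.eq_one_of_smul_eq).kleinianGroup
  have hfree := isCancelSMul_kleinianGroup hρ.eq_one_of_smul_eq
  refine ⟨hpd, hfree, nonempty_diffeomorph_tangentBundle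
    (hdev.isBallLocalDiffeo hp.continuous) (fun m => ?_) fun x y => ?_⟩
  · obtain ⟨z, rfl⟩ := surjective_of_isCoveringMap hp m
    refine ⟨(D z).1, (D z).2, ?_⟩
    rw [ballIncl_symm_coe (D z).2]
    exact congrArg p (D.symm_apply_apply z)
  · rw [ballIncl_symm_coe x.2, ballIncl_symm_coe y.2]
    exact hρ.apply_eq_iff x y

end CompleteManifold

end

theorem mainTheorem5 (n : ℕ) (hn : 2 ≤ n) :
    -- manifolds
    (∀ (M : Type*) [TopologicalSpace M] [T2Space M] [ConnectedSpace M]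
      [ChartedSpace (RSpace n) M] [IsManifold 𝓘(ℝ, RSpace n) ∞ M]
      (S : HyperbolicStructure n M)
      -- the universal covering, with a base point
      (N : Type*) [TopologicalSpace N] [SimplyConnectedSpace N]
      (p : N → M) (hp : IsCoveringMap p) (z₀ : N)
      -- the structure is complete: its developing map is a covering map
      (dev : N → HypSpace ℝ n) (_ : S.IsDevelopingMap p dev) (_ : IsCoveringMap dev)
      (ρ : (FundamentalGroup M (p z₀))ᵐᵒᵖ →* specialPseudoUnitary ℝ n)
      (_ : IsHolonomy hp z₀ dev ρ),
      ∃ (_ : ProperlyDiscontinuousSMul (kleinianGroup ρ) (HypSpace ℂ n))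
        (_ : IsCancelSMul (kleinianGroup ρ) (HypSpace ℂ n)),
        IsManifold 𝓘(ℝ, EuclideanSpace ℂ (Fin n)) ∞
          (MulAction.orbitRel.Quotient (kleinianGroup ρ) (HypSpace ℂ n)) ∧
        Nonempty (Diffeomorph 𝓘(ℝ, EuclideanSpace ℂ (Fin n)) 𝓘(ℝ, RSpace n).tangent
          (MulAction.orbitRel.Quotient (kleinianGroup ρ) (HypSpace ℂ n))
          (TangentBundle 𝓘(ℝ, RSpace n) M) ∞)) ∧
    -- orbifolds
    (∀ (Q : Type*) [TopologicalSpace Q] [T2Space Q] (O : Orbifold (RSpace n) Q)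
      (S : HyperbolicOrbifoldStructure n O)
      -- the universal orbifold covering and the orbifold fundamental group
      (N : Type*) [TopologicalSpace N] [T2Space N] [SimplyConnectedSpace N]
      [ChartedSpace (RSpace n) N] [IsManifold 𝓘(ℝ, RSpace n) ∞ N]
      (Γ : Type*) [Group Γ] [MulAction Γ N] [FaithfulSMul Γ N] [ProperlyDiscontinuousSMul Γ N]
      (p : N → Q) (_ : IsOrbifoldQuotientMap O Γ p)
      -- the structure is complete: its developing map is a covering map
      (dev : N → HypSpace ℝ n) (_ : S.IsDevelopingMap p dev) (_ : IsCoveringMap dev)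
      (ρ : Γ →* specialPseudoUnitary ℝ n) (_ : ∀ γ z, dev (γ • z) = ρ γ • dev z),
      ∃ _ : ProperlyDiscontinuousSMul (kleinianGroup ρ) (HypSpace ℂ n),
        Nonempty (OrbifoldDiffeo (complexHyperbolicOrbifold (kleinianGroup ρ))
          O.tangentOrbibundle)) := by
  refine ⟨?_, ?_⟩
  · intro M _ _ _ _ _ S N _ _ p hp z₀ dev hdev hcov ρ hρ
    exact diffeomorph_tangentBundle_of_isHolonomy hdev hcov hρ
  · intro Q _ _ O S N _ _ _ _ _ Γ _ _ _ _ p hp dev hdev hcov ρ hρ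
    exact complexHyperbolicOrbifold_diffeo_tangentOrbibundle hp hdev hcov hρ
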